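/- For a constant $d\ge 0$, an instance of size $n$ of the problem $3\text{-SUM}$ consists of three lists $a_1,\dots,a_n$, $b_1,\dots,b_n$, $c_1,\dots,c_n$ of integers of $O(\log n)$ bits, namely of absolute value less than $2^{d(\lfloor \log_2 n\rfloor+1)}$ (with $\log_2 0$ read as $0$). A zero triple is a triple $(i,j,k)$ with $a_i+b_j+c_k=0$. As usual, $\tilde O(g(n))$ means $O(g(n)\log^{k} n)$ for some constant $k$. Algorithms are programs for a word RAM with words of $\Theta(\log n)$ bits, which performs an arithmetic operation on words, a memory access, or a comparison in unit time; randomized programs may in addition draw a uniformly random element of $\{0,\dots,m\}$ for a word $m\ge 0$ in unit time. **Theorem.** There is a nondeterministic proof for the complement of $3\text{-SUM}$ whose verifier runs in time $\tilde O(n^{1.5})$ and whose prover runs in expected time $\tilde O(n^{2})$. That is, for every $d$ there are a word length $w=\kappa(\lfloor\log_2 n\rfloor+1)$ with $\kappa$ constant, a deterministic program $V$ (the verifier) and a randomized program $P$ (the prover) such that, for every instance $I$ of size $n$: 1. for every proof string $\pi$ (a finite sequence of words), $V$ halts on $(I,\pi)$ within $\tilde O(n^{1.5})$ steps; 2. (soundness)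 if $I$ has a zero triple, then $V$ accepts $(I,\pi)$ for no $\pi$; 3. the expected running time of $P$ on $I$ is $\tilde O(n^{2})$; 4. (completeness) if $I$ has no zero triple, then every output $\pi$ that $P$ can produce on $I$ is a proof string such that $V$ accepts $(I,\pi)$. All bounds are uniform over the instances of size $n$. -/

import Mathlib

open Filter Asymptotics

/-! ## Soft-O -/

/-- `f = Õ(g)`: `f` is `O(g · logᵏ)` for some constant `k`. -/
def IsSoftO (f g : ℕ → ℝ) : Prop :=
  ∃ k : ℕ, f =O[atTop] fun n => g n * Real.log n ^ k

namespace WordRAM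

/-! ## A randomized word RAM

The machine has registers `0, 1, 2, …` and random-access arrays `0, 1, 2, …`; a program mentions
only finitely many of them. Every cell holds a signed `w`-bit word in two's complement, and
every arithmetic operation is reduced to such a word. Arrays are addressed by words. There is
also a write-only output tape. Programs are finite texts, independent of the input and of `w`. -/

/-- The signed `w`-bit word (an integer in `[-2^(w-1), 2^(w-1))`) congruent to `x` mod `2^w`. -/
def wrap (w : ℕ) (x : ℤ) : ℤ := x.bmod (2 ^ w)

/-- The binary word operations; comparisons return `1` for true and `0` for false. -/
inductive BinOp
  | add | sub | mul | div | mod | lt | eq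

/-- The exact integer result of an operation (division by `0` gives `0`, `x mod 0 = x`). -/
def BinOp.apply : BinOp → ℤ → ℤ → ℤ
  | .add, x, y => x + y
  | .sub, x, y => x - y
  | .mul, x, y => x * y
  | .div, x, y => x / y
  | .mod, x, y => x % y
  | .lt, x, y => if x < y then 1 else 0
  | .eq, x, y => if x = y then 1 else 0

/-- Expressions: constants, registers, array cells (`load k e` is cell `e` of array `k`), and
word operations. -/
inductive Expr
  | const (z : ℤ)
  | reg (x : ℕ)
  | load (k : ℕ) (e : Expr)
  | binop (o : BinOp) (e f : Expr)

/-- Structured programs.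
* `assign x e` writes the value of `e` into register `x`;
* `store k i e` writes the value of `e` into cell `i` of array `k`;
* `emit e` appends the value of `e` to the output tape;
* `rand x e` writes into register `x` a uniformly random element of `{0, …, m}`, where `m` is the
  value of `e` (`0` if that is negative), independently of all other draws;
* `branch e p q` runs `p` if `e` is nonzero and `q` otherwise;
* `loop e p` runs `p` as long as `e` is nonzero. -/
inductive Cmd
  | skip
  | assign (x : ℕ) (e : Expr)
  | store (k : ℕ) (i e : Expr)
  | emit (e : Expr)
  | rand (x : ℕ) (e : Expr)
  | seq (p q : Cmd)
  | branch (e : Expr) (p q : Cmd)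
  | loop (e : Expr) (p : Cmd)

/-- Deterministic programs: those without a `rand` command. -/
def Cmd.Deterministic : Cmd → Prop
  | .rand _ _ => False
  | .seq p q => p.Deterministic ∧ q.Deterministic
  | .branch _ p q => p.Deterministic ∧ q.Deterministic
  | .loop _ p => p.Deterministic
  | _ => True

/-- Contents of the registers, of the arrays, and of the output tape. -/
structure State where
  reg : ℕ → ℤ
  arr : ℕ → ℤ → ℤ
  out : List ℤ

/-- The value of an expression on a machine with `w`-bit words. -/
def Expr.eval (w : ℕ) (s : State) : Expr → ℤ
  | .const z => wrap w z
  | .reg x => s.reg x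
  | .load k e => s.arr k (e.eval w s)
  | .binop o e f => wrap w (o.apply (e.eval w s) (f.eval w s))

/-- A configuration: the commands that remain to be executed, in order, and the state. -/
structure Config where
  todo : List Cmd
  st : State

/-- The machine has halted when nothing remains to be executed. -/
def Config.Halted (c : Config) : Prop := c.todo = []

/-- The largest value `m` that the random draw of the next step can return; `0` if the next command
is not `rand`. -/
def Config.drawMax (w : ℕ) (c : Config) : ℕ :=
  match c.todo with
  | .rand _ e :: _ => (e.eval w c.st).toNat
  | _ => 0

/-- One time step, where `r` is the result of the random draw of this step (used by `rand` only).
A step executes one elementary command or one test of a condition; it performs at most as many word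
operations as the expressions occurring in it have symbols, a constant depending only on the
program. A halted configuration does not change. -/
def Config.step (w : ℕ) (c : Config) (r : ℕ) : Config :=
  match c.todo with
  | [] => c
  | .skip :: K => ⟨K, c.st⟩
  | .assign x e :: K => ⟨K, { c.st with reg := Function.update c.st.reg x (e.eval w c.st) }⟩
  | .store k i e :: K =>
      ⟨K, { c.st with
        arr := Function.update c.st.arr k
          (Function.update (c.st.arr k) (i.eval w c.st) (e.eval w c.st)) }⟩
  | .emit e :: K => ⟨K, { c.st with out := c.st.out ++ [e.eval w c.st] }⟩
  | .rand x _ :: K => ⟨K, { c.st with reg := Function.update c.st.reg x (r : ℤ) }⟩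
  | .seq p q :: K => ⟨p :: q :: K, c.st⟩
  | .branch e p q :: K => if e.eval w c.st ≠ 0 then ⟨p :: K, c.st⟩ else ⟨q :: K, c.st⟩
  | .loop e p :: K => if e.eval w c.st ≠ 0 then ⟨p :: .loop e p :: K, c.st⟩ else ⟨K, c.st⟩

/-- The configuration after `t` time steps of a deterministic computation. -/
def Config.run (w t : ℕ) (c : Config) : Config := (fun c => c.step w 0)^[t] c

/-- The distribution of the configuration after `t` time steps of a randomized computation. -/
noncomputable def Config.runDist (w : ℕ) : ℕ → Config → PMF Config
  | 0, c => PMF.pure c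
  | t + 1, c =>
      (PMF.uniformOfFinset (Finset.range (c.drawMax w + 1)) (by simp)).bind
        fun r => Config.runDist w t (c.step w r)

/-- The expected number of time steps until halting, `𝔼[T] = ∑ₜ ℙ(T > t)`. It is `∞` if the machine
fails to halt with positive probability. -/
noncomputable def Config.expectedTime (w : ℕ) (c : Config) : ENNReal :=
  ∑' t : ℕ, (c.runDist w t).toOuterMeasure {c' | ¬ c'.Halted}

/-- The array holding the words of a list in cells `0, 1, …`, and `0` in all other cells. -/
def arrayOf (w : ℕ) (l : List ℤ) : ℤ → ℤ :=
  fun i => if 0 ≤ i then wrap w (l.getD i.toNat 0) else 0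

end WordRAM

/-! ## 3-SUM -/

/-- A 3-SUM instance: three lists of `n` integers with absolute value less than
`2 ^ (d (⌊log₂ n⌋ + 1))`, that is, integers of `O(log n)` bits with implied constant `d`. -/
structure ThreeSumInstance (d n : ℕ) where
  a : Fin n → ℤ
  b : Fin n → ℤ
  c : Fin n → ℤ
  a_lt : ∀ i, |a i| < 2 ^ (d * (Nat.log 2 n + 1))
  b_lt : ∀ i, |b i| < 2 ^ (d * (Nat.log 2 n + 1))
  c_lt : ∀ i, |c i| < 2 ^ (d * (Nat.log 2 n + 1))

namespace ThreeSumInstance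

variable {d n : ℕ}

/-- The instance has a triple that sums to zero. -/
def HasZeroTriple (I : ThreeSumInstance d n) : Prop :=
  ∃ i j k, I.a i + I.b j + I.c k = 0

/-- Start of the program `p` on the instance `I` and the proof string `π` (a list of words): `n` is
in register `0`, the three lists are in arrays `0`, `1`, `2`, and `π` is in array `3`. All other cells
are `0` and the output tape is empty. -/
def start (I : ThreeSumInstance d n) (w : ℕ) (p : WordRAM.Cmd) (π : List ℤ) : WordRAM.Config where
  todo := [p]
  st :=
    { reg := fun x => if x = 0 then WordRAM.wrap w n else 0
      arr := fun k =>
        if k = 0 then WordRAM.arrayOf w (List.ofFn I.a)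
        else if k = 1 then WordRAM.arrayOf w (List.ofFn I.b)
        else if k = 2 then WordRAM.arrayOf w (List.ofFn I.c)
        else if k = 3 then WordRAM.arrayOf w π
        else fun _ => 0
      out := [] }

/-- The deterministic verifier `V` halts on the instance `I` and the proof string `π` with output
`1`. -/
def Accepts (I : ThreeSumInstance d n) (w : ℕ) (V : WordRAM.Cmd) (π : List ℤ) : Prop :=
  ∃ t, ((I.start w V π).run w t).Halted ∧ ((I.start w V π).run w t).st.out = [1]

end ThreeSumInstance

/-! Write X for `2 ^ lg n`, M for `modBound n` (about n^1.5) and F for `falseBound d n` (n^1.5 up to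
logarithms). A proof string consists of a modulus m ≤ M and the increasing list of all hits, that
is, of the codes of triples whose sum is divisible by m. The verifier checks that the list increases
and that each entry is a hit with nonzero sum. It then compares the length of the list with the
number of all hits, which it computes itself. If they agree, every hit is listed; a zero triple is a
hit for every m, so there is none (`ProofOk.sum_ne_zero`). This argument needs no primality of m.

The hits are counted in time Õ(M) without being listed. Let N be a power of two with 2M ≤ N ≤ 4M. A
triple is a hit if and only if the residues of its first two entries add up to one of two numbers
below 2m, so the hits are the solutions of two congruences modulo N (`solutions_add_solutions`). By
orthogonality of characters, the sum over all frequencies of the product of the Fourier transforms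
of three histograms is N times a number of solutions (`sum_dft_mul`). The transforms are computed by
the FFT in fixed-point arithmetic with scale X^64. All errors are bounded by much smaller powers of
X, so the result determines the integer (`countCmd_spec`).

Suitable moduli are frequent. A nonzero sum is at most X^(d+2) in absolute value and has at most
(d+2) lg n prime factors, so there are at most n^3 (d+2) lg n pairs of a prime and one of its false
positives. There are at least M / (8 lg n) primes up to M, because 2^M ≤ (M+1) lcm(1, …, M). Hence
at most half of these primes have F or more false positives, and a random modulus is good with
probability at least 1 / (16 lg n) (`modBound_le_mul_card_good`).

The prover draws moduli until one works. With the indices k bucketed by the residue of -c k, the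
hits of each pair (i, j) form a linked list. Since an attempt is aborted when it meets a hit after
listing F of them, it takes O(n^2 + M + F) steps (`attemptCmd_spec`), and O(log n) attempts are
expected (`Config.Rounds.truncTime_le`). Finding a zero triple also ends the search, so the time
bound holds for all instances.

Programs are analysed over unbounded integers with stored values at most B = `cellBound d n`. As 2
B^8 < 2^w, expressions of degree at most 8 do not overflow, and the analysis transfers to the
machine (`Exec.detSteps`). -/

namespace WordRAM

/-! ## Exact semantics -/

namespace Expr

instance : Add Expr := ⟨binop .add⟩
instance : Sub Expr := ⟨binop .sub⟩
instance : Mul Expr := ⟨binop .mul⟩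
instance : Div Expr := ⟨binop .div⟩
instance : Mod Expr := ⟨binop .mod⟩
instance (n : ℕ) : OfNat Expr n := ⟨const n⟩

/-- The comparison `e < f`. -/
def less (e f : Expr) : Expr := binop .lt e f

/-- The test `e = f`. -/
def equal (e f : Expr) : Expr := binop .eq e f

/-- The value of an expression over unbounded integers. -/
def val (s : State) : Expr → ℤ
  | const z => z
  | reg x => s.reg x
  | load k e => s.arr k (e.val s)
  | binop o e f => o.apply (e.val s) (f.val s)

/-- If all leaves have absolute value at most `B`, then an expression of degree `k ≤ 8` has absolute
value at most `B ^ k`. Cells of array `3` are unbounded, hence have a degree above `8`. -/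
def deg : Expr → ℕ
  | const _ => 1
  | reg _ => 1
  | load k _ => if k = 3 then 9 else 1
  | binop .add e f => max e.deg f.deg + 1
  | binop .sub e f => max e.deg f.deg + 1
  | binop .mul e f => e.deg + f.deg
  | binop .div e f => max e.deg f.deg
  | binop .mod e f => max e.deg f.deg
  | binop .lt _ _ => 1
  | binop .eq _ _ => 1

/-- A syntactic condition under which an expression is evaluated without overflow. -/
def Exact (B : ℤ) : Expr → Prop
  | const z => |z| ≤ B
  | reg _ => True
  | load _ e => e.Exact B
  | binop .lt e f => e.Exact B ∧ f.Exact B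
  | binop .eq e f => e.Exact B ∧ f.Exact B
  | binop o e f => e.Exact B ∧ f.Exact B ∧ (binop o e f).deg ≤ 8

section
variable (s : State) (B : ℤ) (e f : Expr) (n k : ℕ) (z : ℤ)

@[simp] theorem val_const : (const z).val s = z := rfl
@[simp] theorem val_ofNat : (no_index (OfNat.ofNat n) : Expr).val s = (OfNat.ofNat n : ℤ) := rfl
@[simp] theorem val_zero : (0 : Expr).val s = 0 := rfl
@[simp] theorem val_one : (1 : Expr).val s = 1 := rfl
@[simp] theorem val_reg : (reg n).val s = s.reg n := rfl
@[simp] theorem val_load : (load k e).val s = s.arr k (e.val s) := rfl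
@[simp] theorem val_add : (e + f).val s = e.val s + f.val s := rfl
@[simp] theorem val_sub : (e - f).val s = e.val s - f.val s := rfl
@[simp] theorem val_mul : (e * f).val s = e.val s * f.val s := rfl
@[simp] theorem val_div : (e / f).val s = e.val s / f.val s := rfl
@[simp] theorem val_mod : (e % f).val s = e.val s % f.val s := rfl
@[simp] theorem val_less_eq_zero : (less e f).val s = 0 ↔ f.val s ≤ e.val s := by
  simp [less, val, BinOp.apply]
@[simp] theorem val_equal_eq_zero : (equal e f).val s = 0 ↔ e.val s ≠ f.val s := by
  simp [equal, val, BinOp.apply]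

@[simp] theorem deg_const : (const z).deg = 1 := rfl
@[simp] theorem deg_ofNat : (no_index (OfNat.ofNat n) : Expr).deg = 1 := rfl
@[simp] theorem deg_reg : (reg n).deg = 1 := rfl
@[simp] theorem deg_load : (load k e).deg = if k = 3 then 9 else 1 := rfl
@[simp] theorem deg_add : (e + f).deg = max e.deg f.deg + 1 := rfl
@[simp] theorem deg_sub : (e - f).deg = max e.deg f.deg + 1 := rfl
@[simp] theorem deg_mul : (e * f).deg = e.deg + f.deg := rfl
@[simp] theorem deg_div : (e / f).deg = max e.deg f.deg := rfl
@[simp] theorem deg_mod : (e % f).deg = max e.deg f.deg := rfl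
@[simp] theorem deg_less : (less e f).deg = 1 := rfl
@[simp] theorem deg_equal : (equal e f).deg = 1 := rfl

@[simp] theorem exact_const : (const z).Exact B ↔ |z| ≤ B := Iff.rfl
@[simp] theorem exact_ofNat : (no_index (OfNat.ofNat n) : Expr).Exact B ↔ (OfNat.ofNat n : ℤ) ≤ B := by
  change |(n : ℤ)| ≤ B ↔ (n : ℤ) ≤ B
  simp
@[simp] theorem exact_reg : (reg n).Exact B ↔ True := Iff.rfl
@[simp] theorem exact_load : (load k e).Exact B ↔ e.Exact B := Iff.rfl
@[simp] theorem exact_add : (e + f).Exact B ↔ e.Exact B ∧ f.Exact B ∧ (e + f).deg ≤ 8 := Iff.rfl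
@[simp] theorem exact_sub : (e - f).Exact B ↔ e.Exact B ∧ f.Exact B ∧ (e - f).deg ≤ 8 := Iff.rfl
@[simp] theorem exact_mul : (e * f).Exact B ↔ e.Exact B ∧ f.Exact B ∧ (e * f).deg ≤ 8 := Iff.rfl
@[simp] theorem exact_div : (e / f).Exact B ↔ e.Exact B ∧ f.Exact B ∧ (e / f).deg ≤ 8 := Iff.rfl
@[simp] theorem exact_mod : (e % f).Exact B ↔ e.Exact B ∧ f.Exact B ∧ (e % f).deg ≤ 8 := Iff.rfl
@[simp] theorem exact_less : (less e f).Exact B ↔ e.Exact B ∧ f.Exact B := Iff.rfl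
@[simp] theorem exact_equal : (equal e f).Exact B ↔ e.Exact B ∧ f.Exact B := Iff.rfl

end

theorem one_le_deg : ∀ e : Expr, 1 ≤ e.deg
  | const _ => le_rfl
  | reg _ => le_rfl
  | load k e => by simp only [deg]; split <;> omega
  | binop .add e f => by simp only [deg]; omega
  | binop .sub e f => by simp only [deg]; omega
  | binop .mul e f => by have := one_le_deg e; simp only [deg]; omega
  | binop .div e f => by have := one_le_deg e; simp only [deg]; omega
  | binop .mod e f => by have := one_le_deg e; simp only [deg]; omega
  | binop .lt e f => le_rfl
  | binop .eq e f => le_rfl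

end Expr

/-- All registers and all arrays except array `3` have entries of absolute value at most `B`. -/
def State.Bdd (B : ℤ) (s : State) : Prop :=
  (∀ x, |s.reg x| ≤ B) ∧ ∀ k, k ≠ 3 → ∀ i, |s.arr k i| ≤ B

theorem wrap_eq_self {w : ℕ} {z : ℤ} (h : 2 * |z| < 2 ^ w) : wrap w z = z := by
  have h1 := neg_abs_le z
  have h2 := le_abs_self z
  apply Int.bmod_eq_of_le_mul_two <;> push_cast <;> omega

section
variable {B : ℤ} {w : ℕ}

/-- Exactness and size are proved in one induction: the size of the operands keeps the result below
B^8, where `wrap` is the identity. A sum costs one degree because 2 B^k ≤ B^(k+1); quotients and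
remainders do not exceed the larger operand. Comparisons need no size bound on their operands, so
the arbitrary words of array `3` may be compared, but not used in arithmetic. -/
theorem Expr.eval_eq_val (hB : 2 ≤ B) (hw : 2 * B ^ 8 < 2 ^ w) {s : State} (hs : s.Bdd B) :
    ∀ e : Expr, e.Exact B → e.eval w s = e.val s ∧ (e.deg ≤ 8 → |e.val s| ≤ B ^ e.deg) := by
  have hB1 : (1 : ℤ) ≤ B := by omega
  have hsmall : ∀ {z : ℤ} {k : ℕ}, k ≤ 8 → |z| ≤ B ^ k → wrap w z = z := by
    intro z k hk hz
    apply wrap_eq_self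
    have : B ^ k ≤ B ^ 8 := pow_le_pow_right₀ hB1 hk
    omega
  have hbool : ∀ (P : Prop) [Decidable P], |(if P then (1 : ℤ) else 0)| ≤ B ^ 1 := by
    intro P _
    split <;> simp <;> omega
  intro e
  induction e with
  | const z =>
    intro h
    have h' : |z| ≤ B ^ 1 := by simpa using h
    exact ⟨hsmall (by norm_num) h', fun _ => h'⟩
  | reg x => exact fun _ => ⟨rfl, fun _ => by simpa [Expr.deg, Expr.val] using hs.1 x⟩
  | load k e ih =>
    intro h
    refine ⟨by simp [Expr.eval, (ih h).1], fun hd => ?_⟩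
    by_cases hk : k = 3
    · simp [hk] at hd
    · simpa [hk] using hs.2 k hk _
  | binop o e f ihe ihf =>
    intro h
    have key : |o.apply (e.val s) (f.val s)| ≤ B ^ (Expr.binop o e f).deg →
        e.Exact B → f.Exact B → (Expr.binop o e f).deg ≤ 8 →
        (Expr.binop o e f).eval w s = (Expr.binop o e f).val s ∧
        ((Expr.binop o e f).deg ≤ 8 →
          |(Expr.binop o e f).val s| ≤ B ^ (Expr.binop o e f).deg) := by
      intro h1 h2 h3 h4
      refine ⟨?_, fun _ => h1⟩
      simp only [Expr.eval, Expr.val, (ihe h2).1, (ihf h3).1]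
      exact hsmall h4 h1
    have hmax : ∀ {k l : ℕ}, k ≤ l → B ^ k ≤ B ^ l := fun h => pow_le_pow_right₀ hB1 h
    cases o with
    | add =>
      obtain ⟨h2, h3, h4⟩ := h
      refine key ?_ h2 h3 h4
      simp only [Expr.deg] at h4 ⊢
      have a1 := (ihe h2).2 (by omega)
      have a2 := (ihf h3).2 (by omega)
      have a3 := hmax (le_max_left e.deg f.deg)
      have a4 := hmax (le_max_right e.deg f.deg)
      have := abs_add_le (e.val s) (f.val s)
      rw [pow_succ]
      simp only [BinOp.apply]
      nlinarith [pow_pos (show (0 : ℤ) < B by omega) (max e.deg f.deg)]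
    | sub =>
      obtain ⟨h2, h3, h4⟩ := h
      refine key ?_ h2 h3 h4
      simp only [Expr.deg] at h4 ⊢
      have a1 := (ihe h2).2 (by omega)
      have a2 := (ihf h3).2 (by omega)
      have a3 := hmax (le_max_left e.deg f.deg)
      have a4 := hmax (le_max_right e.deg f.deg)
      have := abs_sub (e.val s) (f.val s)
      rw [pow_succ]
      simp only [BinOp.apply]
      nlinarith [pow_pos (show (0 : ℤ) < B by omega) (max e.deg f.deg)]
    | mul =>
      obtain ⟨h2, h3, h4⟩ := h
      refine key ?_ h2 h3 h4
      simp only [Expr.deg] at h4 ⊢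
      have a1 := (ihe h2).2 (by have := f.one_le_deg; omega)
      have a2 := (ihf h3).2 (by have := e.one_le_deg; omega)
      simp only [BinOp.apply, abs_mul, pow_add]
      gcongr
    | div =>
      obtain ⟨h2, h3, h4⟩ := h
      refine key ?_ h2 h3 h4
      simp only [Expr.deg] at h4 ⊢
      have a1 := (ihe h2).2 (by omega)
      have a3 := hmax (le_max_left e.deg f.deg)
      have := Int.abs_ediv_le_abs (e.val s) (f.val s)
      simp only [BinOp.apply]
      omega
    | mod =>
      obtain ⟨h2, h3, h4⟩ := h
      refine key ?_ h2 h3 h4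
      simp only [Expr.deg] at h4 ⊢
      have a1 := (ihe h2).2 (by omega)
      have a2 := (ihf h3).2 (by omega)
      have a3 := hmax (le_max_left e.deg f.deg)
      have a4 := hmax (le_max_right e.deg f.deg)
      simp only [BinOp.apply]
      by_cases h0 : f.val s = 0
      · simp only [h0, Int.emod_zero]; omega
      · have b1 := Int.emod_nonneg (e.val s) h0
        have b2 := Int.emod_lt_abs (e.val s) h0
        rw [abs_of_nonneg b1]
        omega
    | lt => exact key (hbool _) h.1 h.2 (by simp [Expr.deg])
    | eq => exact key (hbool _) h.1 h.2 (by simp [Expr.deg])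

end

/-! ### State updates -/

namespace State

/-- Write `v` into register `x`. -/
def setReg (s : State) (x : ℕ) (v : ℤ) : State := { s with reg := Function.update s.reg x v }

/-- Write `v` into cell `i` of array `k`. -/
def setArr (s : State) (k : ℕ) (i v : ℤ) : State :=
  { s with arr := Function.update s.arr k (Function.update (s.arr k) i v) }

/-- Append `v` to the output tape. -/
def push (s : State) (v : ℤ) : State := { s with out := s.out ++ [v] }

variable (s : State) (x y k l : ℕ) (i j v : ℤ)

@[simp] theorem setReg_reg : (s.setReg x v).reg y = if y = x then v else s.reg y := by
  simp [setReg, Function.update_apply]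
@[simp] theorem setReg_arr : (s.setReg x v).arr = s.arr := rfl
@[simp] theorem setReg_out : (s.setReg x v).out = s.out := rfl
@[simp] theorem setArr_reg : (s.setArr k i v).reg = s.reg := rfl
@[simp] theorem setArr_arr :
    (s.setArr k i v).arr l j = if l = k ∧ j = i then v else s.arr l j := by
  simp only [setArr, Function.update_apply]
  by_cases h : l = k
  · subst h; simp [Function.update_apply]
  · simp [h]
theorem setArr_arr_of_ne (h : l ≠ k) : (s.setArr k i v).arr l = s.arr l := by
  simp [setArr, h]
@[simp] theorem setArr_out : (s.setArr k i v).out = s.out := rfl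
@[simp] theorem push_reg : (s.push v).reg = s.reg := rfl
@[simp] theorem push_arr : (s.push v).arr = s.arr := rfl
@[simp] theorem push_out : (s.push v).out = s.out ++ [v] := rfl

end State

/-! ### Syntactic conditions and frames -/

namespace Cmd

/-- The syntactic condition under which all expressions of a program are evaluated exactly. -/
def Exact (B : ℤ) : Cmd → Prop
  | skip => True
  | assign _ e => e.Exact B
  | store _ i e => i.Exact B ∧ e.Exact B
  | emit e => e.Exact B
  | rand _ e => e.Exact B
  | seq p q => p.Exact B ∧ q.Exact B
  | branch e p q => e.Exact B ∧ p.Exact B ∧ q.Exact B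
  | loop e p => e.Exact B ∧ p.Exact B

/-- The program may write register `x`. -/
def writesReg : Cmd → ℕ → Bool
  | assign x _, y => y == x
  | rand x _, y => y == x
  | seq p q, y => p.writesReg y || q.writesReg y
  | branch _ p q, y => p.writesReg y || q.writesReg y
  | loop _ p, y => p.writesReg y
  | _, _ => false

/-- The program may write array `k`. -/
def writesArr : Cmd → ℕ → Bool
  | store k _ _, l => l == k
  | seq p q, l => p.writesArr l || q.writesArr l
  | branch _ p q, l => p.writesArr l || q.writesArr l
  | loop _ p, l => p.writesArr l
  | _, _ => false

/-- The program may write to the output tape. -/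
def emits : Cmd → Bool
  | emit _ => true
  | seq p q => p.emits || q.emits
  | branch _ p q => p.emits || q.emits
  | loop _ p => p.emits
  | _ => false

/-- The states `s` and `s'` agree on everything that `p` cannot write. -/
structure Same (p : Cmd) (s s' : State) : Prop where
  reg : ∀ x, p.writesReg x = false → s'.reg x = s.reg x
  arr : ∀ k, p.writesArr k = false → s'.arr k = s.arr k
  out : p.emits = false → s'.out = s.out

theorem Same.refl (p : Cmd) (s : State) : p.Same s s := ⟨fun _ _ => rfl, fun _ _ => rfl, fun _ => rfl⟩

theorem Same.trans {p : Cmd} {s s' s'' : State} (h : p.Same s s') (h' : p.Same s' s'') :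
    p.Same s s'' :=
  ⟨fun x hx => (h'.reg x hx).trans (h.reg x hx), fun x hx => (h'.arr x hx).trans (h.arr x hx),
    fun hx => (h'.out hx).trans (h.out hx)⟩

theorem Same.mono {p q : Cmd} {s s' : State} (h : p.Same s s')
    (h1 : ∀ x, q.writesReg x = false → p.writesReg x = false)
    (h2 : ∀ x, q.writesArr x = false → p.writesArr x = false)
    (h3 : q.emits = false → p.emits = false) : q.Same s s' :=
  ⟨fun x hx => h.reg x (h1 x hx), fun x hx => h.arr x (h2 x hx), fun hx => h.out (h3 hx)⟩

end Cmd

/-- Big-step execution over unbounded integers of programs without randomness: `Exec B p s t s'`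
says that `p` takes `t` steps from `s` to `s'`, and that all values written on the way have absolute
value at most `B`. -/
inductive Exec (B : ℤ) : Cmd → State → ℕ → State → Prop
  | skip (s) : Exec B .skip s 1 s
  | assign (s x e) (h : |e.val s| ≤ B) : Exec B (.assign x e) s 1 (s.setReg x (e.val s))
  | store (s k i e) (h : |e.val s| ≤ B) : Exec B (.store k i e) s 1 (s.setArr k (i.val s) (e.val s))
  | emit (s e) : Exec B (.emit e) s 1 (s.push (e.val s))
  | seq {p q s s' s'' t t'} (h : Exec B p s t s') (h' : Exec B q s' t' s'') :
      Exec B (.seq p q) s (1 + t + t') s''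
  | branch_true {e p q s t s'} (he : e.val s ≠ 0) (h : Exec B p s t s') :
      Exec B (.branch e p q) s (1 + t) s'
  | branch_false {e p q s t s'} (he : e.val s = 0) (h : Exec B q s t s') :
      Exec B (.branch e p q) s (1 + t) s'
  | loop_false {e p s} (he : e.val s = 0) : Exec B (.loop e p) s 1 s
  | loop_true {e p s t s' t' s''} (he : e.val s ≠ 0) (h : Exec B p s t s')
      (h' : Exec B (.loop e p) s' t' s'') : Exec B (.loop e p) s (1 + t + t') s''

/-- `t` machine steps without random choices. -/
inductive DetSteps (w : ℕ) : ℕ → Config → Config → Prop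
  | zero (c) : DetSteps w 0 c c
  | succ {t c c'} (h : c.drawMax w = 0) (h' : DetSteps w t (c.step w 0) c') : DetSteps w (t + 1) c c'

theorem DetSteps.trans {w t t' : ℕ} {c c' c'' : Config} (h : DetSteps w t c c')
    (h' : DetSteps w t' c' c'') : DetSteps w (t + t') c c'' := by
  induction h with
  | zero => simpa using h'
  | succ h1 _ ih =>
    rw [Nat.add_right_comm]
    exact .succ h1 (ih h')

theorem DetSteps.one {w : ℕ} {c : Config} (h : c.drawMax w = 0) : DetSteps w 1 c (c.step w 0) :=
  .succ h (.zero _)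

theorem DetSteps.run_eq {w t : ℕ} {c c' : Config} (h : DetSteps w t c c') : c.run w t = c' := by
  induction h with
  | zero => rfl
  | succ h1 _ ih => exact ih

theorem Exec.bdd {B : ℤ} {p : Cmd} {s s' : State} {t : ℕ} (h : Exec B p s t s') (hs : s.Bdd B) :
    s'.Bdd B := by
  induction h with
  | skip => exact hs
  | assign s x e h =>
    refine ⟨fun y => ?_, hs.2⟩
    rw [State.setReg_reg]
    split
    · exact h
    · exact hs.1 y
  | store s k i e h =>
    refine ⟨hs.1, fun l hl j => ?_⟩
    rw [State.setArr_arr]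
    split
    · exact h
    · exact hs.2 l hl j
  | emit => exact hs
  | seq _ _ ih ih' => exact ih' (ih hs)
  | branch_true _ _ ih => exact ih hs
  | branch_false _ _ ih => exact ih hs
  | loop_false => exact hs
  | loop_true _ _ _ ih ih' => exact ih' (ih hs)

/-- Every state on the way is bounded by `Exec.bdd`, so the machine evaluates each expression
exactly. The conclusion is about `DetSteps`, which serves both the deterministic verifier and the
stretches of the prover between two random draws. -/
theorem Exec.detSteps {B : ℤ} {w : ℕ} (hB : 2 ≤ B) (hw : 2 * B ^ 8 < 2 ^ w) {p : Cmd} {s s' : State}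
    {t : ℕ} (h : Exec B p s t s') (hs : s.Bdd B) (hp : p.Exact B) (K : List Cmd) :
    DetSteps w t ⟨p :: K, s⟩ ⟨K, s'⟩ := by
  have ev : ∀ {s : State}, s.Bdd B → ∀ {e : Expr}, e.Exact B → e.eval w s = e.val s :=
    fun hs _ he => (Expr.eval_eq_val hB hw hs _ he).1
  induction h generalizing K with
  | skip s => exact DetSteps.one rfl
  | assign s x e h =>
    have := DetSteps.one (w := w) (c := ⟨.assign x e :: K, s⟩) rfl
    simpa [Config.step, State.setReg, State.setArr, State.push, ev hs hp] using this
  | store s k i e h =>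
    have := DetSteps.one (w := w) (c := ⟨.store k i e :: K, s⟩) rfl
    simpa [Config.step, State.setReg, State.setArr, State.push, ev hs hp.1, ev hs hp.2] using this
  | emit s e =>
    have := DetSteps.one (w := w) (c := ⟨.emit e :: K, s⟩) rfl
    simpa [Config.step, State.setReg, State.setArr, State.push, ev hs hp] using this
  | @seq p q s s' s'' t t' h _ ih ih' =>
    have := DetSteps.one (w := w) (c := ⟨.seq p q :: K, s⟩) rfl
    exact (this.trans (ih hs hp.1 _)).trans (ih' (h.bdd hs) hp.2 _)
  | @branch_true e p q s t s' he h ih =>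
    have := DetSteps.one (w := w) (c := ⟨.branch e p q :: K, s⟩) rfl
    simp only [Config.step, ev hs hp.1, he, ne_eq, not_false_eq_true, if_true] at this
    exact this.trans (ih hs hp.2.1 _)
  | @branch_false e p q s t s' he h ih =>
    have := DetSteps.one (w := w) (c := ⟨.branch e p q :: K, s⟩) rfl
    simp only [Config.step, ev hs hp.1, he, ne_eq, not_true_eq_false, if_false] at this
    exact this.trans (ih hs hp.2.2 _)
  | @loop_false e p s he =>
    have := DetSteps.one (w := w) (c := ⟨.loop e p :: K, s⟩) rfl
    simpa only [Config.step, ev hs hp.1, he, ne_eq, not_true_eq_false, if_false] using this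
  | @loop_true e p s t s' t' s'' he h _ ih ih' =>
    have := DetSteps.one (w := w) (c := ⟨.loop e p :: K, s⟩) rfl
    simp only [Config.step, ev hs hp.1, he, ne_eq, not_false_eq_true, if_true] at this
    exact (this.trans (ih hs hp.2 _)).trans (ih' (h.bdd hs) hp _)

/-- The frame rule. For concrete programs its side conditions are decided by computation, which is
why they are mostly discharged by `rfl`. -/
theorem Exec.same {B : ℤ} {p : Cmd} {s s' : State} {t : ℕ} (h : Exec B p s t s') : p.Same s s' := by
  induction h with
  | skip => exact .refl _ _
  | assign s x e h =>
    refine ⟨fun y hy => ?_, fun _ _ => rfl, fun _ => rfl⟩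
    have : y ≠ x := by simpa [Cmd.writesReg] using hy
    simp [this]
  | store s k i e h =>
    refine ⟨fun _ _ => rfl, fun l hl => ?_, fun _ => rfl⟩
    have : l ≠ k := by simpa [Cmd.writesArr] using hl
    exact s.setArr_arr_of_ne _ _ _ _ this
  | emit => exact ⟨fun _ _ => rfl, fun _ _ => rfl, by simp [Cmd.emits]⟩
  | seq _ _ ih ih' =>
    refine Cmd.Same.trans (ih.mono ?_ ?_ ?_) (ih'.mono ?_ ?_ ?_) <;>
      simp +contextual [Cmd.writesReg, Cmd.writesArr, Cmd.emits]
  | branch_true _ _ ih =>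
    refine ih.mono ?_ ?_ ?_ <;> simp +contextual [Cmd.writesReg, Cmd.writesArr, Cmd.emits]
  | branch_false _ _ ih =>
    refine ih.mono ?_ ?_ ?_ <;> simp +contextual [Cmd.writesReg, Cmd.writesArr, Cmd.emits]
  | loop_false => exact .refl _ _
  | loop_true _ _ _ ih ih' =>
    exact Cmd.Same.trans (ih.mono (by simp [Cmd.writesReg]) (by simp [Cmd.writesArr])
      (by simp [Cmd.emits])) ih'

/-! ## Hoare triples with time bounds -/

/-- From `s`, the program `p` halts within `T` steps in a state that satisfies `Q`. -/
def HT (B : ℤ) (p : Cmd) (T : ℕ) (s : State) (Q : State → Prop) : Prop :=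
  ∃ t ≤ T, ∃ s', Exec B p s t s' ∧ Q s'

namespace HT

variable {B : ℤ} {p q : Cmd} {s : State} {Q R : State → Prop} {T T₁ T₂ : ℕ} {e : Expr} {x b : ℕ}

theorem conseq (h : HT B p T₁ s R) (hT : T₁ ≤ T) (hQ : ∀ s', p.Same s s' → R s' → Q s') :
    HT B p T s Q := by
  obtain ⟨t, ht, s', h1, h2⟩ := h
  exact ⟨t, ht.trans hT, s', h1, hQ s' h1.same h2⟩

theorem assign (h : |e.val s| ≤ B) (hQ : Q (s.setReg x (e.val s))) : HT B (.assign x e) 1 s Q :=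
  ⟨1, le_rfl, _, .assign s x e h, hQ⟩

theorem store {k : ℕ} {i : Expr} (h : |e.val s| ≤ B) (hQ : Q (s.setArr k (i.val s) (e.val s))) :
    HT B (.store k i e) 1 s Q :=
  ⟨1, le_rfl, _, .store s k i e h, hQ⟩

theorem emit (hQ : Q (s.push (e.val s))) : HT B (.emit e) 1 s Q :=
  ⟨1, le_rfl, _, .emit s e, hQ⟩

theorem skip (hQ : Q s) : HT B .skip 1 s Q :=
  ⟨1, le_rfl, _, .skip s, hQ⟩

theorem seq (h : HT B p T₁ s R) (h' : ∀ s', p.Same s s' → R s' → HT B q T₂ s' Q)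
    (hT : 1 + T₁ + T₂ ≤ T) : HT B (.seq p q) T s Q := by
  obtain ⟨t, ht, s', h1, h2⟩ := h
  obtain ⟨t', ht', s'', h1', h2'⟩ := h' s' h1.same h2
  exact ⟨1 + t + t', by omega, s'', .seq h1 h1', h2'⟩

theorem assign_seq (h : |e.val s| ≤ B) (h' : HT B p T₁ (s.setReg x (e.val s)) Q)
    (hT : T₁ + 2 ≤ T) : HT B (.seq (.assign x e) p) T s Q := by
  obtain ⟨t, ht, s', h1, h2⟩ := h'
  exact ⟨1 + 1 + t, by omega, s', .seq (.assign s x e h) h1, h2⟩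

theorem store_seq {k : ℕ} {i : Expr} (h : |e.val s| ≤ B)
    (h' : HT B p T₁ (s.setArr k (i.val s) (e.val s)) Q)
    (hT : T₁ + 2 ≤ T) : HT B (.seq (.store k i e) p) T s Q := by
  obtain ⟨t, ht, s', h1, h2⟩ := h'
  exact ⟨1 + 1 + t, by omega, s', .seq (.store s k i e h) h1, h2⟩

theorem branch (h1 : e.val s ≠ 0 → HT B p T₁ s Q) (h2 : e.val s = 0 → HT B q T₁ s Q)
    (hT : T₁ + 1 ≤ T) : HT B (.branch e p q) T s Q := by
  by_cases h : e.val s = 0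
  · obtain ⟨t, ht, s', a, b⟩ := h2 h
    exact ⟨1 + t, by omega, s', .branch_false h a, b⟩
  · obtain ⟨t, ht, s', a, b⟩ := h1 h
    exact ⟨1 + t, by omega, s', .branch_true h a, b⟩

/-- The loop rule: the invariant carries the remaining time budget. -/
theorem loop (I : ℕ → State → Prop) (h0 : I T s)
    (hstep : ∀ τ s', (Cmd.loop e p).Same s s' → I τ s' → e.val s' ≠ 0 →
      ∃ c τ', τ' + c + 1 ≤ τ ∧ HT B p c s' (I τ'))
    (hpost : ∀ τ s', (Cmd.loop e p).Same s s' → I τ s' → e.val s' = 0 → 1 ≤ τ ∧ Q s') :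
    HT B (.loop e p) T s Q := by
  have main : ∀ τ s', (Cmd.loop e p).Same s s' → I τ s' → HT B (.loop e p) τ s' Q := by
    intro τ
    induction τ using Nat.strong_induction_on with
    | _ τ ih =>
      intro s' hs hI
      by_cases h : e.val s' = 0
      · obtain ⟨h1, h2⟩ := hpost τ s' hs hI h
        exact ⟨1, h1, s', .loop_false h, h2⟩
      · obtain ⟨c, τ', hτ, t, ht, s'', h1, h2⟩ := hstep τ s' hs hI h
        have hs' : (Cmd.loop e p).Same s s'' := hs.trans (h1.same.mono (by simp [Cmd.writesReg])
          (by simp [Cmd.writesArr]) (by simp [Cmd.emits]))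
        obtain ⟨t', ht', s₃, h1', h2'⟩ := ih τ' (by omega) s'' hs' h2
        exact ⟨1 + t + t', by omega, s₃, .loop_true h h1 h1', h2'⟩
  exact main T s (.refl _ _) h0

end HT

/-- `for x = 0, …, reg b - 1 do p`. -/
def Cmd.forLoop (x b : ℕ) (p : Cmd) : Cmd :=
  .seq (.assign x 0) (.loop (.less (.reg x) (.reg b)) (.seq p (.assign x (.reg x + 1))))

/-- The invariant refers to the moment of the loop test, so the body has to establish it for the
state in which the counter is already advanced. An iteration costs 3 steps beside the body: the
test, the unfolding of `seq` and the increment. The final 3 are the outer `seq`, the initialization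
and the failing test. -/
theorem HT.forLoop {B : ℤ} {p : Cmd} {s : State} {Q : State → Prop} {T₁ T : ℕ} {x b : ℕ}
    (N : ℕ) (Inv : ℕ → State → Prop) (hN : s.reg b = N) (hNB : (N : ℤ) ≤ B)
    (hx : p.writesReg x = false) (hb : (Cmd.forLoop x b p).writesReg b = false)
    (h0 : Inv 0 (s.setReg x 0))
    (hstep : ∀ i s', i < N → (Cmd.forLoop x b p).Same s s' → s'.reg x = i → Inv i s' →
      HT B p T₁ s' fun s'' => Inv (i + 1) (s''.setReg x ((i + 1 : ℕ) : ℤ)))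
    (hpost : ∀ s', (Cmd.forLoop x b p).Same s s' → s'.reg x = N → Inv N s' → Q s')
    (hT : N * (T₁ + 3) + 3 ≤ T) :
    HT B (.forLoop x b p) T s Q := by
  have hB : 0 ≤ B := le_trans (Int.natCast_nonneg N) hNB
  have hbx : b ≠ x := by
    rintro rfl
    simp [Cmd.forLoop, Cmd.writesReg] at hb
  -- Here `≤` is implication between predicates on states: being framed by the loop after the
  -- initialization implies being framed by the whole program.
  have hsub : (Cmd.loop (.less (.reg x) (.reg b)) (.seq p (.assign x (.reg x + 1)))).Same
      (s.setReg x 0) ≤ (Cmd.forLoop x b p).Same s := by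
    intro s' h
    refine ⟨fun y hy => ?_, fun k hk => ?_, fun ho => ?_⟩
    · have hyx : y ≠ x := by
        rintro rfl
        simp [Cmd.forLoop, Cmd.writesReg] at hy
      rw [h.reg y (by simp [Cmd.forLoop, Cmd.writesReg] at hy ⊢; tauto)]
      simp [hyx]
    · rw [h.arr k (by simpa [Cmd.forLoop, Cmd.writesArr] using hk)]
      simp
    · rw [h.out (by simpa [Cmd.forLoop, Cmd.emits] using ho)]
      simp
  refine HT.assign_seq (T₁ := N * (T₁ + 3) + 1) (by simpa using hB) ?_ (by omega)
  simp only [Expr.val_ofNat]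
  refine HT.loop (fun τ s' => ∃ i, i ≤ N ∧ s'.reg x = i ∧ Inv i s' ∧ τ = (N - i) * (T₁ + 3) + 1)
    ⟨0, by omega, by simp, h0, by simp⟩ ?_ ?_
  · rintro τ s' hs ⟨i, hi, hxi, hI, rfl⟩ hc
    have hs' := hsub _ hs
    have hbN : s'.reg b = N := (hs'.reg b hb).trans hN
    have hlt : i < N := by
      by_contra hge
      simp [hxi, hbN, hge] at hc
    refine ⟨T₁ + 2, (N - (i + 1)) * (T₁ + 3) + 1, ?_, ?_⟩
    · obtain ⟨k, rfl⟩ : ∃ k, N = i + 1 + k := ⟨N - (i + 1), by omega⟩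
      have e1 : i + 1 + k - i = k + 1 := by omega
      have e2 : i + 1 + k - (i + 1) = k := by omega
      rw [e1, e2, Nat.add_mul]
      omega
    · refine HT.seq (hstep i s' hlt hs' hxi hI) (T₂ := 1) (fun s'' hss hI' => ?_) (by omega)
      have hx'' : s''.reg x = i := (hss.reg x hx).trans hxi
      refine HT.assign ?_ ⟨i + 1, by omega, by simp [hx''], ?_, rfl⟩
      · simp only [Expr.val_add, Expr.val_reg, Expr.val_ofNat, hx'']
        rw [abs_of_nonneg (by positivity)]
        omega
      · simpa [hx''] using hI'
  · rintro τ s' hs ⟨i, hi, hxi, hI, rfl⟩ hc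
    have hs' := hsub _ hs
    have hbN : s'.reg b = N := (hs'.reg b hb).trans hN
    have hge : ¬ i < N := by
      intro hlt
      simp [hxi, hbN] at hc
      omega
    obtain rfl : i = N := by omega
    exact ⟨by omega, hpost s' hs' hxi hI⟩

/-! ## Parameters -/

/-- The number of bits of `n`. -/
def lg (n : ℕ) : ℕ := Nat.log 2 n + 1

theorem exists_le_mul_self (n : ℕ) : ∃ s, n ≤ s * s := ⟨n, Nat.le_mul_self n⟩

/-- The square root of `n`, rounded up. -/
def sqrtUp (n : ℕ) : ℕ := Nat.find (exists_le_mul_self n)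

/-- The upper bound for the moduli. -/
def modBound (n : ℕ) : ℕ := n * sqrtUp n + 1

/-- The constant factor in the bound for the number of false positives. -/
def falseConst (d : ℕ) : ℕ := 16 * (d + 2)

/-- The upper bound for the number of triples that a proof lists. -/
def falseBound (d n : ℕ) : ℕ := falseConst d * n * sqrtUp n * lg n * lg n + 1

/-- The bound for the absolute values of all intermediate results. -/
def cellBound (d n : ℕ) : ℤ := (2 ^ lg n) ^ (d + 140)

theorem one_le_lg (n : ℕ) : 1 ≤ lg n := Nat.succ_pos _

theorem lt_two_pow_lg (n : ℕ) : n < 2 ^ lg n := Nat.lt_pow_succ_log_self one_lt_two n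

theorem two_le_two_pow_lg (n : ℕ) : 2 ≤ 2 ^ lg n := by
  simpa using Nat.pow_le_pow_right two_pos (one_le_lg n)

theorem le_sqrtUp_mul_self (n : ℕ) : n ≤ sqrtUp n * sqrtUp n := Nat.find_spec (exists_le_mul_self n)

theorem sqrtUp_le (n : ℕ) : sqrtUp n ≤ n := Nat.find_le (Nat.le_mul_self n)

theorem mul_self_lt_of_lt_sqrtUp {n s : ℕ} (h : s < sqrtUp n) : s * s < n :=
  not_le.1 (Nat.find_min (exists_le_mul_self n) h)

theorem lg_le_two_pow_lg (n : ℕ) : lg n ≤ 2 ^ lg n := Nat.lt_two_pow_self.le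

theorem modBound_le (n : ℕ) : modBound n ≤ (2 ^ lg n) ^ 2 := by
  have h1 := lt_two_pow_lg n
  have h2 := sqrtUp_le n
  unfold modBound
  calc n * sqrtUp n + 1 ≤ n * n + 1 := by gcongr
    _ ≤ (n + 1) ^ 2 := by nlinarith
    _ ≤ _ := by gcongr; exact h1

theorem falseBound_le (d n : ℕ) : falseBound d n ≤ (2 ^ lg n) ^ (d + 10) := by
  have hX := two_le_two_pow_lg n
  have h1 := (lt_two_pow_lg n).le
  have h2 := (sqrtUp_le n).trans h1
  have h3 := lg_le_two_pow_lg n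
  have h4 : falseConst d ≤ (2 ^ lg n) ^ (d + 5) := by
    -- This gives 16 (d + 2) ≤ 32 (d + 1) ≤ 2^(d+5).
    have : d + 1 ≤ 2 ^ d := Nat.lt_two_pow_self
    calc falseConst d ≤ 2 ^ (d + 5) := by unfold falseConst; rw [pow_add]; omega
      _ ≤ _ := by gcongr
  set X := 2 ^ lg n
  unfold falseBound
  calc falseConst d * n * sqrtUp n * lg n * lg n + 1
      ≤ X ^ (d + 5) * X * X * X * X + X ^ (d + 9) := by
        gcongr
        exact Nat.one_le_pow _ _ (by omega)
    _ = X ^ (d + 9) * 2 := by ring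
    _ ≤ X ^ (d + 9) * X := by gcongr
    _ = X ^ (d + 10) := by ring

theorem pow_le_cellBound {d n k : ℕ} (hk : k ≤ d + 140) :
    ((2 : ℤ) ^ lg n) ^ k ≤ cellBound d n := by
  have : (2 : ℤ) ≤ 2 ^ lg n := by exact_mod_cast two_le_two_pow_lg n
  exact pow_le_pow_right₀ (by omega) hk

theorem natCast_le_cellBound {d n k v : ℕ} (hv : v ≤ (2 ^ lg n) ^ k) (hk : k ≤ d + 140) :
    (v : ℤ) ≤ cellBound d n :=
  le_trans (by exact_mod_cast hv) (pow_le_cellBound hk)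

theorem two_pow_le_cellBound {d n : ℕ} {k : ℕ} (hk : k ≤ d + 140) : (2 : ℤ) ^ k ≤ cellBound d n := by
  refine le_trans ?_ (pow_le_cellBound hk)
  have : (2 : ℤ) ≤ 2 ^ lg n := by exact_mod_cast two_le_two_pow_lg n
  gcongr

theorem le_cellBound_of_le {d n : ℕ} {z : ℤ} (h : z ≤ 2 ^ 120) : z ≤ cellBound d n :=
  h.trans (two_pow_le_cellBound (by omega))

/-- The registers `0, …, 5` contain `n` and the parameters that depend on it. -/
structure HasParams (d n : ℕ) (s : State) : Prop where
  r0 : s.reg 0 = n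
  r1 : s.reg 1 = sqrtUp n
  r2 : s.reg 2 = 2 ^ lg n
  r3 : s.reg 3 = lg n
  r4 : s.reg 4 = modBound n
  r5 : s.reg 5 = falseBound d n

theorem HasParams.of_same {d n : ℕ} {s s' : State} {p : Cmd} (h : HasParams d n s)
    (hs : p.Same s s') (h0 : p.writesReg 0 = false := by rfl)
    (h1 : p.writesReg 1 = false := by rfl) (h2 : p.writesReg 2 = false := by rfl)
    (h3 : p.writesReg 3 = false := by rfl) (h4 : p.writesReg 4 = false := by rfl)
    (h5 : p.writesReg 5 = false := by rfl) : HasParams d n s' :=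
  ⟨by rw [hs.reg _ h0, h.r0], by rw [hs.reg _ h1, h.r1], by rw [hs.reg _ h2, h.r2],
    by rw [hs.reg _ h3, h.r3], by rw [hs.reg _ h4, h.r4], by rw [hs.reg _ h5, h.r5]⟩

theorem HasParams.setReg {d n : ℕ} {s : State} (h : HasParams d n s) {x : ℕ} {v : ℤ}
    (hx : 5 < x := by norm_num) : HasParams d n (s.setReg x v) := by
  constructor <;> rw [State.setReg_reg, if_neg (by omega)]
  exacts [h.r0, h.r1, h.r2, h.r3, h.r4, h.r5]

open WordRAM.Expr WordRAM.Cmd in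
/-- Computes the parameters. -/
def paramsCmd (d : ℕ) : Cmd :=
  .seq (assign 1 0) <|
  .seq (loop (less (reg 1 * reg 1) (reg 0)) (assign 1 (reg 1 + 1))) <|
  .seq (assign 2 2) <|
  .seq (assign 3 1) <|
  .seq (loop (less (reg 2) (reg 0 + 1)) (.seq (assign 2 (2 * reg 2)) (assign 3 (reg 3 + 1)))) <|
  .seq (assign 4 (reg 0 * reg 1 + 1)) <|
  assign 5 (const (falseConst d) * reg 0 * reg 1 * reg 3 * reg 3 + 1)

-- The square root is found by counting upwards, which is affordable since it takes about √n steps;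
-- the power of two is found by doubling.
open WordRAM.Expr in
theorem paramsCmd_spec (d n : ℕ) (s : State) (h0 : s.reg 0 = n) :
    HT (cellBound d n) (paramsCmd d) (40 * modBound n * lg n) s (HasParams d n) := by
  have hX := two_le_two_pow_lg n
  have hn := lt_two_pow_lg n
  have hsn := sqrtUp_le n
  have hl := one_le_lg n
  have hM : 1 ≤ modBound n := Nat.succ_pos _
  have hsM : sqrtUp n ≤ modBound n := by
    rcases Nat.eq_zero_or_pos n with h | h
    · omega
    · unfold modBound; nlinarith
  have hT : 2 * sqrtUp n + 4 * lg n + 24 ≤ 40 * modBound n * lg n := by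
    have h1 : sqrtUp n ≤ modBound n * lg n := by nlinarith
    have h2 : lg n ≤ modBound n * lg n := by nlinarith
    nlinarith
  have bS : ∀ i, i ≤ sqrtUp n → (i : ℤ) ≤ cellBound d n := fun i hi =>
    natCast_le_cellBound (k := 1) (by rw [pow_one]; omega) (by omega)
  unfold paramsCmd
  refine HT.assign_seq (T₁ := 2 * sqrtUp n + 4 * lg n + 22)
    (by simpa using le_cellBound_of_le (by norm_num)) ?_ (by omega)
  refine HT.seq (T₁ := 2 * sqrtUp n + 1) (T₂ := 4 * lg n + 14)
    (R := fun s' => s'.reg 1 = sqrtUp n) ?_ ?_ (by omega)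
  · refine HT.loop (fun τ s' => ∃ i, i ≤ sqrtUp n ∧ s'.reg 1 = i ∧ τ = 2 * (sqrtUp n - i) + 1)
      ⟨0, by simp⟩ ?_ ?_
    · rintro τ s' hs ⟨i, hi, h1, rfl⟩ hc
      have h0' : s'.reg 0 = n := by simpa [h0] using hs.reg 0 rfl
      have hlt : i < sqrtUp n := by
        refine lt_of_le_of_ne hi ?_
        rintro rfl
        have := le_sqrtUp_mul_self n
        simp [h1, h0'] at hc
        norm_cast at hc
        omega
      refine ⟨1, 2 * (sqrtUp n - (i + 1)) + 1, by omega, HT.assign ?_ ⟨i + 1, by omega, ?_, rfl⟩⟩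
      · simpa [h1] using (abs_of_nonneg (by positivity)).trans_le (bS (i + 1) hlt)
      · simp [h1]
    · rintro τ s' hs ⟨i, hi, h1, rfl⟩ hc
      have h0' : s'.reg 0 = n := by simpa [h0] using hs.reg 0 rfl
      refine ⟨by omega, ?_⟩
      rcases hi.eq_or_lt with h | h
      · rw [h1, h]
      · have := mul_self_lt_of_lt_sqrtUp h
        simp [h1, h0'] at hc
        norm_cast at hc
        omega
  · intro s1 hs1 h1
    have h0' : s1.reg 0 = n := by simpa [h0] using hs1.reg 0 rfl
    refine HT.assign_seq (T₁ := 4 * lg n + 10)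
      (by simpa using le_cellBound_of_le (by norm_num)) ?_ (by omega)
    refine HT.assign_seq (T₁ := 4 * lg n + 8)
      (by simpa using le_cellBound_of_le (by norm_num)) ?_ (by omega)
    refine HT.seq (T₁ := 4 * (lg n - 1) + 1) (T₂ := 4)
      (R := fun s' => s'.reg 2 = 2 ^ lg n ∧ s'.reg 3 = lg n) ?_ ?_ (by omega)
    -- `lg n` is the least exponent e ≥ 1 with n < 2^e, also for n = 0; hence the doubling starts at
    -- 2^1 and the exponent is `i + 1`.
    · refine HT.loop (fun τ s' => ∃ i, i < lg n ∧ s'.reg 2 = 2 ^ (i + 1) ∧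
        s'.reg 3 = (i + 1 : ℕ) ∧ τ = 4 * (lg n - (i + 1)) + 1) ⟨0, by simp; omega⟩ ?_ ?_
      · rintro τ s' hs ⟨i, hi, h2, h3, rfl⟩ hc
        have h0'' : s'.reg 0 = n := by simpa [h0'] using hs.reg 0 rfl
        have hlt : i + 1 < lg n := by
          simp [h2, h0''] at hc
          norm_cast at hc
          unfold lg
          rcases Nat.eq_zero_or_pos n with h | h
          · have : 1 ≤ 2 ^ (i + 1) := Nat.one_le_two_pow
            rw [pow_succ] at *
            omega
          · have := Nat.le_log_of_pow_le one_lt_two hc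
            omega
        refine ⟨3, 4 * (lg n - (i + 2)) + 1, by omega, HT.assign_seq (T₁ := 1) ?_
          (HT.assign ?_ ⟨i + 1, by omega, ?_, ?_, rfl⟩) (by omega)⟩
        · simp only [val_mul, val_ofNat, val_reg, h2]
          rw [← pow_succ', abs_of_nonneg (by positivity)]
          refine le_trans (pow_le_pow_right₀ (by norm_num) (show i + 1 + 1 ≤ lg n by omega)) ?_
          simpa using pow_le_cellBound (d := d) (n := n) (k := 1) (by omega)
        · simp [h3]
          rw [abs_of_nonneg (by positivity)]
          exact_mod_cast natCast_le_cellBound (k := 1) (v := i + 1 + 1)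
            (by have := lg_le_two_pow_lg n; rw [pow_one]; omega) (by omega)
        · simp [h2, pow_succ']
        · simp [h3]
      · rintro τ s' hs ⟨i, hi, h2, h3, rfl⟩ hc
        have h0'' : s'.reg 0 = n := by simpa [h0'] using hs.reg 0 rfl
        have : i + 1 = lg n := by
          simp [h2, h0''] at hc
          norm_cast at hc
          rcases Nat.eq_zero_or_pos n with h | h
          · simp [lg, h] at hi ⊢
            omega
          · have := Nat.log_lt_of_lt_pow h.ne' (show n < 2 ^ (i + 1) by omega)
            unfold lg at *
            omega
        exact ⟨by omega, by rw [h2, this], by rw [h3, this]⟩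
    · rintro s2 hs2 ⟨h2, h3⟩
      have h0'' : s2.reg 0 = n := by simpa [h0'] using hs2.reg 0 rfl
      have h1' : s2.reg 1 = sqrtUp n := by simpa [h1] using hs2.reg 1 rfl
      refine HT.assign_seq (T₁ := 1) ?_ (HT.assign ?_ ?_) (by omega)
      · simp only [val_add, val_mul, val_reg, val_ofNat, h0'', h1']
        rw [abs_of_nonneg (by positivity)]
        exact_mod_cast natCast_le_cellBound (modBound_le n) (by omega)
      · simp [h0'', h1', h3]
        rw [abs_of_nonneg (by positivity)]
        exact_mod_cast natCast_le_cellBound (falseBound_le d n) (by omega)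
      · constructor <;> simp [h0'', h1', h2, h3, modBound, falseBound]

/-! ## The fast Fourier transform over the complex numbers -/

/-- The first `N`-th root of unity on the unit circle. -/
noncomputable def zeta (N : ℕ) : ℂ := Complex.exp (2 * Real.pi * Complex.I / N)

theorem zeta_isPrimitiveRoot {N : ℕ} (hN : N ≠ 0) : IsPrimitiveRoot (zeta N) N :=
  Complex.isPrimitiveRoot_exp N hN

theorem zeta_pow_self {N : ℕ} (hN : N ≠ 0) : zeta N ^ N = 1 := (zeta_isPrimitiveRoot hN).pow_eq_one

theorem norm_zeta_pow {N : ℕ} (hN : N ≠ 0) (k : ℕ) : ‖zeta N ^ k‖ = 1 := by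
  rw [norm_pow, Complex.norm_eq_one_of_pow_eq_one (zeta_pow_self hN) hN, one_pow]

theorem zeta_eq_cos_add_sin (N : ℕ) :
    zeta N = (Real.cos (2 * Real.pi / N) : ℂ) + (Real.sin (2 * Real.pi / N) : ℂ) * Complex.I := by
  rw [zeta, show (2 * Real.pi * Complex.I / N : ℂ) = ((2 * Real.pi / N : ℝ) : ℂ) * Complex.I by
    push_cast; ring, Complex.exp_mul_I]
  simp

/-- The cell with half-width `h` from which a step of the transform computes cell `o`. -/
def fftSrc (N h o : ℕ) : ℕ := o % h + (2 * h * (o / h)) % N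

/-- One step of the transform. -/
noncomputable def fftStep (N h : ℕ) (x : ℕ → ℂ) (o : ℕ) : ℂ :=
  x (fftSrc N h o) + zeta N ^ (o / h * h) * x (fftSrc N h o + h)

/-- The array after `l` steps of the transform of length `2 ^ K`. -/
noncomputable def fftLevel (K : ℕ) (x : ℕ → ℂ) : ℕ → ℕ → ℂ
  | 0 => x
  | l + 1 => fftStep (2 ^ K) (2 ^ (K - (l + 1))) (fftLevel K x l)

theorem sum_range_two_mul {M : Type*} [AddCommMonoid M] (f : ℕ → M) (n : ℕ) :
    ∑ u ∈ Finset.range (2 * n), f u = ∑ u ∈ Finset.range n, (f (2 * u) + f (2 * u + 1)) := by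
  induction n with
  | zero => simp
  | succ n ih =>
    rw [Nat.mul_succ, Finset.sum_range_succ, Finset.sum_range_succ, ih, Finset.sum_range_succ,
      add_assoc]

/-- The remainder modulo 2^K is taken of a multiple of 2h, and 2^K is 2^l times 2h; so it only
reduces the frequency o / h modulo 2^l. -/
theorem fftSrc_eq {K l h : ℕ} (hK : 2 ^ K = 2 ^ l * (2 * h)) (o : ℕ) :
    fftSrc (2 ^ K) h o = o % h + 2 * h * (o / h % 2 ^ l) := by
  rw [fftSrc, hK, mul_comm (2 ^ l), Nat.mul_mod_mul_left]

theorem fftSrc_add_lt {K l h : ℕ} (hK : 2 ^ K = 2 ^ l * (2 * h)) (hh : 0 < h) (o : ℕ) :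
    fftSrc (2 ^ K) h o + h < 2 ^ K := by
  rw [fftSrc_eq hK]
  have h1 := Nat.mod_lt o hh
  have h2 : o / h % 2 ^ l + 1 ≤ 2 ^ l := Nat.mod_lt _ (by positivity)
  calc _ < 2 * h * (o / h % 2 ^ l + 1) := by rw [Nat.mul_add]; omega
    _ ≤ 2 * h * 2 ^ l := Nat.mul_le_mul_left _ h2
    _ = _ := by rw [hK]; ring

/-- With h = 2^(K-l), cell o of level l holds the Fourier coefficient of frequency o / h of the
subsequence of x along the residue class of o modulo h. Splitting the sum into even and odd u splits
this class into two classes modulo 2h, whose coefficients are on the level before (Cooley–Tukey).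
With this placement the last level comes out in natural order, without bit reversal. -/
theorem fftLevel_eq (K : ℕ) (x : ℕ → ℂ) (l : ℕ) (hl : l ≤ K) (o : ℕ) (ho : o < 2 ^ K) :
    fftLevel K x l o = ∑ u ∈ Finset.range (2 ^ l), x (o % 2 ^ (K - l) + 2 ^ (K - l) * u) *
      zeta (2 ^ K) ^ (2 ^ (K - l) * u * (o / 2 ^ (K - l))) := by
  induction l generalizing o with
  | zero => simp [fftLevel, Nat.mod_eq_of_lt ho]
  | succ l ih =>
    obtain ⟨r, rfl⟩ : ∃ r, K = l + 1 + r := ⟨K - (l + 1), by omega⟩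
    have e1 : l + 1 + r - (l + 1) = r := by omega
    have e2 : l + 1 + r - l = r + 1 := by omega
    rw [e1]
    rw [e2] at ih
    simp only [fftLevel, fftStep, e1]
    set N := 2 ^ (l + 1 + r) with hN
    set h := 2 ^ r with hh
    have hhpos : 0 < h := by positivity
    have hK : N = 2 ^ l * (2 * h) := by rw [hN, hh]; ring
    have hlt := fftSrc_add_lt (hN ▸ hK) hhpos o
    rw [← hN] at hlt
    have hsrc := fftSrc_eq (hN ▸ hK) o
    rw [← hN] at hsrc
    have hmod := Nat.mod_lt o hhpos
    have hpow : (2 : ℕ) ^ (r + 1) = 2 * h := by rw [hh]; ring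
    rw [hpow] at ih
    have hp1 : fftSrc N h o % (2 * h) = o % h := by
      rw [hsrc, Nat.add_mul_mod_self_left, Nat.mod_eq_of_lt (by omega)]
    have hp2 : fftSrc N h o / (2 * h) = o / h % 2 ^ l := by
      rw [hsrc, Nat.add_mul_div_left _ _ (by omega), Nat.div_eq_of_lt (by omega), zero_add]
    have hq1 : (fftSrc N h o + h) % (2 * h) = o % h + h := by
      rw [hsrc, add_right_comm, Nat.add_mul_mod_self_left, Nat.mod_eq_of_lt (by omega)]
    have hq2 : (fftSrc N h o + h) / (2 * h) = o / h % 2 ^ l := by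
      rw [hsrc, add_right_comm, Nat.add_mul_div_left _ _ (by omega), Nat.div_eq_of_lt (by omega),
        zero_add]
    -- The power ζ^(2h) has order 2^l, so only the residue of the frequency modulo 2^l matters.
    have hz : ∀ u, zeta N ^ (2 * h * u * (o / h % 2 ^ l)) = zeta N ^ (2 * h * u * (o / h)) := by
      intro u
      conv_rhs => rw [← Nat.mod_add_div (o / h) (2 ^ l)]
      rw [mul_add, pow_add]
      have : 2 * h * u * (2 ^ l * (o / h / 2 ^ l)) = N * (u * (o / h / 2 ^ l)) := by rw [hK]; ring
      rw [this, pow_mul (zeta N) N, zeta_pow_self (pow_ne_zero _ two_ne_zero), one_pow, mul_one]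
    rw [ih (by omega) _ (by omega), ih (by omega) _ hlt, hp1, hp2, hq1, hq2]
    rw [pow_succ' 2 l, sum_range_two_mul, Finset.sum_add_distrib, Finset.mul_sum]
    congr 1
    · refine Finset.sum_congr rfl fun u _ => ?_
      rw [hz, show 2 * h * u = h * (2 * u) by ring]
    · refine Finset.sum_congr rfl fun u _ => ?_
      rw [hz, mul_left_comm, ← pow_add]
      congr 2
      · ring
      · ring

/-- The discrete Fourier transform of length `N`. -/
noncomputable def dft (N : ℕ) (x : ℕ → ℂ) (k : ℕ) : ℂ :=
  ∑ u ∈ Finset.range N, x u * zeta N ^ (u * k)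

theorem fftLevel_last (K : ℕ) (x : ℕ → ℂ) (o : ℕ) (ho : o < 2 ^ K) :
    fftLevel K x K o = dft (2 ^ K) x o := by
  rw [fftLevel_eq K x K le_rfl o ho]
  simp [dft, Nat.mod_one]

/-- Each cell of each level is a sum of distinct entries of x with coefficients of norm one. The
intermediate values therefore never exceed the sum of the norms, and the fixed-point numbers stay in
range. -/
theorem norm_fftLevel_le (K : ℕ) (x : ℕ → ℂ) (A : ℝ)
    (hA : ∑ u ∈ Finset.range (2 ^ K), ‖x u‖ ≤ A) (l : ℕ) (hl : l ≤ K) (o : ℕ) (ho : o < 2 ^ K) :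
    ‖fftLevel K x l o‖ ≤ A := by
  rw [fftLevel_eq K x l hl o ho]
  refine (norm_sum_le _ _).trans (le_trans ?_ hA)
  simp only [norm_mul, norm_zeta_pow (pow_ne_zero K two_ne_zero), mul_one]
  have hm : 0 < 2 ^ (K - l) := by positivity
  have hinj : Set.InjOn (fun u => o % 2 ^ (K - l) + 2 ^ (K - l) * u)
      (Finset.range (2 ^ l) : Set ℕ) := fun u _ v _ huv => by
    have : 2 ^ (K - l) * u = 2 ^ (K - l) * v := by simpa using huv
    exact Nat.eq_of_mul_eq_mul_left hm this
  rw [← Finset.sum_image (f := fun u => ‖x u‖) hinj]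
  refine Finset.sum_le_sum_of_subset_of_nonneg ?_ fun _ _ _ => norm_nonneg _
  intro v hv
  simp only [Finset.mem_image, Finset.mem_range] at hv ⊢
  obtain ⟨u, hu, rfl⟩ := hv
  have h1 := Nat.mod_lt o hm
  calc _ < 2 ^ (K - l) * (u + 1) := by rw [Nat.mul_add]; omega
    _ ≤ 2 ^ (K - l) * 2 ^ l := Nat.mul_le_mul_left _ hu
    _ = 2 ^ K := by rw [← pow_add]; congr 1; omega

/-- The number of `i < n` with `f i = u`. -/
def histogram (n : ℕ) (f : ℕ → ℕ) (u : ℕ) : ℕ := ((Finset.range n).filter fun i => f i = u).card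

theorem sum_histogram_mul (n N : ℕ) (f : ℕ → ℕ) (hf : ∀ i < n, f i < N) (g : ℕ → ℂ) :
    ∑ u ∈ Finset.range N, (histogram n f u : ℂ) * g u = ∑ i ∈ Finset.range n, g (f i) := by
  rw [← Finset.sum_fiberwise_of_maps_to (s := Finset.range n) (t := Finset.range N) (g := f)
    (fun i hi => by simpa using hf i (by simpa using hi))]
  refine Finset.sum_congr rfl fun u _ => ?_
  rw [Finset.sum_congr rfl (g := fun _ => g u)
    (fun i hi => by rw [(Finset.mem_filter.1 hi).2])]
  simp [histogram]

theorem sum_histogram (n N : ℕ) (f : ℕ → ℕ) (hf : ∀ i < n, f i < N) :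
    ∑ u ∈ Finset.range N, histogram n f u = n := by
  have := sum_histogram_mul n N f hf fun _ => 1
  simp only [mul_one, Finset.sum_const, Finset.card_range, nsmul_eq_mul] at this
  exact_mod_cast this

theorem dft_histogram (n N : ℕ) (f : ℕ → ℕ) (hf : ∀ i < n, f i < N) (k : ℕ) :
    dft N (fun u => histogram n f u) k = ∑ i ∈ Finset.range n, zeta N ^ (f i * k) :=
  sum_histogram_mul n N f hf fun u => zeta N ^ (u * k)

/-! ### Orthogonality of characters and the number of solutions -/

theorem sum_zeta_pow {N : ℕ} (hN : N ≠ 0) (e : ℕ) :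
    ∑ t ∈ Finset.range N, zeta N ^ (e * t) = if N ∣ e then (N : ℂ) else 0 := by
  have h := zeta_isPrimitiveRoot hN
  simp only [pow_mul]
  split_ifs with hd
  · rw [(h.pow_eq_one_iff_dvd e).2 hd]; simp
  · have h1 : zeta N ^ e ≠ 1 := fun h' => hd ((h.pow_eq_one_iff_dvd e).1 h')
    rw [geom_sum_eq h1, ← pow_mul, mul_comm, pow_mul, h.pow_eq_one, one_pow, sub_self, zero_div]

/-- The number of solutions of `f i + g j + h k ≡ 0` modulo `N`. -/
def solutions (n N : ℕ) (f g h : ℕ → ℕ) : ℕ :=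
  ∑ i ∈ Finset.range n, ∑ j ∈ Finset.range n, ∑ k ∈ Finset.range n,
    if N ∣ f i + g j + h k then 1 else 0

/-- The product expands into the characters ζ^((f i + g j + h k) t), and summing over t leaves N for
each solution and 0 otherwise. Only the total over all frequencies is needed, so there is no inverse
transform. -/
theorem sum_dft_mul {N : ℕ} (hN : N ≠ 0) (n : ℕ) (f g h : ℕ → ℕ) (hf : ∀ i < n, f i < N)
    (hg : ∀ i < n, g i < N) (hh : ∀ i < n, h i < N) :
    ∑ t ∈ Finset.range N, dft N (fun u => histogram n f u) t * dft N (fun u => histogram n g u) t *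
      dft N (fun u => histogram n h u) t = N * solutions n N f g h := by
  simp only [dft_histogram _ _ _ hf, dft_histogram _ _ _ hg, dft_histogram _ _ _ hh]
  have key : ∀ t, (∑ i ∈ Finset.range n, zeta N ^ (f i * t)) *
      (∑ i ∈ Finset.range n, zeta N ^ (g i * t)) * (∑ i ∈ Finset.range n, zeta N ^ (h i * t)) =
      ∑ i ∈ Finset.range n, ∑ j ∈ Finset.range n, ∑ k ∈ Finset.range n,
        zeta N ^ ((f i + g j + h k) * t) := by
    intro t
    rw [Finset.sum_mul_sum, Finset.sum_mul]
    refine Finset.sum_congr rfl fun i _ => ?_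
    rw [Finset.sum_mul]
    refine Finset.sum_congr rfl fun j _ => ?_
    rw [Finset.mul_sum]
    refine Finset.sum_congr rfl fun k _ => ?_
    rw [← pow_add, ← pow_add]
    congr 1
    ring
  simp only [key]
  simp only [solutions, Nat.cast_sum, Finset.mul_sum]
  rw [Finset.sum_comm]
  refine Finset.sum_congr rfl fun i _ => ?_
  rw [Finset.sum_comm]
  refine Finset.sum_congr rfl fun j _ => ?_
  rw [Finset.sum_comm]
  refine Finset.sum_congr rfl fun k _ => ?_
  rw [sum_zeta_pow hN]
  simp

/-! ## Fixed-point approximations -/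

/-- The pair `u + v i` divided by the scale `S` approximates `z` with error `e / S`. -/
def Approx (S : ℤ) (e : ℝ) (z : ℂ) (u v : ℤ) : Prop :=
  ‖((u : ℂ) + (v : ℂ) * Complex.I) - S * z‖ ≤ e

namespace Approx

variable {S : ℤ} {e e' b b' : ℝ} {z z' : ℂ} {u v u' v' : ℤ}

theorem mono (h : Approx S e z u v) (he : e ≤ e') : Approx S e' z u v := le_trans h he

theorem add (h : Approx S e z u v) (h' : Approx S e' z' u' v') :
    Approx S (e + e') (z + z') (u + u') (v + v') := by
  unfold Approx at *
  have : (((u + u' : ℤ) : ℂ) + ((v + v' : ℤ) : ℂ) * Complex.I) - S * (z + z') =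
      (((u : ℂ) + (v : ℂ) * Complex.I) - S * z) + (((u' : ℂ) + (v' : ℂ) * Complex.I) - S * z') := by
    push_cast; ring
  rw [this]
  exact (norm_add_le _ _).trans (add_le_add h h')

theorem norm_le (hS : 0 ≤ S) (h : Approx S e z u v) (hz : ‖z‖ ≤ b) :
    ‖(u : ℂ) + (v : ℂ) * Complex.I‖ ≤ S * b + e := by
  have hS' : (0 : ℝ) ≤ S := by exact_mod_cast hS
  have h1 : ‖(S : ℂ) * z‖ ≤ S * b := by
    rw [norm_mul, Complex.norm_intCast, abs_of_nonneg hS']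
    gcongr
  calc _ = ‖((S : ℂ) * z) + ((u : ℂ) + (v : ℂ) * Complex.I - S * z)‖ := by congr 1; ring
    _ ≤ _ := (norm_add_le _ _).trans (add_le_add h1 h)

theorem abs_re_le (hS : 0 ≤ S) (h : Approx S e z u v) (hz : ‖z‖ ≤ b) : |(u : ℝ)| ≤ S * b + e := by
  have := Complex.abs_re_le_norm ((u : ℂ) + (v : ℂ) * Complex.I)
  simp only [Complex.add_re, Complex.intCast_re, Complex.mul_re, Complex.I_re, mul_zero,
    Complex.intCast_im, Complex.I_im, zero_mul, sub_zero, add_zero] at this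
  exact this.trans (h.norm_le hS hz)

theorem abs_im_le (hS : 0 ≤ S) (h : Approx S e z u v) (hz : ‖z‖ ≤ b) : |(v : ℝ)| ≤ S * b + e := by
  have := Complex.abs_im_le_norm ((u : ℂ) + (v : ℂ) * Complex.I)
  simp only [Complex.add_im, Complex.intCast_im, Complex.mul_im, Complex.I_re, mul_zero,
    Complex.intCast_re, Complex.I_im, mul_one, zero_add, add_zero] at this
  exact this.trans (h.norm_le hS hz)

/-- With U = u + v i and U' = u' + v' i, one has U U' - S² z z' = (U - S z) U' + S z (U' - S z').
Dividing by S and using |U'| ≤ S (b' + 1), which follows from e' ≤ S, gives the first two terms of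
the error; rounding down the real and the imaginary part costs at most 1 each. -/
theorem mul (hS : 0 < S) (h : Approx S e z u v) (h' : Approx S e' z' u' v') (hz : ‖z‖ ≤ b)
    (hz' : ‖z'‖ ≤ b') (he' : e' ≤ S) :
    Approx S (e * (b' + 1) + b * e' + 2) (z * z') ((u * u' - v * v') / S)
      ((u * v' + v * u') / S) := by
  have hS' : (0 : ℝ) < S := by exact_mod_cast hS
  have he0 : 0 ≤ e := (norm_nonneg _).trans h
  have he0' : 0 ≤ e' := (norm_nonneg _).trans h'
  have hU' := h'.norm_le hS.le hz'
  unfold Approx at *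
  set U := (u : ℂ) + (v : ℂ) * Complex.I with hU
  set U' := (u' : ℂ) + (v' : ℂ) * Complex.I with hUU'
  set x := u * u' - v * v' with hx
  set y := u * v' + v * u' with hy
  have hP : (x : ℂ) + (y : ℂ) * Complex.I = U * U' := by
    rw [hx, hy, hU, hUU']
    push_cast
    linear_combination (-(v : ℂ) * v') * Complex.I_sq
  have hdiv : ∀ t : ℤ, (S : ℂ) * ((t / S : ℤ) : ℂ) = t - ((t % S : ℤ) : ℂ) := by
    intro t
    have := Int.emod_add_mul_ediv t S
    rw [eq_sub_iff_add_eq']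
    exact_mod_cast this
  have hmod : ∀ t : ℤ, ‖((t % S : ℤ) : ℂ)‖ ≤ S := by
    intro t
    rw [Complex.norm_intCast, abs_of_nonneg (by exact_mod_cast Int.emod_nonneg t hS.ne')]
    exact_mod_cast (Int.emod_lt_of_pos t hS).le
  have key : (S : ℂ) * ((((x / S : ℤ) : ℂ) + ((y / S : ℤ) : ℂ) * Complex.I) - S * (z * z')) =
      (U - S * z) * U' + S * z * (U' - S * z') +
        -(((x % S : ℤ) : ℂ) + ((y % S : ℤ) : ℂ) * Complex.I) := by
    rw [mul_sub, mul_add, ← mul_assoc (S : ℂ) ((y / S : ℤ) : ℂ), hdiv, hdiv]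
    linear_combination hP
  have hn := congrArg (‖·‖) key
  simp only [norm_mul, Complex.norm_intCast] at hn
  rw [abs_of_pos hS'] at hn
  have h1 : ‖(U - S * z) * U'‖ ≤ e * (S * b' + e') := by
    rw [norm_mul]
    gcongr
  have h2 : ‖(S : ℂ) * z * (U' - S * z')‖ ≤ S * b * e' := by
    rw [norm_mul, norm_mul, Complex.norm_intCast, abs_of_pos hS']
    have := (norm_nonneg z).trans hz
    gcongr
  have h3 : ‖-(((x % S : ℤ) : ℂ) + ((y % S : ℤ) : ℂ) * Complex.I)‖ ≤ 2 * S := by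
    rw [norm_neg]
    refine (norm_add_le _ _).trans ?_
    rw [norm_mul, Complex.norm_I, mul_one]
    linarith [hmod x, hmod y]
  have h4 := (norm_add_le ((U - S * z) * U' + S * z * (U' - S * z'))
    (-(((x % S : ℤ) : ℂ) + ((y % S : ℤ) : ℂ) * Complex.I))).trans
    (add_le_add_left (norm_add_le _ _) _)
  rw [← hn] at h4
  have h5 : e * e' ≤ e * S := by gcongr
  refine le_of_mul_le_mul_left ?_ hS'
  nlinarith

end Approx

/-- Computing the cosine of half an angle in fixed-point arithmetic. -/
theorem abs_sub_cos_half_le {S c y r : ℤ} {C c₂ : ℝ} (hS : 1000 ≤ S) (hc : |(c : ℝ) - S * C| ≤ 20)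
    (hC : 0 ≤ C) (h2 : 0 ≤ c₂) (hC2 : c₂ ^ 2 = (1 + C) / 2) (hy : y = S * (S + c) / 2)
    (hr0 : 0 ≤ r) (hr : r * r ≤ y) (hr' : y < (r + 1) * (r + 1)) : |(r : ℝ) - S * c₂| ≤ 20 := by
  have hS' : (1000 : ℝ) ≤ S := by exact_mod_cast hS
  have hr0' : (0 : ℝ) ≤ r := by exact_mod_cast hr0
  have hrr : (r : ℝ) * r ≤ y := by exact_mod_cast hr
  have hrr' : (y : ℝ) < (r + 1) * (r + 1) := by exact_mod_cast hr'
  have hy1 : 2 * (y : ℝ) ≤ S * (S + c) := by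
    have : 2 * y ≤ S * (S + c) := by rw [hy]; exact Int.mul_ediv_self_le two_ne_zero
    exact_mod_cast this
  have hy2 : S * (S + c) ≤ 2 * (y : ℝ) + 2 := by
    have : S * (S + c) < 2 * y + 2 := by rw [hy]; exact Int.lt_mul_ediv_self_add two_pos
    exact_mod_cast this.le
  obtain ⟨hc1, hc2⟩ := abs_le.1 hc
  set t := S * c₂ with ht
  have ht0 : 0 ≤ t := by positivity
  have htt : 2 * t ^ 2 = S * (S + S * C) := by rw [ht, mul_pow, hC2]; ring
  -- As C ≥ 0, the value c₂ is at least 0.7. Near t the square root thus divides the error 10 S of y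
  -- by about 1.4 S, and rounding down adds little: the bound 20 reproduces itself.
  have ht7 : (7 / 10) * (S : ℝ) ≤ t := by
    by_contra! h
    have : t ^ 2 < ((7 / 10) * S) ^ 2 := by gcongr
    have : 0 ≤ S * (S * C) := by positivity
    nlinarith
  have hyt1 : (y : ℝ) ≤ t ^ 2 + 10 * S := by nlinarith
  have hyt2 : t ^ 2 - 10 * S - 1 ≤ y := by nlinarith
  rw [abs_le]
  constructor
  · by_contra! h
    have h1 : (r : ℝ) + 1 < t - 19 := by linarith
    have : ((r : ℝ) + 1) * (r + 1) < (t - 19) * (t - 19) := by gcongr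
    nlinarith
  · by_contra! h
    have h1 : t + 20 < r := by linarith
    have : (t + 20) * (t + 20) < (r : ℝ) * r := by gcongr
    nlinarith

/-- Computing the sine of half an angle in fixed-point arithmetic. -/
theorem abs_sub_sin_half_le {S σ r : ℤ} {s c₂ s₂ : ℝ} (hS : 1000 ≤ S)
    (hs : |(σ : ℝ) - S * s| ≤ 100) (hc2 : 1 / 2 ≤ c₂ ^ 2) (hc0 : 0 ≤ c₂) (hs0 : 0 ≤ s₂)
    (hs2 : s₂ ^ 2 ≤ 1 / 2) (hss : s = 2 * s₂ * c₂) (hr : |(r : ℝ) - S * c₂| ≤ 20) :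
    |((σ * S / (2 * r) : ℤ) : ℝ) - S * s₂| ≤ 100 ∧ 0 < r := by
  have hS' : (1000 : ℝ) ≤ S := by exact_mod_cast hS
  have hc7 : 7 / 10 ≤ c₂ := by nlinarith
  have hs7 : s₂ ≤ 71 / 100 := by nlinarith
  obtain ⟨hr1, hr2⟩ := abs_le.1 hr
  obtain ⟨hσ1, hσ2⟩ := abs_le.1 hs
  have hrS : (68 / 100) * (S : ℝ) ≤ r := by nlinarith
  have hrpos' : (0 : ℝ) < r := by linarith
  have hrpos : 0 < r := by exact_mod_cast hrpos'
  refine ⟨?_, hrpos⟩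
  set q := σ * S / (2 * r) with hq
  have hq1 : 2 * (r : ℝ) * q ≤ σ * S := by
    have : 2 * r * q ≤ σ * S := Int.mul_ediv_self_le (by omega)
    exact_mod_cast this
  have hq2 : (σ : ℝ) * S ≤ 2 * r * q + 2 * r := by
    have : σ * S < 2 * r * q + 2 * r := Int.lt_mul_ediv_self_add (by omega)
    exact_mod_cast this.le
  set v := S * s₂ with hv
  have hv0 : 0 ≤ v := by positivity
  have hv7 : v ≤ (71 / 100) * S := by rw [hv]; nlinarith
  have e1 : S * s * S = 2 * v * (S * c₂) := by rw [hss, hv]; ring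
  have b1 : 2 * v * (r - S * c₂) ≤ 2 * v * 20 := by gcongr
  have b2 : -(2 * v * 20) ≤ 2 * v * (r - S * c₂) := by nlinarith
  have b3 : (σ : ℝ) * S ≤ S * s * S + 100 * S := by nlinarith
  have b4 : S * s * S - 100 * S ≤ (σ : ℝ) * S := by nlinarith
  -- The bound 100 reproduces itself as well: the errors of σ, of r and of the division add up to at
  -- most 100 / (2 · 0.68) + 20 · 0.71 / 0.68 + 1 < 100.
  have hb5 : 2 * (r : ℝ) * (q - v) ≤ 2 * r * 100 := by nlinarith
  have hb6 : -(2 * (r : ℝ) * 100) ≤ 2 * r * (q - v) := by nlinarith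
  rw [abs_le]
  have h2r : (0 : ℝ) < 2 * r := by positivity
  constructor <;> nlinarith

/-- The condition on k puts the angle into the first quadrant, so the half-angle formulas determine
cosine and sine as nonnegative roots. -/
theorem cos_sin_half {k : ℕ} (hk : 2 ≤ k) :
    let θ := 2 * Real.pi / (2 ^ k : ℕ)
    let θ₂ := 2 * Real.pi / (2 ^ (k + 1) : ℕ)
    0 ≤ Real.cos θ ∧ 0 ≤ Real.cos θ₂ ∧ 0 ≤ Real.sin θ₂ ∧
      Real.cos θ₂ ^ 2 = (1 + Real.cos θ) / 2 ∧ Real.sin θ₂ ^ 2 = (1 - Real.cos θ) / 2 ∧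
      Real.sin θ = 2 * Real.sin θ₂ * Real.cos θ₂ := by
  intro θ θ₂
  have hθ : θ = 2 * θ₂ := by
    simp only [θ, θ₂]
    push_cast
    field_simp
    ring
  have hpos : 0 ≤ θ₂ := by have := Real.pi_pos; positivity
  have hle : θ₂ ≤ Real.pi / 4 := by
    have : (8 : ℝ) ≤ (2 ^ (k + 1) : ℕ) := by
      exact_mod_cast (show 2 ^ 3 ≤ 2 ^ (k + 1) from Nat.pow_le_pow_right two_pos (by omega))
    simp only [θ₂]
    rw [div_le_div_iff₀ (by positivity) (by norm_num)]
    nlinarith [Real.pi_pos]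
  have hpi := Real.pi_pos
  rw [hθ]
  refine ⟨Real.cos_nonneg_of_neg_pi_div_two_le_of_le (by linarith) (by linarith),
    Real.cos_nonneg_of_neg_pi_div_two_le_of_le (by linarith) (by linarith),
    Real.sin_nonneg_of_nonneg_of_le_pi hpos (by linarith), ?_, ?_, Real.sin_two_mul _⟩
  · rw [Real.cos_two_mul]; ring
  · rw [Real.cos_two_mul]; linarith [Real.sin_sq_add_cos_sq θ₂]

/-! ## Computing an approximate root of unity -/

/-- The scale of the fixed-point arithmetic. -/
def scale (n : ℕ) : ℤ := (2 ^ lg n) ^ 64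

theorem thousand_le_scale (n : ℕ) : 1000 ≤ scale n := by
  have : (2 : ℤ) ≤ 2 ^ lg n := by exact_mod_cast two_le_two_pow_lg n
  calc (1000 : ℤ) ≤ 2 ^ 64 := by norm_num
    _ ≤ _ := by unfold scale; gcongr

/-- Quadratic in the scale are the radicand of the half-angle step and the crude bound for the cells
of the histograms; this makes the exponent of `cellBound` exceed 128. -/
theorem scale_pow_two_le (d n : ℕ) : 8 * scale n ^ 2 ≤ cellBound d n := by
  have : (2 : ℤ) ≤ 2 ^ lg n := by exact_mod_cast two_le_two_pow_lg n
  refine le_trans ?_ (pow_le_cellBound (d := d) (k := 131) (by omega))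
  calc 8 * scale n ^ 2 = 2 ^ 3 * (2 ^ lg n) ^ 128 := by unfold scale; ring
    _ ≤ (2 ^ lg n) ^ 3 * (2 ^ lg n) ^ 128 := by gcongr
    _ = _ := by ring

theorem mul_scale_le {d n : ℕ} {z : ℤ} (h : z ≤ 8 * scale n) : z ≤ cellBound d n := by
  have := thousand_le_scale n
  have := scale_pow_two_le d n
  nlinarith

theorem four_mul_modBound_le (n : ℕ) : 4 * modBound n ≤ (2 ^ lg n) ^ 4 := by
  have h1 := modBound_le n
  have h2 := two_le_two_pow_lg n
  calc 4 * modBound n ≤ 2 ^ 2 * (2 ^ lg n) ^ 2 := by omega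
    _ ≤ (2 ^ lg n) ^ 2 * (2 ^ lg n) ^ 2 := by gcongr
    _ = _ := by ring

theorem four_mul_modBound_le_scale (n : ℕ) : (4 * modBound n : ℤ) ≤ scale n := by
  have : (2 : ℤ) ≤ 2 ^ lg n := by exact_mod_cast two_le_two_pow_lg n
  have h := four_mul_modBound_le n
  calc (4 * modBound n : ℤ) ≤ (2 ^ lg n) ^ 4 := by exact_mod_cast h
    _ ≤ _ := pow_le_pow_right₀ (by omega) (by omega)

open WordRAM.Expr WordRAM.Cmd

/-- Computes the scale in register `9`. -/
def scaleCmd : Cmd :=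
  .seq (assign 9 (reg 2 * reg 2 * reg 2 * reg 2)) <|
  .seq (assign 9 (reg 9 * reg 9 * reg 9 * reg 9)) <|
  assign 9 (reg 9 * reg 9 * reg 9 * reg 9)

theorem scaleCmd_spec {d n : ℕ} {s : State} (h : HasParams d n s) :
    HT (cellBound d n) scaleCmd 5 s fun s' => s'.reg 9 = scale n := by
  have hb : ∀ k ≤ 64, |((2 : ℤ) ^ lg n) ^ k| ≤ cellBound d n := fun k hk => by
    rw [abs_of_nonneg (by positivity)]
    exact pow_le_cellBound (by omega)
  refine HT.assign_seq (T₁ := 3) ?_ (HT.assign_seq (T₁ := 1) ?_ (HT.assign ?_ ?_) le_rfl) le_rfl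
  · simp only [val_mul, val_reg, h.r2]
    convert hb 4 (by omega) using 2
    ring
  · simp only [val_mul, val_reg, h.r2, State.setReg_reg, if_true]
    convert hb 16 (by omega) using 2
    ring
  · simp only [val_mul, val_reg, h.r2, State.setReg_reg, if_true]
    convert hb 64 (by omega) using 2
    ring
  · simp only [val_mul, val_reg, h.r2, State.setReg_reg, if_true, scale]
    ring

/-- Computes in register `14` the integer part of the square root of register `17`. -/
def sqrtCmd : Cmd :=
  .seq (assign 14 0) <|
  .seq (assign 15 (2 * reg 9)) <|
  .seq (assign 19 (64 * reg 3 + 1)) <|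
  forLoop 18 19 <|
    .seq (assign 16 ((reg 14 + reg 15) / 2)) <|
    branch (less (reg 17) (reg 16 * reg 16)) (assign 15 (reg 16)) (assign 14 (reg 16))

/-- Bisection of [0, 2S]: since 2S = 2^(64 lg n + 1), the 64 lg n + 1 halvings leave an interval of
length one. -/
theorem sqrtCmd_spec {d n : ℕ} {s : State} (h : HasParams d n s) (h9 : s.reg 9 = scale n) {y : ℤ}
    (h17 : s.reg 17 = y) (hy0 : 0 ≤ y) (hy : y < (2 * scale n) * (2 * scale n)) :
    HT (cellBound d n) sqrtCmd (500 * lg n) s fun s' =>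
      0 ≤ s'.reg 14 ∧ s'.reg 14 * s'.reg 14 ≤ y ∧ y < (s'.reg 14 + 1) * (s'.reg 14 + 1) := by
  have hS := thousand_le_scale n
  have hl := one_le_lg n
  have hJ : ((64 * lg n + 1 : ℕ) : ℤ) ≤ cellBound d n := by
    refine natCast_le_cellBound (k := 8) ?_ (by omega)
    have h1 := lg_le_two_pow_lg n
    have h2 := two_le_two_pow_lg n
    calc 64 * lg n + 1 ≤ 2 ^ 7 * 2 ^ lg n := by omega
      _ ≤ (2 ^ lg n) ^ 7 * 2 ^ lg n := by gcongr
      _ = _ := by ring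
  refine HT.assign_seq (T₁ := 500 * lg n - 2) ?_ ?_ (by omega)
  · simpa using le_cellBound_of_le (by norm_num)
  refine HT.assign_seq (T₁ := 500 * lg n - 4) ?_ ?_ (by omega)
  · simp only [val_mul, val_reg, val_ofNat, State.setReg_reg, h9]
    norm_num
    rw [abs_of_nonneg (by omega)]
    exact mul_scale_le (by omega)
  refine HT.assign_seq (T₁ := 500 * lg n - 6) ?_ ?_ (by omega)
  · simp only [val_mul, val_add, val_reg, val_ofNat, State.setReg_reg, h.r3]
    norm_num
    rw [abs_of_nonneg (by positivity)]
    exact_mod_cast hJ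
  refine HT.forLoop (T₁ := 4) (64 * lg n + 1)
    (fun i s' => 0 ≤ s'.reg 14 ∧ s'.reg 15 ≤ 2 * scale n ∧ s'.reg 14 < s'.reg 15 ∧
      s'.reg 14 * s'.reg 14 ≤ y ∧ y < s'.reg 15 * s'.reg 15 ∧
      s'.reg 15 - s'.reg 14 ≤ 2 ^ (64 * lg n + 1 - i)) ?_ hJ rfl rfl ?_ ?_ ?_ (by omega)
  · simp [h.r3]
  · simp [h9]
    refine ⟨by omega, hy0, hy, ?_⟩
    rw [scale, ← pow_mul, pow_succ']
    ring_nf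
    exact le_rfl
  · rintro i s' hi hs h18 ⟨a1, a2, a3, a4, a5, a6⟩
    have h17' : s'.reg 17 = y := by simpa [h17] using hs.reg 17 rfl
    have hp : (2 : ℤ) ^ (64 * lg n + 1 - i) = 2 * 2 ^ (64 * lg n - i) := by
      rw [← pow_succ']
      congr 1
      omega
    rw [hp] at a6
    have hp1 : (1 : ℤ) ≤ 2 ^ (64 * lg n - i) := by
      exact_mod_cast Nat.one_le_two_pow
    have hmid : |(s'.reg 14 + s'.reg 15) / 2| ≤ cellBound d n := by
      rw [abs_of_nonneg (by omega)]
      exact mul_scale_le (by omega)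
    refine HT.assign_seq (T₁ := 2) ?_ (HT.branch (T₁ := 1) (fun hc => HT.assign ?_ ?_)
      (fun hc => HT.assign ?_ ?_) le_rfl) le_rfl
    · simpa using hmid
    · simpa using hmid
    · simp [h17'] at hc ⊢
      refine ⟨a1, by omega, ?_, a4, hc, by omega⟩
      by_contra! hge
      have : (s'.reg 14 + s'.reg 15) / 2 = s'.reg 14 := by omega
      rw [this] at hc
      omega
    · simpa using hmid
    · simp [h17'] at hc ⊢
      exact ⟨by omega, a2, by omega, hc, a5, by omega⟩
  · rintro s' - - ⟨a1, a2, a3, a4, a5, a6⟩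
    have : s'.reg 15 = s'.reg 14 + 1 := by
      simp at a6
      omega
    exact ⟨a1, a4, this ▸ a5⟩

/-- Computes in registers `10` and `11` the length of the transform and its logarithm, and in
registers `12` and `13` the real and the imaginary part of the root of unity. -/
def rootCmd : Cmd :=
  .seq (assign 10 4) <|
  .seq (assign 11 2) <|
  .seq (assign 12 0) <|
  .seq (assign 13 (reg 9)) <|
  loop (less (reg 10) (2 * reg 4)) <|
    .seq (assign 17 (reg 9 * (reg 9 + reg 12) / 2)) <|
    .seq sqrtCmd <|
    .seq (assign 12 (reg 14)) <|
    .seq (assign 13 (reg 13 * reg 9 / (2 * reg 12))) <|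
    .seq (assign 10 (2 * reg 10)) <|
    assign 11 (reg 11 + 1)

/-- Registers `9, …, 13` contain the scale, the length `2 ^ K` of the transform, `K`, and the
approximate root of unity. -/
structure HasRoot (n K : ℕ) (s : State) : Prop where
  r9 : s.reg 9 = scale n
  r10 : s.reg 10 = ((2 ^ K : ℕ) : ℤ)
  r11 : s.reg 11 = K
  two_le : 2 ≤ K
  le : 2 ^ K ≤ 4 * modBound n
  cos : |(s.reg 12 : ℝ) - scale n * Real.cos (2 * Real.pi / (2 ^ K : ℕ))| ≤ 20
  sin : |(s.reg 13 : ℝ) - scale n * Real.sin (2 * Real.pi / (2 ^ K : ℕ))| ≤ 100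

theorem HasRoot.abs_cos_le {n K : ℕ} {s : State} (h : HasRoot n K s) :
    |s.reg 12| ≤ 2 * scale n := by
  have hS : (1000 : ℝ) ≤ scale n := by exact_mod_cast thousand_le_scale n
  have h1 := Real.abs_cos_le_one (2 * Real.pi / (2 ^ K : ℕ))
  have h2 := abs_sub_abs_le_abs_sub (s.reg 12 : ℝ)
    (scale n * Real.cos (2 * Real.pi / (2 ^ K : ℕ)))
  rw [abs_mul, abs_of_nonneg (by linarith : (0 : ℝ) ≤ scale n)] at h2
  have : |(s.reg 12 : ℝ)| ≤ 2 * scale n := by nlinarith [h.cos]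
  exact_mod_cast this

theorem HasRoot.abs_sin_le {n K : ℕ} {s : State} (h : HasRoot n K s) :
    |s.reg 13| ≤ 2 * scale n := by
  have hS : (1000 : ℝ) ≤ scale n := by exact_mod_cast thousand_le_scale n
  have h1 := Real.abs_sin_le_one (2 * Real.pi / (2 ^ K : ℕ))
  have h2 := abs_sub_abs_le_abs_sub (s.reg 13 : ℝ)
    (scale n * Real.sin (2 * Real.pi / (2 ^ K : ℕ)))
  rw [abs_mul, abs_of_nonneg (by linarith : (0 : ℝ) ≤ scale n)] at h2
  have : |(s.reg 13 : ℝ)| ≤ 2 * scale n := by nlinarith [h.sin]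
  exact_mod_cast this

theorem le_four_mul_lg {n K : ℕ} (h : 2 ^ K ≤ 4 * modBound n) : K ≤ 4 * lg n := by
  have := h.trans (four_mul_modBound_le n)
  rw [← pow_mul] at this
  have := (Nat.pow_le_pow_iff_right one_lt_two).1 this
  omega

/-- The computation starts with the fourth root of unity, which is exact, and halves the angle until
the length reaches 2M. The errors 20 and 100 of cosine and sine do not grow in a halving. As 2^K ≤
4M ≤ X^4, there are fewer than 4 lg n passes. -/
theorem rootCmd_spec {d n : ℕ} {s : State} (h : HasParams d n s) (h9 : s.reg 9 = scale n) :
    HT (cellBound d n) rootCmd (2100 * lg n * lg n) s fun s' =>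
      ∃ K, HasRoot n K s' ∧ 2 * modBound n ≤ 2 ^ K := by
  have hS := thousand_le_scale n
  have hl := one_le_lg n
  have hll : lg n ≤ lg n * lg n := by nlinarith
  have hM : 1 ≤ modBound n := Nat.succ_pos _
  have hMS := four_mul_modBound_le_scale n
  refine HT.assign_seq (T₁ := 4 * lg n * (500 * lg n + 12) + 7)
    (by simpa using le_cellBound_of_le (by norm_num)) ?_ (by nlinarith)
  refine HT.assign_seq (T₁ := 4 * lg n * (500 * lg n + 12) + 5)
    (by simpa using le_cellBound_of_le (by norm_num)) ?_ (by omega)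
  refine HT.assign_seq (T₁ := 4 * lg n * (500 * lg n + 12) + 3)
    (by simpa using le_cellBound_of_le (by norm_num)) ?_ (by omega)
  refine HT.assign_seq (T₁ := 4 * lg n * (500 * lg n + 12) + 1) ?_ ?_ (by omega)
  · simp [h9]
    rw [abs_of_nonneg (by omega)]
    exact mul_scale_le (by omega)
  refine HT.loop (fun τ s' => ∃ K, HasRoot n K s' ∧
    (4 * lg n - K) * (500 * lg n + 12) + 1 ≤ τ) ⟨2, ?_, by gcongr; omega⟩ ?_ ?_
  · constructor <;> simp [h9]
    · omega
    · rw [show 2 * Real.pi / 4 = Real.pi / 2 by ring]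
      simp
    · rw [show 2 * Real.pi / 4 = Real.pi / 2 by ring]
      simp
  · rintro τ s1 hs1 ⟨K, hK, hτ⟩ hc
    have hp1 : HasParams d n s1 := h.setReg.setReg.setReg.setReg.of_same hs1
    have hN2 : 2 ^ K < 2 * modBound n := by
      simp [hK.r10, hp1.r4] at hc
      exact_mod_cast hc
    have hK4 : 2 ^ (K + 1) ≤ 4 * modBound n := by rw [pow_succ]; omega
    have hKl := le_four_mul_lg hK4
    obtain ⟨t1, t2, t3, t4, t5, t6⟩ := cos_sin_half hK.two_le
    have hcS : |s1.reg 12| ≤ scale n + 20 := by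
      have h1 := Real.abs_cos_le_one (2 * Real.pi / (2 ^ K : ℕ))
      have h2 := abs_sub_abs_le_abs_sub (s1.reg 12 : ℝ)
        (scale n * Real.cos (2 * Real.pi / (2 ^ K : ℕ)))
      have hS : (0 : ℝ) ≤ scale n := by exact_mod_cast (show 0 ≤ scale n by omega)
      rw [abs_mul, abs_of_nonneg hS] at h2
      have : |(s1.reg 12 : ℝ)| ≤ scale n + 20 := by nlinarith [hK.cos]
      exact_mod_cast this
    -- The true cosine is nonnegative, so the computed one is at least -20. Together with S ≥ 1000
    -- this makes the radicand nonnegative.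
    have hc20 : -20 ≤ s1.reg 12 := by
      have h1 := (abs_le.1 hK.cos).1
      have hS : (0 : ℝ) ≤ scale n := by exact_mod_cast (show 0 ≤ scale n by omega)
      have : (-20 : ℝ) ≤ s1.reg 12 := by nlinarith
      exact_mod_cast this
    have hcS' := (abs_le.1 hcS).2
    set y := scale n * (scale n + s1.reg 12) / 2 with hy
    have hy0 : 0 ≤ y := Int.ediv_nonneg (mul_nonneg (by omega) (by omega)) (by norm_num)
    have hyS : y ≤ 2 * scale n ^ 2 := by
      have h1 : 2 * y ≤ scale n * (scale n + s1.reg 12) := Int.mul_ediv_self_le two_ne_zero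
      nlinarith
    obtain ⟨k, hk⟩ : ∃ k, 4 * lg n - K = k + 1 := ⟨4 * lg n - K - 1, by omega⟩
    have hk' : 4 * lg n - (K + 1) = k := by omega
    rw [hk, Nat.add_mul] at hτ
    refine ⟨500 * lg n + 11, k * (500 * lg n + 12) + 1, by omega, ?_⟩
    refine HT.assign_seq (T₁ := 500 * lg n + 9) ?_ ?_ (by omega)
    · simp only [val_div, val_mul, val_add, val_reg, val_ofNat, hK.r9]
      rw [← hy, abs_of_nonneg hy0]
      have := scale_pow_two_le d n
      nlinarith
    refine HT.seq (T₁ := 500 * lg n) (T₂ := 7) (sqrtCmd_spec (y := y) hp1.setReg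
      (by simp [hK.r9]) (by simp [hK.r9, hy]) hy0 (by nlinarith)) ?_ (by omega)
    rintro s2 hs2 ⟨hr0, hr1, hr2⟩
    have e9 : s2.reg 9 = scale n := by simpa [hK.r9] using hs2.reg 9 rfl
    have e10 : s2.reg 10 = (2 ^ K : ℕ) := by simpa [hK.r10] using hs2.reg 10 rfl
    have e11 : s2.reg 11 = K := by simpa [hK.r11] using hs2.reg 11 rfl
    have e13 : s2.reg 13 = s1.reg 13 := by simpa using hs2.reg 13 rfl
    set r := s2.reg 14 with hr
    have hcos := abs_sub_cos_half_le hS hK.cos t1 t2 t4 hy hr0 hr1 hr2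
    obtain ⟨hsin, hrpos⟩ := abs_sub_sin_half_le hS hK.sin (by rw [t4]; linarith) t2 t3
      (by rw [t5]; linarith) t6 hcos
    have hroot : HasRoot n (K + 1) ((((s2.setReg 12 r).setReg 13
        (s1.reg 13 * scale n / (2 * r))).setReg 10 (2 * (2 ^ K : ℕ))).setReg 11 (K + 1)) :=
      ⟨by simp [e9], by simp [pow_succ'], by simp, by have := hK.two_le; omega, hK4,
        by simpa using hcos, by simpa using hsin⟩
    have b12 := hroot.abs_cos_le
    have b13 := hroot.abs_sin_le
    simp at b12 b13
    refine HT.assign_seq (T₁ := 5) ?_ (HT.assign_seq (T₁ := 3) ?_ (HT.assign_seq (T₁ := 1) ?_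
      (HT.assign ?_ ⟨K + 1, ?_, ?_⟩) le_rfl) le_rfl) le_rfl
    · simpa [← hr] using b12.trans (mul_scale_le (by omega))
    · simpa [← hr, e9, e13] using b13.trans (mul_scale_le (by omega))
    · simp [e10]
      refine mul_scale_le ?_
      have : ((2 ^ (K + 1) : ℕ) : ℤ) ≤ 4 * modBound n := by exact_mod_cast hK4
      rw [pow_succ] at this
      push_cast at this
      omega
    · simp [e11]
      rw [abs_of_nonneg (by positivity)]
      refine mul_scale_le ?_
      have : K + 1 ≤ 4 * modBound n := Nat.lt_two_pow_self.le.trans hK4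
      have : ((K + 1 : ℕ) : ℤ) ≤ 4 * modBound n := by exact_mod_cast this
      push_cast at this
      omega
    · simpa [← hr, e9, e10, e11, e13] using hroot
    · rw [hk']
  · rintro τ s1 hs1 ⟨K, hK, hτ⟩ hc
    have hp1 : HasParams d n s1 := h.setReg.setReg.setReg.setReg.of_same hs1
    refine ⟨by omega, K, hK, ?_⟩
    simp [hK.r10, hp1.r4] at hc
    exact_mod_cast hc

/-! ## Twiddle factors -/

/-- Computes the powers of the root of unity in arrays `10` and `11`. -/
def twiddleCmd : Cmd :=
  .seq (assign 20 (reg 9)) <|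
  .seq (assign 21 0) <|
  forLoop 22 10 <|
    .seq (store 10 (reg 22) (reg 20)) <|
    .seq (store 11 (reg 22) (reg 21)) <|
    .seq (assign 23 ((reg 12 * reg 20 - reg 13 * reg 21) / reg 9)) <|
    .seq (assign 21 ((reg 12 * reg 21 + reg 13 * reg 20) / reg 9)) <|
    assign 20 (reg 23)

/-- The error bound for the twiddle factors. -/
noncomputable def twiddleErr (K : ℕ) : ℝ := 250 * 2 ^ K

/-- Arrays `10` and `11` contain the powers of the root of unity. -/
def HasTwiddles (n K : ℕ) (s : State) : Prop :=
  ∀ t : ℕ, t < 2 ^ K → Approx (scale n) (twiddleErr K) (zeta (2 ^ K) ^ t) (s.arr 10 t) (s.arr 11 t)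

theorem HasRoot.approx {n K : ℕ} {s : State} (h : HasRoot n K s) :
    Approx (scale n) 120 (zeta (2 ^ K)) (s.reg 12) (s.reg 13) := by
  unfold Approx
  rw [zeta_eq_cos_add_sin]
  set C := Real.cos (2 * Real.pi / (2 ^ K : ℕ)) with hC
  set D := Real.sin (2 * Real.pi / (2 ^ K : ℕ)) with hD
  have : ((s.reg 12 : ℂ) + (s.reg 13 : ℂ) * Complex.I) - scale n * ((C : ℂ) + (D : ℂ) * Complex.I) =
      ((s.reg 12 - scale n * C : ℝ) : ℂ) + ((s.reg 13 - scale n * D : ℝ) : ℂ) * Complex.I := by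
    push_cast; ring
  rw [this]
  refine (norm_add_le _ _).trans ?_
  rw [norm_mul, Complex.norm_I, mul_one, Complex.norm_real, Complex.norm_real]
  have h1 := h.cos
  have h2 := h.sin
  rw [← hC] at h1
  rw [← hD] at h2
  rw [Real.norm_eq_abs, Real.norm_eq_abs]
  linarith

theorem two_pow_le_of_le_modBound {n K : ℕ} (hK : 2 ^ K ≤ 4 * modBound n) :
    (2 : ℝ) ^ K ≤ (2 ^ lg n) ^ 4 := by
  exact_mod_cast hK.trans (four_mul_modBound_le n)

theorem two_le_two_pow_lg_real (n : ℕ) : (2 : ℝ) ≤ 2 ^ lg n := by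
  exact_mod_cast two_le_two_pow_lg n

theorem twiddleErr_le {n K : ℕ} (hK : 2 ^ K ≤ 4 * modBound n) :
    twiddleErr K ≤ (2 ^ lg n) ^ 12 := by
  have h1 := two_pow_le_of_le_modBound hK
  have h2 := two_le_two_pow_lg_real n
  calc twiddleErr K ≤ 2 ^ 8 * (2 ^ lg n) ^ 4 := by unfold twiddleErr; gcongr; norm_num
    _ ≤ (2 ^ lg n) ^ 8 * (2 ^ lg n) ^ 4 := by gcongr
    _ = _ := by ring

theorem pow_le_scale {n k : ℕ} (hk : k ≤ 64) : ((2 : ℝ) ^ lg n) ^ k ≤ (scale n : ℝ) := by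
  have h2 := two_le_two_pow_lg_real n
  unfold scale
  push_cast
  exact pow_le_pow_right₀ (by linarith) hk

theorem Approx.abs_le_cellBound {n d : ℕ} {e A : ℝ} {z : ℂ} {u v : ℤ}
    (h : Approx (scale n) e z u v) (hz : ‖z‖ ≤ A) (hA : A ≤ (2 ^ lg n) ^ 20) (he : e ≤ scale n) :
    |u| ≤ cellBound d n ∧ |v| ≤ cellBound d n := by
  have hS : 0 ≤ scale n := by have := thousand_le_scale n; omega
  have h2 := two_le_two_pow_lg_real n
  have hX : (1 : ℝ) ≤ (2 ^ lg n) ^ 20 := one_le_pow₀ (by linarith)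
  have hS' : (0 : ℝ) ≤ scale n := by exact_mod_cast hS
  have key : scale n * A + e ≤ (cellBound d n : ℝ) := by
    calc scale n * A + e ≤ scale n * (2 ^ lg n) ^ 20 + scale n * (2 ^ lg n) ^ 20 := by
          gcongr
          nlinarith
      _ = 2 * (2 ^ lg n) ^ 84 := by unfold scale; push_cast; ring
      _ ≤ 2 ^ lg n * (2 ^ lg n) ^ 84 := by gcongr
      _ = (2 ^ lg n) ^ 85 := by ring
      _ ≤ _ := by exact_mod_cast pow_le_cellBound (d := d) (n := n) (k := 85) (by omega)
  constructor
  · exact_mod_cast (h.abs_re_le hS hz).trans key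
  · exact_mod_cast (h.abs_im_le hS hz).trans key

/-- The root has error 120 and all powers have norm one, so each multiplication adds 120 · 2 + 2 ≤
250 to the error, which grows only linearly in the exponent. -/
theorem twiddleCmd_spec {d n K : ℕ} {s : State} (h : HasRoot n K s) :
    HT (cellBound d n) twiddleCmd (20 * 2 ^ K) s (HasTwiddles n K) := by
  have hS := thousand_le_scale n
  have hKB : ((2 ^ K : ℕ) : ℤ) ≤ cellBound d n := by
    have h1 : ((2 ^ K : ℕ) : ℤ) ≤ 4 * modBound n := by exact_mod_cast h.le
    exact mul_scale_le (by have := four_mul_modBound_le_scale n; omega)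
  have hE : twiddleErr K ≤ scale n := (twiddleErr_le h.le).trans (pow_le_scale (by norm_num))
  have h4 : 2 ^ 2 ≤ 2 ^ K := Nat.pow_le_pow_right two_pos h.two_le
  have hX := two_le_two_pow_lg_real n
  have hN : (2 ^ K : ℕ) ≠ 0 := by positivity
  have hle : ∀ i : ℕ, i ≤ 2 ^ K → 250 * (i : ℝ) ≤ twiddleErr K := fun i hi => by
    unfold twiddleErr
    have : (i : ℝ) ≤ 2 ^ K := by exact_mod_cast hi
    linarith
  have bd : ∀ {i : ℕ} {u v : ℤ}, i ≤ 2 ^ K → Approx (scale n) (250 * i) (zeta (2 ^ K) ^ i) u v →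
      |u| ≤ cellBound d n ∧ |v| ≤ cellBound d n := fun hi ha =>
    (ha.mono (hle _ hi)).abs_le_cellBound (norm_zeta_pow hN _).le
      (one_le_pow₀ (by linarith)) hE
  refine HT.assign_seq (T₁ := 2 ^ K * 12 + 5) ?_ ?_ (by omega)
  · simp [h.r9]
    rw [abs_of_nonneg (by omega)]
    exact mul_scale_le (by omega)
  refine HT.assign_seq (T₁ := 2 ^ K * 12 + 3)
    (by simpa using le_cellBound_of_le (by norm_num)) ?_ (by omega)
  refine HT.forLoop (T₁ := 9) (2 ^ K) (fun i s' =>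
      Approx (scale n) (250 * i) (zeta (2 ^ K) ^ i) (s'.reg 20) (s'.reg 21) ∧
      ∀ t : ℕ, t < i → Approx (scale n) (twiddleErr K) (zeta (2 ^ K) ^ t) (s'.arr 10 t) (s'.arr 11 t))
    (by simp [h.r10]) hKB rfl rfl ?_ ?_ ?_ (by omega)
  · simp [h.r9, Approx]
  · rintro i s' hi hs h22 ⟨ha, ht⟩
    have e9 : s'.reg 9 = scale n := by simpa [h.r9] using hs.reg 9 rfl
    have e12 : s'.reg 12 = s.reg 12 := by simpa using hs.reg 12 rfl
    have e13 : s'.reg 13 = s.reg 13 := by simpa using hs.reg 13 rfl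
    have hnext : Approx (scale n) (250 * (i + 1 : ℕ)) (zeta (2 ^ K) ^ (i + 1))
        ((s.reg 12 * s'.reg 20 - s.reg 13 * s'.reg 21) / scale n)
        ((s.reg 12 * s'.reg 21 + s.reg 13 * s'.reg 20) / scale n) := by
      have := h.approx.mul (by omega) ha (b := 1) (b' := 1)
        (by simpa using (norm_zeta_pow hN 1).le) (norm_zeta_pow hN i).le ((hle i hi.le).trans hE)
      rw [pow_succ']
      refine this.mono ?_
      push_cast
      linarith
    obtain ⟨b1, b2⟩ := bd hi.le ha
    obtain ⟨b3, b4⟩ := bd hi hnext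
    refine HT.store_seq (T₁ := 7) (by simpa using b1) ?_ le_rfl
    refine HT.store_seq (T₁ := 5) (by simpa using b2) ?_ le_rfl
    refine HT.assign_seq (T₁ := 3) (by simpa [e9, e12, e13] using b3) ?_ le_rfl
    refine HT.assign_seq (T₁ := 1) (by simpa [e9, e12, e13] using b4) ?_ le_rfl
    refine HT.assign (by simpa [e9, e12, e13] using b3) ⟨?_, fun t hti => ?_⟩
    · simpa [e9, e12, e13] using hnext
    · rcases (Nat.lt_succ_iff_lt_or_eq.1 hti) with hlt | rfl
      · have hne : (t : ℤ) ≠ i := by omega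
        simpa [h22, hne] using ht t hlt
      · simpa [h22] using ha.mono (hle t hi.le)
  · rintro s' - - ⟨-, ht⟩
    exact ht

/-! ## Histograms -/

/-- Adds the scale to the cells with the indices `e`, for all values of the counter `24`. -/
def histCmd (dst : ℕ) (e : Expr) : Cmd :=
  forLoop 24 0 <|
    .seq (assign 25 e) <|
    store dst (reg 25) (load dst (reg 25) + reg 9)

theorem histogram_succ (n : ℕ) (f : ℕ → ℕ) (u : ℕ) :
    histogram (n + 1) f u = histogram n f u + if u = f n then 1 else 0 := by
  unfold histogram
  rw [Finset.range_add_one, Finset.filter_insert]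
  by_cases h : f n = u
  · rw [if_pos h, Finset.card_insert_of_notMem (by simp), if_pos h.symm]
  · rw [if_neg h, if_neg (Ne.symm h), add_zero]

theorem histogram_le (n : ℕ) (f : ℕ → ℕ) (u : ℕ) : histogram n f u ≤ n := by
  simpa [histogram] using Finset.card_filter_le (Finset.range n) fun i => f i = u

/-- The initial content g allows two histograms to be accumulated in the same array, as is needed
for the low and the high indices. -/
theorem histCmd_spec {d n dst : ℕ} {e : Expr} {s : State} (f g : ℕ → ℕ) (h0 : s.reg 0 = n)
    (h9 : s.reg 9 = scale n)
    (he : ∀ i < n, ∀ s', (histCmd dst e).Same s s' → s'.reg 24 = i → e.val s' = f i)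
    (hf : ∀ i < n, (f i : ℤ) ≤ cellBound d n) (hg : ∀ u, g u ≤ n)
    (hs0 : ∀ u : ℕ, s.arr dst u = scale n * g u) :
    HT (cellBound d n) (histCmd dst e) (10 * (n + 1)) s fun s' =>
      ∀ u : ℕ, s'.arr dst u = scale n * ((g u + histogram n f u : ℕ) : ℤ) := by
  have hS := thousand_le_scale n
  have hX := two_le_two_pow_lg n
  have hnX := lt_two_pow_lg n
  have hnS : (2 * n : ℤ) ≤ scale n := by
    have : 2 * n ≤ (2 ^ lg n) ^ 2 := by nlinarith
    calc (2 * n : ℤ) ≤ (2 ^ lg n) ^ 2 := by exact_mod_cast this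
      _ ≤ _ := pow_le_pow_right₀ (by exact_mod_cast hX.trans' one_le_two) (by norm_num)
  refine HT.forLoop (T₁ := 3) n (fun i s' => ∀ u : ℕ, s'.arr dst u =
    scale n * ((g u + histogram i f u : ℕ) : ℤ)) h0 (mul_scale_le (by omega)) rfl rfl ?_ ?_ ?_
    (by omega)
  · simpa [histogram] using hs0
  · intro i s' hi hs h24 hI
    have e9 : s'.reg 9 = scale n := by simpa [h9] using hs.reg 9 rfl
    have hval := he i hi s' hs h24
    refine HT.assign_seq (T₁ := 1) ?_ (HT.store ?_ fun u => ?_) le_rfl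
    · rw [hval, abs_of_nonneg (by positivity)]
      exact hf i hi
    · simp [hval, e9, hI]
      rw [← mul_add_one, abs_of_nonneg (by positivity)]
      have h1 := hg (f i)
      have h2 := histogram_le i f (f i)
      have h3 := scale_pow_two_le d n
      have h4 : (g (f i) : ℤ) + histogram i f (f i) + 1 ≤ scale n := by
        have : g (f i) + histogram i f (f i) + 1 ≤ 2 * n := by omega
        exact le_trans (by exact_mod_cast this) hnS
      nlinarith
    · rw [histogram_succ]
      by_cases hu : u = f i
      · simp [hval, hu, e9, hI]
        ring
      · have hu' : (u : ℤ) ≠ f i := by exact_mod_cast hu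
        simp [hval, hu, hI]
  · intro s' _ _ hI
    exact hI

/-! ## The fixed-point Fourier transform -/

theorem HasRoot.of_same {n K : ℕ} {s s' : State} {p : Cmd} (h : HasRoot n K s)
    (hs : p.Same s s') (h9 : p.writesReg 9 = false := by rfl)
    (h10 : p.writesReg 10 = false := by rfl) (h11 : p.writesReg 11 = false := by rfl)
    (h12 : p.writesReg 12 = false := by rfl) (h13 : p.writesReg 13 = false := by rfl) :
    HasRoot n K s' :=
  ⟨by rw [hs.reg _ h9, h.r9], by rw [hs.reg _ h10, h.r10], by rw [hs.reg _ h11, h.r11], h.two_le,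
    h.le, by rw [hs.reg _ h12]; exact h.cos, by rw [hs.reg _ h13]; exact h.sin⟩

theorem HasTwiddles.of_same {n K : ℕ} {s s' : State} {p : Cmd} (h : HasTwiddles n K s)
    (hs : p.Same s s') (h10 : p.writesArr 10 = false := by rfl)
    (h11 : p.writesArr 11 = false := by rfl) : HasTwiddles n K s' := by
  intro t ht
  rw [hs.arr _ h10, hs.arr _ h11]
  exact h t ht

/-- One step of the transform of the arrays `re` and `im`, with half-width in register `27`. -/
def stageCmd (re im : ℕ) : Cmd :=
  .seq
    (forLoop 28 10 <|
      .seq (assign 29 (reg 28 % reg 27 + (2 * reg 27 * (reg 28 / reg 27)) % reg 10)) <|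
      .seq (assign 30 (reg 28 / reg 27 * reg 27)) <|
      .seq (store 18 (reg 28) (load re (reg 29) + (load 10 (reg 30) * load re (reg 29 + reg 27) -
        load 11 (reg 30) * load im (reg 29 + reg 27)) / reg 9)) <|
      store 19 (reg 28) (load im (reg 29) + (load 10 (reg 30) * load im (reg 29 + reg 27) +
        load 11 (reg 30) * load re (reg 29 + reg 27)) / reg 9))
    (forLoop 28 10 <|
      .seq (store re (reg 28) (load 18 (reg 28))) <|
      store im (reg 28) (load 19 (reg 28)))

/-- Arrays `re` and `im` contain an approximation of `x` on the first `2 ^ K` cells. -/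
def HasArray (n K : ℕ) (e : ℝ) (x : ℕ → ℂ) (re im : ℕ) (s : State) : Prop :=
  ∀ o : ℕ, o < 2 ^ K → Approx (scale n) e (x o) (s.arr re o) (s.arr im o)

theorem HasArray.of_same {n K re im : ℕ} {e : ℝ} {x : ℕ → ℂ} {s s' : State} {p : Cmd}
    (h : HasArray n K e x re im s) (hs : p.Same s s') (hre : p.writesArr re = false := by rfl)
    (him : p.writesArr im = false := by rfl) : HasArray n K e x re im s' := by
  intro t ht
  rw [hs.arr _ hre, hs.arr _ him]
  exact h t ht

/-- The increase of the error in one step of the transform of an array with sum `A`. -/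
noncomputable def stageErr (K : ℕ) (A : ℝ) : ℝ := twiddleErr K * (A + 1) + 2

theorem two_pow_le_cellBound_of_hasRoot {d n K : ℕ} {s : State} (h : HasRoot n K s) :
    ((2 ^ K : ℕ) : ℤ) ≤ cellBound d n := by
  have h1 : ((2 ^ K : ℕ) : ℤ) ≤ 4 * modBound n := by exact_mod_cast h.le
  have := four_mul_modBound_le_scale n
  have := thousand_le_scale n
  exact mul_scale_le (by omega)

/-- The product with the twiddle factor has error e + `stageErr`, because the factor has norm one
and the cell norm at most A; the other summand contributes e. The results pass through the buffers
`18` and `19`, since updating in place would destroy cells that are still to be read. The range of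
`re` and `im` keeps them apart from the buffers and the twiddle factors. -/
theorem stageCmd_spec {d n K l re im : ℕ} {s : State} {x : ℕ → ℂ} {A e : ℝ} (h : HasRoot n K s)
    (ht : HasTwiddles n K s) (hl : l < K) (h27 : s.reg 27 = (2 ^ (K - (l + 1)) : ℕ))
    (hre : 12 ≤ re ∧ re ≤ 17) (him : 12 ≤ im ∧ im ≤ 17) (hne : re ≠ im)
    (hx : HasArray n K e (fftLevel K x l) re im s)
    (hA : ∑ u ∈ Finset.range (2 ^ K), ‖x u‖ ≤ A) (hAX : A ≤ (2 ^ lg n) ^ 20)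
    (he : e ≤ scale n) (he' : 2 * e + stageErr K A ≤ scale n) :
    HT (cellBound d n) (stageCmd re im) (30 * 2 ^ K) s
      (HasArray n K (2 * e + stageErr K A) (fftLevel K x (l + 1)) re im) := by
  have hS := thousand_le_scale n
  have hKB := two_pow_le_cellBound_of_hasRoot (d := d) h
  have h4 : 2 ^ 2 ≤ 2 ^ K := Nat.pow_le_pow_right two_pos h.two_le
  have hN : (2 ^ K : ℕ) ≠ 0 := by positivity
  set hh := 2 ^ (K - (l + 1)) with hhh
  have hhpos : 0 < hh := by positivity
  have hK : 2 ^ K = 2 ^ l * (2 * hh) := by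
    rw [hhh, ← pow_succ', ← pow_add]
    congr 1
    omega
  have bd : ∀ {o : ℕ} {u v : ℤ}, o < 2 ^ K →
      Approx (scale n) (2 * e + stageErr K A) (fftLevel K x (l + 1) o) u v →
      |u| ≤ cellBound d n ∧ |v| ≤ cellBound d n := fun ho ha =>
    ha.abs_le_cellBound (norm_fftLevel_le K x A hA (l + 1) hl _ ho) hAX he'
  refine HT.seq (T₁ := 2 ^ K * 10 + 3) (T₂ := 2 ^ K * 6 + 3)
    (R := HasArray n K (2 * e + stageErr K A) (fftLevel K x (l + 1)) 18 19) ?_ ?_ (by omega)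
  · refine HT.forLoop (T₁ := 7) (2 ^ K) (fun i s' => ∀ o : ℕ, o < i →
        Approx (scale n) (2 * e + stageErr K A) (fftLevel K x (l + 1) o) (s'.arr 18 o)
          (s'.arr 19 o)) (by simp [h.r10]) hKB rfl rfl ?_ ?_ ?_ (by omega)
    · simp
    · intro i s' hi hs h28 hI
      have e9 : s'.reg 9 = scale n := by simpa [h.r9] using hs.reg 9 rfl
      have e10 : s'.reg 10 = (2 ^ K : ℕ) := by simpa [h.r10] using hs.reg 10 rfl
      have e27 : s'.reg 27 = hh := by simpa [h27] using hs.reg 27 rfl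
      have e10' : s'.arr 10 = s.arr 10 := hs.arr 10 rfl
      have e11' : s'.arr 11 = s.arr 11 := hs.arr 11 rfl
      have ere : s'.arr re = s.arr re := hs.arr re (by simp [forLoop, writesArr]; omega)
      have eim : s'.arr im = s.arr im := hs.arr im (by simp [forLoop, writesArr]; omega)
      have hlt := fftSrc_add_lt hK hhpos i
      set q := fftSrc (2 ^ K) hh i with hq
      have hq' : (q : ℤ) = (i : ℤ) % hh + (2 * hh * (i / hh)) % (2 ^ K : ℕ) := by
        rw [hq, fftSrc]
        push_cast
        rfl
      have htw : i / hh * hh < 2 ^ K := (Nat.div_mul_le_self i hh).trans_lt hi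
      have hmul := (ht _ htw).mul (by omega) (hx _ hlt) (b := 1) (norm_zeta_pow hN _).le
        (norm_fftLevel_le K x A hA l hl.le _ hlt) he
      have hadd := (hx q (by omega)).add hmul
      have hnew : fftLevel K x (l + 1) i = fftLevel K x l q + zeta (2 ^ K) ^ (i / hh * hh) *
        fftLevel K x l (q + hh) := rfl
      rw [← hnew] at hadd
      have hadd' := hadd.mono (e' := 2 * e + stageErr K A) (by unfold stageErr; linarith)
      obtain ⟨b1, b2⟩ := bd hi hadd'
      push_cast at hadd' b1 b2
      have hqB : (q : ℤ) ≤ cellBound d n := by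
        refine le_trans ?_ hKB
        exact_mod_cast (by omega : q ≤ 2 ^ K)
      have htB : ((i : ℤ) / hh * hh) ≤ cellBound d n := by
        refine le_trans ?_ hKB
        exact_mod_cast htw.le
      refine HT.assign_seq (T₁ := 5) ?_ ?_ le_rfl
      · simp only [val_add, val_mod, val_mul, val_div, val_reg, val_ofNat, h28, e10, e27, ← hq']
        rwa [abs_of_nonneg (by positivity)]
      refine HT.assign_seq (T₁ := 3) ?_ ?_ le_rfl
      · simp [h28, e27]
        rwa [abs_of_nonneg (by positivity)]
      simp only [val_add, val_mod, val_mul, val_div, val_reg, val_ofNat, h28, e10, e27, ← hq']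
      have n18 : re ≠ 18 := by omega
      have n19 : im ≠ 18 := by omega
      refine HT.store_seq (T₁ := 1) ?_ (HT.store ?_ ?_) le_rfl
      · simpa [h28, e27, e9, e10', e11', ere, eim] using b1
      · simpa [h28, e27, e9, e10', e11', ere, eim, n18, n19] using b2
      · intro o ho
        rcases (Nat.lt_succ_iff_lt_or_eq.1 ho) with hlt | rfl
        · have hne : (o : ℤ) ≠ i := by omega
          simpa [h28, hne] using hI o hlt
        · simpa [h28, e27, e9, e10', e11', ere, eim, n18, n19] using hadd'
    · intro s' _ _ hI
      exact hI
  · intro s1 hs1 hI1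
    refine HT.forLoop (T₁ := 3) (2 ^ K) (fun i s' => ∀ o : ℕ, o < i →
        Approx (scale n) (2 * e + stageErr K A) (fftLevel K x (l + 1) o) (s'.arr re o)
          (s'.arr im o)) (by simpa [h.r10] using hs1.reg 10 rfl) hKB rfl rfl ?_ ?_ ?_ (by omega)
    · simp
    · intro i s' hi hs h28 hI
      have hr18 : (18 : ℕ) ≠ re ∧ (19 : ℕ) ≠ re := by omega
      have hi18 : (18 : ℕ) ≠ im ∧ (19 : ℕ) ≠ im := by omega
      have e18 : s'.arr 18 = s1.arr 18 := hs.arr 18 (by simp [forLoop, writesArr]; omega)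
      have e19 : s'.arr 19 = s1.arr 19 := hs.arr 19 (by simp [forLoop, writesArr]; omega)
      obtain ⟨b1, b2⟩ := bd hi (hI1 i hi)
      refine HT.store_seq (T₁ := 1) (by simpa [h28, e18] using b1)
        (HT.store (by simpa [h28, e19, hr18] using b2) ?_) le_rfl
      intro o ho
      rcases (Nat.lt_succ_iff_lt_or_eq.1 ho) with hlt | rfl
      · have hne : (o : ℤ) ≠ i := by omega
        simpa [h28, hne] using hI o hlt
      · simpa [h28, e18, e19, hr18, hne] using hI1 o hi
    · intro s' _ _ hI
      exact hI

/-- The Fourier transform of the arrays `re` and `im`. -/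
def fftCmd (re im : ℕ) : Cmd :=
  .seq (assign 27 (reg 10)) <|
  forLoop 26 11 <|
    .seq (assign 27 (reg 27 / 2)) (stageCmd re im)

/-- The error of the transform of an array with sum at most `A`. -/
noncomputable def fftErr (K : ℕ) (A : ℝ) : ℝ := 2 ^ K * stageErr K A

theorem fftCmd_spec {d n K re im : ℕ} {s : State} {x : ℕ → ℂ} {A : ℝ} (h : HasRoot n K s)
    (ht : HasTwiddles n K s) (hre : 12 ≤ re ∧ re ≤ 17) (him : 12 ≤ im ∧ im ≤ 17) (hne : re ≠ im)
    (hx : HasArray n K 0 x re im s) (hA : ∑ u ∈ Finset.range (2 ^ K), ‖x u‖ ≤ A)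
    (hAX : A ≤ (2 ^ lg n) ^ 20) (he : fftErr K A ≤ scale n) :
    HT (cellBound d n) (fftCmd re im) (40 * K * 2 ^ K) s
      (HasArray n K (fftErr K A) (dft (2 ^ K) x) re im) := by
  have hKB := two_pow_le_cellBound_of_hasRoot (d := d) h
  have hK2 := h.two_le
  have h4 : 2 ^ 2 ≤ 2 ^ K := Nat.pow_le_pow_right two_pos h.two_le
  have hA0 : 0 ≤ A := le_trans (Finset.sum_nonneg fun _ _ => norm_nonneg _) hA
  have hT0 : 0 ≤ twiddleErr K := by unfold twiddleErr; positivity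
  have hC0 : 0 ≤ stageErr K A := by unfold stageErr; positivity
  -- Iterating e ↦ 2e + `stageErr` from 0 gives (2^l - 1) `stageErr` after l steps.
  have hlev : ∀ l ≤ K, (2 ^ l - 1) * stageErr K A ≤ fftErr K A := fun l hl => by
    unfold fftErr
    have : (2 : ℝ) ^ l ≤ 2 ^ K := pow_le_pow_right₀ one_le_two hl
    gcongr
    linarith
  refine HT.assign_seq (T₁ := K * (30 * 2 ^ K + 2 + 3) + 3) ?_ ?_ ?_
  · simp only [val_reg, h.r10]
    rwa [abs_of_nonneg (by positivity)]
  · refine HT.forLoop (T₁ := 30 * 2 ^ K + 2) K (fun l s' => HasArray n K ((2 ^ l - 1) * stageErr K A)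
      (fftLevel K x l) re im s' ∧ s'.reg 27 = (2 ^ (K - l) : ℕ)) (by simp [h.r11]) ?_ rfl rfl ?_ ?_ ?_
      le_rfl
    · exact le_trans (by exact_mod_cast Nat.lt_two_pow_self.le) hKB
    · refine ⟨?_, by simp [h.r10]⟩
      simpa [fftLevel, HasArray] using hx
    · rintro l s' hl hs h26 ⟨ha, h27⟩
      have hp : ((2 ^ (K - l) : ℕ) : ℤ) / 2 = (2 ^ (K - (l + 1)) : ℕ) := by
        rw [show K - l = K - (l + 1) + 1 by omega, pow_succ]
        push_cast
        omega
      have hpB : ((2 ^ (K - (l + 1)) : ℕ) : ℤ) ≤ cellBound d n := le_trans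
        (by exact_mod_cast Nat.pow_le_pow_right two_pos (Nat.sub_le K (l + 1))) hKB
      have hw : ∀ k, (stageCmd re im).writesArr k = (forLoop 26 11 <|
        .seq (assign 27 (reg 27 / 2)) (stageCmd re im)).writesArr k := fun k => by
        simp [forLoop, writesArr]
      refine HT.assign_seq (T₁ := 30 * 2 ^ K) ?_ ?_ le_rfl
      · simp only [val_div, val_reg, val_ofNat, h27]
        rw [hp, abs_of_nonneg (by positivity)]
        exact hpB
      have hr' : HasRoot n K ((s'.setReg 27 (2 ^ (K - (l + 1)) : ℕ))) := by
        have hr := h.of_same (s' := s') (p := forLoop 26 11 <|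
          .seq (assign 27 (reg 27 / 2)) (stageCmd re im)) ⟨fun y hy => ?_, fun k hk => ?_, fun ho => ?_⟩
        · exact ⟨by simp [hr.r9], by simp [hr.r10], by simp [hr.r11], hr.two_le, hr.le,
            by simpa using hr.cos, by simpa using hr.sin⟩
        · rw [hs.reg y hy, State.setReg_reg, if_neg]
          rintro rfl
          simp [forLoop, writesReg] at hy
        · rw [hs.arr k hk]; rfl
        · rw [hs.out ho]; rfl
      simp only [val_div, val_reg, val_ofNat, h27, hp]
      refine (stageCmd_spec (l := l) hr' ?_ hl (by simp) hre him hne (e := (2 ^ l - 1) * stageErr K A)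
        (x := x) (by simpa [HasArray] using ha) hA hAX ((hlev l hl.le).trans he) ?_).conseq le_rfl ?_
      · intro t htt
        rw [State.setReg_arr, hs.arr 10 (by simp [forLoop, writesArr, stageCmd]; omega),
          hs.arr 11 (by simp [forLoop, writesArr, stageCmd]; omega)]
        exact ht t htt
      · refine le_trans (le_of_eq ?_) ((hlev (l + 1) hl).trans he)
        rw [pow_succ]; ring
      · intro s'' hs'' hres
        refine ⟨?_, ?_⟩
        · have : (2 : ℝ) * ((2 ^ l - 1) * stageErr K A) + stageErr K A =
              (2 ^ (l + 1) - 1) * stageErr K A := by rw [pow_succ]; ring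
          rw [this] at hres
          simpa [HasArray] using hres
        · have := hs''.reg 27 rfl
          simpa using this
    · rintro s' - - ⟨ha, -⟩ o ho
      rw [← fftLevel_last K x o ho]
      exact (ha o ho).mono (hlev K le_rfl)
  · nlinarith [Nat.mul_le_mul hK2 h4]

/-- The sum of the products of the three transforms. -/
def sumCmd : Cmd :=
  .seq (assign 31 0) <|
  forLoop 28 10 <|
    .seq (assign 32 ((load 12 (reg 28) * load 14 (reg 28) -
      load 13 (reg 28) * load 15 (reg 28)) / reg 9)) <|
    .seq (assign 33 ((load 12 (reg 28) * load 15 (reg 28) +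
      load 13 (reg 28) * load 14 (reg 28)) / reg 9)) <|
    assign 31 (reg 31 + (reg 32 * load 16 (reg 28) - reg 33 * load 17 (reg 28)) / reg 9)

/-- The error of a product of three numbers of absolute value at most `A`. -/
noncomputable def prodErr (A e : ℝ) : ℝ := (e * (A + 1) + A * e + 2) * (A + 1) + A ^ 2 * e + 2

/-- Two applications of `Approx.mul`, with norms A, A and then A², A, give the error of one product.
Only real parts are accumulated, because the sum of interest is a natural number. -/
theorem sumCmd_spec {d n K : ℕ} {s : State} {x y z : ℕ → ℂ} {A e : ℝ} (h : HasRoot n K s)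
    (hx : HasArray n K e x 12 13 s) (hy : HasArray n K e y 14 15 s) (hz : HasArray n K e z 16 17 s)
    (hxA : ∀ o < 2 ^ K, ‖x o‖ ≤ A) (hyA : ∀ o < 2 ^ K, ‖y o‖ ≤ A) (hzA : ∀ o < 2 ^ K, ‖z o‖ ≤ A)
    (hA : 1 ≤ A) (hAX : 2 ^ K * A ^ 3 ≤ (2 ^ lg n) ^ 20) (hp : 2 ^ K * prodErr A e ≤ scale n) :
    HT (cellBound d n) sumCmd (20 * 2 ^ K) s fun s' =>
      |(s'.reg 31 : ℝ) - scale n * (∑ o ∈ Finset.range (2 ^ K), x o * y o * z o).re| ≤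
        2 ^ K * prodErr A e := by
  have hS := thousand_le_scale n
  have hS' : (0 : ℝ) ≤ scale n := by exact_mod_cast (by omega : 0 ≤ scale n)
  have hKB := two_pow_le_cellBound_of_hasRoot (d := d) h
  have h4 : 2 ^ 2 ≤ 2 ^ K := Nat.pow_le_pow_right two_pos h.two_le
  have h1K : (1 : ℝ) ≤ 2 ^ K := one_le_pow₀ one_le_two
  have he0 : 0 ≤ e := (norm_nonneg _).trans (hx 0 (by omega))
  have hp0 : 0 ≤ prodErr A e := by unfold prodErr; positivity
  have hA0 : (0 : ℝ) ≤ A := by linarith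
  have hpS : prodErr A e ≤ scale n := by nlinarith
  have he : e ≤ scale n := by
    refine le_trans ?_ hpS
    unfold prodErr
    nlinarith [mul_nonneg he0 hA0, mul_nonneg (mul_nonneg he0 hA0) hA0]
  have hA3 : A ^ 3 ≤ (2 ^ lg n) ^ 20 := by nlinarith [pow_nonneg hA0 3]
  have hA2 : A ^ 2 ≤ (2 ^ lg n) ^ 20 := (pow_le_pow_right₀ hA (by norm_num)).trans hA3
  have hiK : ∀ i : ℕ, i ≤ 2 ^ K → (i : ℝ) ≤ 2 ^ K := fun i hi => by exact_mod_cast hi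
  have bsum : ∀ {i : ℕ} {v : ℤ}, i ≤ 2 ^ K →
      |(v : ℝ) - scale n * (∑ o ∈ Finset.range i, x o * y o * z o).re| ≤ i * prodErr A e →
      |v| ≤ cellBound d n := by
    intro i v hi hv
    have h1 : ‖∑ o ∈ Finset.range i, x o * y o * z o‖ ≤ 2 ^ K * A ^ 3 := by
      refine (norm_sum_le _ _).trans ?_
      refine (Finset.sum_le_card_nsmul _ _ (A ^ 3) fun o ho => ?_).trans ?_
      · have ho' : o < 2 ^ K := (Finset.mem_range.1 ho).trans_le hi
        rw [norm_mul, norm_mul, pow_succ, pow_two]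
        gcongr
        exacts [hxA o ho', hyA o ho', hzA o ho']
      · rw [Finset.card_range, nsmul_eq_mul]
        gcongr
        exact hiK i hi
    -- The partial sum is regarded as an approximation of a real number, so that the size bound for
    -- approximations applies.
    have hre : Approx (scale n) (i * prodErr A e) ((∑ o ∈ Finset.range i, x o * y o * z o).re : ℂ)
        v 0 := by
      unfold Approx
      rw [show ((v : ℂ) + ((0 : ℤ) : ℂ) * Complex.I - scale n *
        ((∑ o ∈ Finset.range i, x o * y o * z o).re : ℂ)) = (((v : ℝ) - scale n *
        (∑ o ∈ Finset.range i, x o * y o * z o).re : ℝ) : ℂ) by push_cast; ring,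
        Complex.norm_real]
      exact hv
    refine (hre.abs_le_cellBound (A := 2 ^ K * A ^ 3) ?_ hAX ?_).1
    · rw [Complex.norm_real]
      exact (Complex.abs_re_le_norm _).trans h1
    · refine le_trans ?_ hp
      gcongr
      exact hiK i hi
  refine HT.assign_seq (T₁ := 2 ^ K * 8 + 3)
    (by simpa using le_cellBound_of_le (by norm_num)) ?_ (by omega)
  refine HT.forLoop (T₁ := 5) (2 ^ K) (fun i s' =>
    |(s'.reg 31 : ℝ) - scale n * (∑ o ∈ Finset.range i, x o * y o * z o).re| ≤ i * prodErr A e)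
    (by simp [h.r10]) hKB rfl rfl (by simp) ?_ ?_ (by omega)
  · intro i s' hi hs h28 hI
    have e9 : s'.reg 9 = scale n := by simpa [h.r9] using hs.reg 9 rfl
    have e12 : s'.arr 12 = s.arr 12 := hs.arr 12 rfl
    have e13 : s'.arr 13 = s.arr 13 := hs.arr 13 rfl
    have e14 : s'.arr 14 = s.arr 14 := hs.arr 14 rfl
    have e15 : s'.arr 15 = s.arr 15 := hs.arr 15 rfl
    have e16 : s'.arr 16 = s.arr 16 := hs.arr 16 rfl
    have e17 : s'.arr 17 = s.arr 17 := hs.arr 17 rfl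
    have m1 := (hx i hi).mul (by omega) (hy i hi) (hxA i hi) (hyA i hi) he
    have n1 : ‖x i * y i‖ ≤ A ^ 2 := by
      rw [norm_mul, pow_two]
      gcongr
      exacts [hxA i hi, hyA i hi]
    have m2 := m1.mul (by omega) (hz i hi) n1 (hzA i hi) he
    have he1 : e * (A + 1) + A * e + 2 ≤ scale n := by
      refine le_trans ?_ hpS
      unfold prodErr
      have : 0 ≤ e * (A + 1) + A * e + 2 := by positivity
      nlinarith [mul_nonneg (pow_nonneg hA0 2) he0]
    obtain ⟨b1, b2⟩ := m1.abs_le_cellBound (d := d) n1 hA2 he1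
    set u := (s.arr 12 i * s.arr 14 i - s.arr 13 i * s.arr 15 i) / scale n with hu
    set v := (s.arr 12 i * s.arr 15 i + s.arr 13 i * s.arr 14 i) / scale n with hv
    have m3 : |(((u * s.arr 16 i - v * s.arr 17 i) / scale n : ℤ) : ℝ) -
        scale n * (x i * y i * z i).re| ≤ prodErr A e := by
      have := (Complex.abs_re_le_norm _).trans m2
      simpa [prodErr] using this
    have hnew : |((s'.reg 31 + (u * s.arr 16 i - v * s.arr 17 i) / scale n : ℤ) : ℝ) -
        scale n * (∑ o ∈ Finset.range (i + 1), x o * y o * z o).re| ≤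
        (i + 1 : ℕ) * prodErr A e := by
      rw [Finset.sum_range_succ, Complex.add_re]
      push_cast
      rw [abs_le] at hI m3 ⊢
      constructor <;> linarith [hI.1, hI.2, m3.1, m3.2]
    refine HT.assign_seq (T₁ := 3) ?_ (HT.assign_seq (T₁ := 1) ?_ (HT.assign ?_ ?_) le_rfl) le_rfl
    · simpa [h28, e9, e12, e13, e14, e15] using b1
    · simpa [h28, e9, e12, e13, e14, e15] using b2
    · have := bsum hi hnew
      simpa [h28, e9, e12, e13, e14, e15, e16, e17, ← hu, ← hv] using this
    · simpa [h28, e9, e12, e13, e14, e15, e16, e17, ← hu, ← hv] using hnew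
  · intro s' _ _ hI
    simpa using hI

/-! ## Counting triples modulo `m` -/

/-- The number of triples with `a i + b j + c k ≡ 0` modulo `m`. -/
def tripleCount (n m : ℕ) (a b c : ℕ → ℤ) : ℕ :=
  ∑ i ∈ Finset.range n, ∑ j ∈ Finset.range n, ∑ k ∈ Finset.range n,
    if (m : ℤ) ∣ a i + b j + c k then 1 else 0

/-- The residue of `a i` modulo `m`. -/
def residue (m : ℕ) (a : ℕ → ℤ) (i : ℕ) : ℕ := (a i % m).toNat

/-- The index that completes two residues with sum `-c k mod m` to a multiple of `N`. -/
def lowIndex (N m : ℕ) (c : ℕ → ℤ) (k : ℕ) : ℕ := (((N : ℤ) - (0 - c k) % m) % N).toNat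

/-- The index that completes two residues with sum `-c k mod m + m` to a multiple of `N`. -/
def highIndex (N m : ℕ) (c : ℕ → ℤ) (k : ℕ) : ℕ := ((N : ℤ) - (0 - c k) % m - m).toNat

section
variable {N m : ℕ} (hm : 0 < m) (hN : 2 * m ≤ N) (a b c : ℕ → ℤ) (i j k : ℕ)
include hm

theorem residue_cast : (residue m a i : ℤ) = a i % m :=
  Int.toNat_of_nonneg (Int.emod_nonneg _ (by omega))

theorem residue_lt : residue m a i < m := by
  have := residue_cast hm a i
  have := Int.emod_lt_of_pos (a i) (show (0 : ℤ) < m by omega)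
  omega

include hN

theorem lowIndex_cast : (lowIndex N m c k : ℤ) = ((N : ℤ) - (0 - c k) % m) % N :=
  Int.toNat_of_nonneg (Int.emod_nonneg _ (by omega))

theorem lowIndex_lt : lowIndex N m c k < N := by
  have := lowIndex_cast hm hN c k
  have := Int.emod_lt_of_pos ((N : ℤ) - (0 - c k) % m) (show (0 : ℤ) < N by omega)
  omega

theorem highIndex_cast : (highIndex N m c k : ℤ) = (N : ℤ) - (0 - c k) % m - m := by
  have := Int.emod_lt_of_pos (0 - c k) (show (0 : ℤ) < m by omega)
  exact Int.toNat_of_nonneg (by omega)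

theorem highIndex_lt : highIndex N m c k < N := by
  have := highIndex_cast hm hN c k
  have := Int.emod_nonneg (0 - c k) (show (m : ℤ) ≠ 0 by omega)
  omega

/-- The sum of the residues and the target both lie in [0, 2m), hence in [0, N), so congruence
modulo N is equality. The reduction modulo N in the index matters only for target 0, where N itself
is not an index. -/
theorem dvd_add_lowIndex_iff : N ∣ residue m a i + residue m b j + lowIndex N m c k ↔
    (residue m a i + residue m b j : ℤ) = (0 - c k) % m := by
  have h1 := residue_lt hm a i
  have h2 := residue_lt hm b j
  have h3 := Int.emod_lt_of_pos (0 - c k) (show (0 : ℤ) < m by omega)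
  have h4 := Int.emod_nonneg (0 - c k) (show (m : ℤ) ≠ 0 by omega)
  rw [← Int.natCast_dvd_natCast]
  push_cast
  rw [lowIndex_cast hm hN]
  have h5 : (N : ℤ) ∣ residue m a i + residue m b j + ((N : ℤ) - (0 - c k) % m) % N ↔
      (N : ℤ) ∣ residue m a i + residue m b j - (0 - c k) % m := by
    rw [Int.dvd_iff_emod_eq_zero, Int.dvd_iff_emod_eq_zero, Int.add_emod_emod]
    rw [show (residue m a i : ℤ) + residue m b j + (N - (0 - c k) % m) =
      residue m a i + residue m b j - (0 - c k) % m + N by ring, Int.add_emod_right]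
  rw [h5]
  constructor
  · intro h
    have := Int.eq_zero_of_abs_lt_dvd h (by rw [abs_lt]; constructor <;> omega)
    omega
  · intro h
    rw [h, sub_self]
    exact dvd_zero _

theorem dvd_add_highIndex_iff : N ∣ residue m a i + residue m b j + highIndex N m c k ↔
    (residue m a i + residue m b j : ℤ) = (0 - c k) % m + m := by
  have h1 := residue_lt hm a i
  have h2 := residue_lt hm b j
  have h3 := Int.emod_lt_of_pos (0 - c k) (show (0 : ℤ) < m by omega)
  have h4 := Int.emod_nonneg (0 - c k) (show (m : ℤ) ≠ 0 by omega)
  rw [← Int.natCast_dvd_natCast]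
  push_cast
  rw [highIndex_cast hm hN]
  rw [show (residue m a i : ℤ) + residue m b j + (N - (0 - c k) % m - m) =
      residue m a i + residue m b j - (0 - c k) % m - m + N by ring, dvd_add_self_right]
  constructor
  · intro h
    have := Int.eq_zero_of_abs_lt_dvd h (by rw [abs_lt]; constructor <;> omega)
    omega
  · intro h
    rw [h]
    simp

omit hN in
-- Two residues add up to less than 2m, and only two numbers in [0, 2m) are congruent to a given
-- target below m.
theorem dvd_sum_iff : (m : ℤ) ∣ a i + b j + c k ↔
    (residue m a i + residue m b j : ℤ) = (0 - c k) % m ∨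
      (residue m a i + residue m b j : ℤ) = (0 - c k) % m + m := by
  have h1 := residue_lt hm a i
  have h2 := residue_lt hm b j
  have h3 := Int.emod_lt_of_pos (0 - c k) (show (0 : ℤ) < m by omega)
  have h4 := Int.emod_nonneg (0 - c k) (show (m : ℤ) ≠ 0 by omega)
  have key : (m : ℤ) ∣ a i + b j + c k ↔
      (m : ℤ) ∣ residue m a i + residue m b j - (0 - c k) % m := by
    rw [residue_cast hm, residue_cast hm]
    rw [Int.dvd_iff_emod_eq_zero, Int.dvd_iff_emod_eq_zero, Int.sub_emod_emod, Int.sub_emod,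
      ← Int.add_emod, ← Int.sub_emod]
    rw [show a i + b j - (0 - c k) = a i + b j + c k by ring]
  rw [key]
  constructor
  · rintro ⟨q, hq⟩
    have hq1 : -1 < q := by
      by_contra! h
      nlinarith
    have hq2 : q < 2 := by
      by_contra! h
      nlinarith
    have : q = 0 ∨ q = 1 := by omega
    rcases this with rfl | rfl
    · left; linarith
    · right; linarith
  · rintro (h | h) <;> rw [h] <;> simp

/-- The two cases of `dvd_sum_iff` exclude each other because m > 0, so each hit is counted exactly
once. -/
theorem solutions_add_solutions (n : ℕ) :
    solutions n N (residue m a) (residue m b) (lowIndex N m c) +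
      solutions n N (residue m a) (residue m b) (highIndex N m c) = tripleCount n m a b c := by
  simp only [solutions, tripleCount, ← Finset.sum_add_distrib]
  refine Finset.sum_congr rfl fun i _ => Finset.sum_congr rfl fun j _ =>
    Finset.sum_congr rfl fun k _ => ?_
  have h1 := dvd_add_lowIndex_iff hm hN a b c i j k
  have h2 := dvd_add_highIndex_iff hm hN a b c i j k
  have h3 := dvd_sum_iff hm a b c i j k
  by_cases hl : (residue m a i + residue m b j : ℤ) = (0 - c k) % m
  · rw [if_pos (h1.2 hl), if_neg (fun h => by have := h2.1 h; omega), if_pos (h3.2 (.inl hl))]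
  · rw [if_neg (fun h => hl (h1.1 h))]
    by_cases hr : (residue m a i + residue m b j : ℤ) = (0 - c k) % m + m
    · rw [if_pos (h2.2 hr), if_pos (h3.2 (.inr hr))]
    · rw [if_neg (fun h => hr (h2.1 h)), if_neg (fun h => (h3.1 h).elim hl hr)]

end

/-! ### Error budget and correctness of the count -/

theorem dft_add (N : ℕ) (x y : ℕ → ℂ) (k : ℕ) :
    dft N (fun u => x u + y u) k = dft N x k + dft N y k := by
  simp [dft, add_mul, Finset.sum_add_distrib]

theorem norm_dft_le {N : ℕ} (hN : N ≠ 0) (x : ℕ → ℂ) (k : ℕ) :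
    ‖dft N x k‖ ≤ ∑ u ∈ Finset.range N, ‖x u‖ := by
  refine (norm_sum_le _ _).trans (le_of_eq ?_)
  simp [-norm_pow, norm_zeta_pow hN]

/-- All quantities are compared with powers of X: 2^K ≤ X^4, the twiddle error is at most X^12 and
2n + 2 ≤ X^2. Hence `stageErr`, `fftErr` and `prodErr` are at most X^15, X^19 and X^27, far below
the scale X^64. The sum bound 2n + 1 covers the array with two histograms, and is at least 1 even
for n = 0. -/
theorem two_mul_two_pow_mul_prodErr_lt {n K : ℕ} (hK : 2 ^ K ≤ 4 * modBound n) :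
    fftErr K (2 * n + 1) ≤ scale n ∧ 2 ^ K * prodErr (2 * n + 1) (fftErr K (2 * n + 1)) ≤ scale n ∧
    2 * prodErr (2 * n + 1) (fftErr K (2 * n + 1)) < scale n := by
  have hX := two_le_two_pow_lg_real n
  have hE := twiddleErr_le hK
  have hE0 : 0 ≤ twiddleErr K := by unfold twiddleErr; positivity
  have hKX := two_pow_le_of_le_modBound hK
  have hn : (n : ℝ) + 1 ≤ 2 ^ lg n := by exact_mod_cast lt_two_pow_lg n
  have hS28 : ((2 : ℝ) ^ lg n) ^ 28 < scale n := by
    unfold scale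
    push_cast
    exact pow_lt_pow_right₀ (by linarith) (by norm_num)
  have hS31 := pow_le_scale (n := n) (k := 31) (by norm_num)
  have hS19 := pow_le_scale (n := n) (k := 19) (by norm_num)
  set X : ℝ := 2 ^ lg n with hXdef
  have hX1 : 1 ≤ X := by linarith
  have hA1 : (2 * n + 1 : ℝ) + 1 ≤ X ^ 2 := by nlinarith
  have hA : (2 * n + 1 : ℝ) ≤ X ^ 2 := by linarith
  have hpow : ∀ k, 2 ≤ X ^ (k + 1) := fun k => hX.trans (le_self_pow₀ hX1 (by omega))
  have hC : stageErr K (2 * n + 1) ≤ X ^ 15 := by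
    calc stageErr K (2 * n + 1) ≤ X ^ 12 * X ^ 2 + X ^ 14 := by
          unfold stageErr
          gcongr
          exact hpow 13
      _ = 2 * X ^ 14 := by ring
      _ ≤ X * X ^ 14 := by gcongr
      _ = _ := by ring
  have hC0 : 0 ≤ stageErr K (2 * n + 1) := by unfold stageErr; positivity
  have he : fftErr K (2 * n + 1) ≤ X ^ 19 := by
    calc fftErr K (2 * n + 1) ≤ X ^ 4 * X ^ 15 := by unfold fftErr; gcongr
      _ = _ := by ring
  have he0 : 0 ≤ fftErr K (2 * n + 1) := by unfold fftErr; positivity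
  set e := fftErr K (2 * n + 1)
  have hp : prodErr (2 * n + 1) e ≤ X ^ 27 := by
    have h1 : e * ((2 * n + 1 : ℝ) + 1) + (2 * n + 1) * e + 2 ≤ X ^ 23 := by
      calc _ ≤ X ^ 19 * X ^ 2 + X ^ 2 * X ^ 19 + X ^ 21 := by
            gcongr
            exact hpow 20
        _ ≤ (2 * 2) * X ^ 21 := by nlinarith [pow_nonneg (show (0 : ℝ) ≤ X by linarith) 21]
        _ ≤ (X * X) * X ^ 21 := by gcongr
        _ = _ := by ring
    unfold prodErr
    calc _ ≤ X ^ 23 * X ^ 2 + (X ^ 2) ^ 2 * X ^ 19 + X ^ 25 := by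
          gcongr
          exact hpow 24
      _ = X ^ 25 + X ^ 23 + X ^ 25 := by ring
      _ ≤ (2 * 2) * X ^ 25 := by
          have : X ^ 23 ≤ X ^ 25 := pow_le_pow_right₀ hX1 (by norm_num)
          linarith [pow_nonneg (show (0 : ℝ) ≤ X by linarith) 25]
      _ ≤ (X * X) * X ^ 25 := by gcongr
      _ = _ := by ring
  have hp0 : 0 ≤ prodErr (2 * n + 1) e := by unfold prodErr; positivity
  refine ⟨he.trans hS19, ?_, ?_⟩
  · calc _ ≤ X ^ 4 * X ^ 27 := by gcongr
      _ = X ^ 31 := by ring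
      _ ≤ _ := hS31
  · calc _ ≤ X * X ^ 27 := by gcongr
      _ = X ^ 28 := by ring
      _ < _ := hS28

/-- Computes in register `31` an approximation of the number of triples modulo register `6`, scaled
by the product of the scale and the length of the transform. -/
def countCmd : Cmd :=
  .seq scaleCmd <|
  .seq rootCmd <|
  .seq twiddleCmd <|
  .seq (histCmd 12 (load 0 (reg 24) % reg 6)) <|
  .seq (histCmd 14 (load 1 (reg 24) % reg 6)) <|
  .seq (histCmd 16 ((reg 10 - (0 - load 2 (reg 24)) % reg 6) % reg 10)) <|
  .seq (histCmd 16 (reg 10 - (0 - load 2 (reg 24)) % reg 6 - reg 6)) <|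
  .seq (fftCmd 12 13) <|
  .seq (fftCmd 14 15) <|
  .seq (fftCmd 16 17) <|
  sumCmd

/-- The arrays `0`, `1`, `2` contain the sequences `a`, `b`, `c` on the first `n` cells. -/
structure HasInput (n : ℕ) (a b c : ℕ → ℤ) (s : State) : Prop where
  a0 : ∀ i : ℕ, i < n → s.arr 0 i = a i
  a1 : ∀ i : ℕ, i < n → s.arr 1 i = b i
  a2 : ∀ i : ℕ, i < n → s.arr 2 i = c i

theorem HasInput.of_same {n : ℕ} {a b c : ℕ → ℤ} {s s' : State} {p : Cmd} (h : HasInput n a b c s)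
    (hs : p.Same s s') (h0 : p.writesArr 0 = false := by rfl)
    (h1 : p.writesArr 1 = false := by rfl) (h2 : p.writesArr 2 = false := by rfl) :
    HasInput n a b c s' :=
  ⟨by rw [hs.arr _ h0]; exact h.a0, by rw [hs.arr _ h1]; exact h.a1,
    by rw [hs.arr _ h2]; exact h.a2⟩

theorem hasArray_zero {n K re im : ℕ} {g : ℕ → ℕ} {s : State}
    (hre : ∀ u : ℕ, s.arr re u = scale n * (g u : ℕ)) (him : ∀ u : ℕ, s.arr im u = 0) :
    HasArray n K 0 (fun u => (g u : ℂ)) re im s := by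
  intro o _
  unfold Approx
  rw [hre, him]
  simp

/-- The total error is at most N times `prodErr`, less than half of S N; so the register determines
the count, although no rounding is carried out. The arrays from `12` on have to be zero at the start
because the histograms are added to them and the imaginary parts are never initialized. -/
theorem countCmd_spec {d n m : ℕ} {s : State} {a b c : ℕ → ℤ} (h : HasParams d n s)
    (hi : HasInput n a b c s) (h6 : s.reg 6 = m) (hm : 0 < m) (hmM : m ≤ modBound n)
    (hz : ∀ k, 12 ≤ k → ∀ i, s.arr k i = 0) :
    HT (cellBound d n) countCmd (6000 * modBound n * lg n * lg n) s fun s' =>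
      ∃ K, s'.reg 9 = scale n ∧ s'.reg 10 = (2 ^ K : ℕ) ∧
        2 * |s'.reg 31 - scale n * (2 ^ K : ℕ) * tripleCount n m a b c| < scale n * (2 ^ K : ℕ) := by
  have hS := thousand_le_scale n
  have hl := one_le_lg n
  have hnM : n ≤ modBound n := by
    unfold modBound
    rcases Nat.eq_zero_or_pos n with h0 | h0
    · omega
    · have : 0 < sqrtUp n := by
        by_contra h'
        have := le_sqrtUp_mul_self n
        have : sqrtUp n = 0 := by omega
        simp [this] at *
        omega
      nlinarith
  have hM1 : 1 ≤ modBound n := Nat.succ_pos _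
  -- All running times are bounded by multiples of one quantity, which makes the bookkeeping of the
  -- time budget linear.
  obtain ⟨U, hU⟩ : ∃ U, U = modBound n * lg n * lg n := ⟨_, rfl⟩
  have hU1 : lg n * lg n ≤ U := by rw [hU, mul_assoc]; exact Nat.le_mul_of_pos_left _ hM1
  have hU2 : modBound n ≤ U := by
    rw [hU, mul_assoc]
    exact Nat.le_mul_of_pos_right _ (Nat.mul_pos hl hl)
  have hU3 : modBound n * lg n ≤ U := by rw [hU]; exact Nat.le_mul_of_pos_right _ hl
  have hroot := fun s hp h9 => (rootCmd_spec (d := d) (n := n) (s := s) hp h9).conseq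
    (show 2100 * lg n * lg n ≤ 2100 * U by nlinarith) fun _ _ h => h
  refine HT.conseq (T₁ := 6000 * U) (Q := fun s' => _) ?_ (by rw [hU]; nlinarith) fun _ _ h => h
  refine HT.seq (T₂ := 5900 * U) (scaleCmd_spec h) ?_ (by omega)
  intro s1 hs1 h9
  refine HT.seq (T₂ := 3700 * U) (hroot _ (h.of_same hs1) h9) ?_ (by omega)
  rintro s2 hs2 ⟨K, hr2, hMK⟩
  have hKU : 2 ^ K ≤ 4 * U := hr2.le.trans (by omega)
  have hKKU : 40 * K * 2 ^ K ≤ 640 * U := by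
    have h1 := le_four_mul_lg hr2.le
    calc 40 * K * 2 ^ K ≤ 40 * (4 * lg n) * (4 * modBound n) := by gcongr; exact hr2.le
      _ = 640 * (modBound n * lg n) := by ring
      _ ≤ _ := by omega
  set N := 2 ^ K with hN
  have hN0 : N ≠ 0 := by positivity
  have hmN : 2 * m ≤ N := by omega
  have hNB := two_pow_le_cellBound_of_hasRoot (d := d) hr2
  have hcell : ∀ {f : ℕ → ℕ}, (∀ i < n, f i < N) → ∀ i < n, (f i : ℤ) ≤ cellBound d n :=
    fun hf i hi => le_trans (by exact_mod_cast (hf i hi).le) hNB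
  have hfa : ∀ i < n, residue m a i < N := fun i _ => (residue_lt hm a i).trans_le (by omega)
  have hfb : ∀ i < n, residue m b i < N := fun i _ => (residue_lt hm b i).trans_le (by omega)
  have hfl : ∀ i < n, lowIndex N m c i < N := fun i _ => lowIndex_lt hm hmN c i
  have hfh : ∀ i < n, highIndex N m c i < N := fun i _ => highIndex_lt hm hmN c i
  refine HT.seq (T₂ := 3600 * U) (twiddleCmd_spec hr2) ?_ (by omega)
  intro s3 hs3 ht3
  have hr3 := hr2.of_same hs3
  have z3 : ∀ k, 12 ≤ k → k ≤ 17 → ∀ i, s3.arr k i = 0 := fun k h1 h2 i => by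
    have e1 : s3.arr k = s2.arr k := hs3.arr k (by simp [twiddleCmd, forLoop, writesArr]; omega)
    have e2 : s2.arr k = s1.arr k := hs2.arr k (by simp [rootCmd, sqrtCmd, forLoop, writesArr])
    have e3 : s1.arr k = s.arr k := hs1.arr k (by simp [scaleCmd, writesArr])
    rw [e1, e2, e3, hz k h1]
  have hi3 := ((hi.of_same hs1).of_same hs2).of_same hs3
  have p3 := ((h.of_same hs1).of_same hs2).of_same hs3
  have h63 : s3.reg 6 = m := by rw [hs3.reg 6 rfl, hs2.reg 6 rfl, hs1.reg 6 rfl, h6]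
  clear hs1 hs2 hs3 h9 hroot
  -- the histograms
  refine HT.seq (T₁ := 20 * U) (T₂ := 3500 * U) ((histCmd_spec (residue m a) (fun _ => 0) p3.r0 hr3.r9
    (fun i hin s' hs' h24 => ?_) (hcell hfa) (fun _ => Nat.zero_le _)
    (fun u => by simp [z3])).conseq (by omega) fun _ _ h => h) ?_ (by omega)
  · have e0 := (hi3.of_same hs').a0 i hin
    have e6 := hs'.reg 6 rfl
    simp [h24, e0, e6, h63, residue_cast hm]
  intro s4 hs4 ha4
  have hr4 := hr3.of_same hs4
  have p4 := p3.of_same hs4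
  have hi4 := hi3.of_same hs4
  refine HT.seq (T₁ := 20 * U) (T₂ := 3400 * U) ((histCmd_spec (residue m b) (fun _ => 0) p4.r0 hr4.r9
    (fun i hin s' hs' h24 => ?_) (hcell hfb) (fun _ => Nat.zero_le _)
    (fun u => by rw [hs4.arr 14 rfl]; simp [z3])).conseq (by omega) fun _ _ h => h) ?_ (by omega)
  · have e0 := (hi4.of_same hs').a1 i hin
    have e6 := hs'.reg 6 rfl
    have e6' := hs4.reg 6 rfl
    simp [h24, e0, e6, e6', h63, residue_cast hm]
  intro s5 hs5 hb5
  have hr5 := hr4.of_same hs5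
  have p5 := p4.of_same hs5
  have hi5 := hi4.of_same hs5
  have h65 : s5.reg 6 = m := by rw [hs5.reg 6 rfl, hs4.reg 6 rfl, h63]
  refine HT.seq (T₁ := 20 * U) (T₂ := 3300 * U) ((histCmd_spec (lowIndex N m c) (fun _ => 0) p5.r0
    hr5.r9 (fun i hin s' hs' h24 => ?_) (hcell hfl) (fun _ => Nat.zero_le _)
    (fun u => by rw [hs5.arr 16 rfl, hs4.arr 16 rfl]; simp [z3])).conseq (by omega)
    fun _ _ h => h) ?_ (by omega)
  · have e0 := (hi5.of_same hs').a2 i hin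
    have e6 := hs'.reg 6 rfl
    have e10 := (hr5.of_same hs').r10
    simp only [val_mod, val_sub, val_load, val_reg, val_ofNat, h24, e0, e6, e10, h65]
    exact (lowIndex_cast hm hmN c i).symm
  intro s6 hs6 hc6
  have hr6 := hr5.of_same hs6
  have p6 := p5.of_same hs6
  have hi6 := hi5.of_same hs6
  have h66 : s6.reg 6 = m := by rw [hs6.reg 6 rfl, h65]
  simp only [zero_add] at ha4 hb5 hc6
  refine HT.seq (T₁ := 20 * U) (T₂ := 3200 * U) ((histCmd_spec (highIndex N m c)
    (histogram n (lowIndex N m c)) p6.r0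
    hr6.r9 (fun i hin s' hs' h24 => ?_) (hcell hfh) (histogram_le _ _) hc6).conseq (by omega)
    fun _ _ h => h) ?_ (by omega)
  · have e0 := (hi6.of_same hs').a2 i hin
    have e6 := hs'.reg 6 rfl
    have e10 := (hr6.of_same hs').r10
    simp only [val_sub, val_mod, val_load, val_reg, val_ofNat, h24, e0, e6, e10, h66]
    exact (highIndex_cast hm hmN c i).symm
  intro s7 hs7 hc7
  have hr7 := hr6.of_same hs7
  have ht7 := (((ht3.of_same hs4).of_same hs5).of_same hs6).of_same hs7
  have z7 : ∀ k, k = 13 ∨ k = 15 ∨ k = 17 → ∀ i, s7.arr k i = 0 := by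
    rintro k (rfl | rfl | rfl) i <;>
      rw [hs7.arr _ rfl, hs6.arr _ rfl, hs5.arr _ rfl, hs4.arr _ rfl, z3 _ (by omega) (by omega)]
  have ha7 : HasArray n K 0 (fun u => (histogram n (residue m a) u : ℂ)) 12 13 s7 :=
    hasArray_zero (by rw [hs7.arr _ rfl, hs6.arr _ rfl, hs5.arr _ rfl]; exact ha4)
      fun u => z7 13 (by simp) u
  have hb7 : HasArray n K 0 (fun u => (histogram n (residue m b) u : ℂ)) 14 15 s7 :=
    hasArray_zero (by rw [hs7.arr _ rfl, hs6.arr _ rfl]; exact hb5) fun u => z7 15 (by simp) u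
  have hc7 : HasArray n K 0 (fun u => ((histogram n (lowIndex N m c) u +
      histogram n (highIndex N m c) u : ℕ) : ℂ)) 16 17 s7 :=
    hasArray_zero hc7 fun u => z7 17 (by simp) u
  clear hs4 hs5 hs6 hs7
  -- the transforms
  obtain ⟨q1, q2, q3⟩ := two_mul_two_pow_mul_prodErr_lt hr2.le
  have hX := two_le_two_pow_lg_real n
  have hnX : (n : ℝ) + 1 ≤ 2 ^ lg n := by exact_mod_cast lt_two_pow_lg n
  have hAX2 : (2 * n + 1 : ℝ) ≤ (2 ^ lg n) ^ 2 := by nlinarith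
  have hAX : (2 * n + 1 : ℝ) ≤ (2 ^ lg n) ^ 20 :=
    hAX2.trans (pow_le_pow_right₀ (by linarith) (by norm_num))
  have sA : ∀ f : ℕ → ℕ, (∀ i < n, f i < N) →
      ∑ u ∈ Finset.range N, ‖(histogram n f u : ℂ)‖ ≤ 2 * n + 1 := fun f hf => by
    have := sum_histogram n N f hf
    simp only [Complex.norm_natCast]
    rw [← Nat.cast_sum, this]
    linarith [Nat.cast_nonneg (α := ℝ) n]
  have sC : ∑ u ∈ Finset.range N, ‖((histogram n (lowIndex N m c) u +
      histogram n (highIndex N m c) u : ℕ) : ℂ)‖ ≤ 2 * n + 1 := by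
    have h1 := sum_histogram n N _ hfl
    have h2 := sum_histogram n N _ hfh
    simp only [Complex.norm_natCast]
    rw [← Nat.cast_sum, Finset.sum_add_distrib, h1, h2]
    push_cast
    linarith
  refine HT.seq (T₂ := 2500 * U) ((fftCmd_spec hr7 ht7 (by omega) (by omega) (by omega) ha7
    (sA _ hfa) hAX q1).conseq hKKU fun _ _ h => h) ?_ (by omega)
  intro s8 hs8 ha8
  refine HT.seq (T₂ := 1800 * U) ((fftCmd_spec (hr7.of_same hs8) (ht7.of_same hs8) (by omega)
    (by omega) (by omega) (hb7.of_same hs8)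
    (sA _ hfb) hAX q1).conseq hKKU fun _ _ h => h) ?_ (by omega)
  intro s9 hs9 hb9
  refine HT.seq (T₂ := 1000 * U) ((fftCmd_spec ((hr7.of_same hs8).of_same hs9)
    ((ht7.of_same hs8).of_same hs9) (by omega)
    (by omega) (by omega) ((hc7.of_same hs8).of_same hs9)
    sC hAX q1).conseq hKKU fun _ _ h => h) ?_ (by omega)
  intro s10 hs10 hc10
  have hr10 := ((hr7.of_same hs8).of_same hs9).of_same hs10
  refine (sumCmd_spec (d := d) (A := 2 * n + 1) hr10 ((ha8.of_same hs9).of_same hs10)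
    (hb9.of_same hs10) hc10
    (fun o _ => (norm_dft_le hN0 _ _).trans (sA _ hfa))
    (fun o _ => (norm_dft_le hN0 _ _).trans (sA _ hfb))
    (fun o _ => (norm_dft_le hN0 _ _).trans sC) (by linarith [Nat.cast_nonneg (α := ℝ) n]) ?_
    q2).conseq (by omega) ?_
  · calc (2 : ℝ) ^ K * (2 * n + 1) ^ 3 ≤ (2 ^ lg n) ^ 4 * ((2 ^ lg n) ^ 2) ^ 3 := by
          have := two_pow_le_of_le_modBound hr2.le
          gcongr
      _ = (2 ^ lg n) ^ 10 := by ring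
      _ ≤ _ := pow_le_pow_right₀ (by linarith) (by norm_num)
  intro s11 hs11 hres
  have hr11 := hr10.of_same hs11
  refine ⟨K, hr11.r9, hr11.r10, ?_⟩
  have hsum : ∑ o ∈ Finset.range N, dft N (fun u => (histogram n (residue m a) u : ℂ)) o *
      dft N (fun u => (histogram n (residue m b) u : ℂ)) o *
      dft N (fun u => ((histogram n (lowIndex N m c) u +
        histogram n (highIndex N m c) u : ℕ) : ℂ)) o = ((N * tripleCount n m a b c : ℕ) : ℂ) := by
    simp only [Nat.cast_add, dft_add, mul_add, Finset.sum_add_distrib]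
    rw [sum_dft_mul hN0 n _ _ _ hfa hfb hfl, sum_dft_mul hN0 n _ _ _ hfa hfb hfh,
      ← solutions_add_solutions hm hmN a b c n]
    push_cast
    ring
  rw [hsum, Complex.natCast_re] at hres
  have hNpos : (0 : ℝ) < N := by exact_mod_cast Nat.pos_of_ne_zero hN0
  have hNr : ((2 : ℝ) ^ K) = N := by rw [hN]; push_cast; rfl
  rw [hNr] at hres
  have : 2 * |(s11.reg 31 : ℝ) - scale n * N * tripleCount n m a b c| < scale n * N := by
    have e : (scale n : ℝ) * ((N * tripleCount n m a b c : ℕ) : ℝ) =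
        scale n * N * tripleCount n m a b c := by push_cast; ring
    rw [e] at hres
    nlinarith
  exact_mod_cast this

/-! ## Codes of triples -/

/-- The sum of the triple `(i, j, k)` with code `(i n + j) n + k`. -/
def codeSum (n : ℕ) (a b c : ℕ → ℤ) (q : ℕ) : ℤ := a (q / n / n) + b (q / n % n) + c (q % n)

/-- The codes of the triples with sum `0` modulo `m`. -/
def hits (n m : ℕ) (a b c : ℕ → ℤ) : Finset ℕ :=
  (Finset.range (n * n * n)).filter fun q => (m : ℤ) ∣ codeSum n a b c q

theorem sum_range_mul {M : Type*} [AddCommMonoid M] (f : ℕ → M) (p q : ℕ) :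
    ∑ x ∈ Finset.range (p * q), f x =
      ∑ i ∈ Finset.range p, ∑ j ∈ Finset.range q, f (i * q + j) := by
  induction p with
  | zero => simp
  | succ p ih => rw [Nat.succ_mul, Finset.sum_range_add, ih, Finset.sum_range_succ]

theorem codeSum_eq {n : ℕ} (a b c : ℕ → ℤ) (i : ℕ) {j k : ℕ} (hj : j < n) (hk : k < n) :
    codeSum n a b c ((i * n + j) * n + k) = a i + b j + c k := by
  have h1 : ((i * n + j) * n + k) / n = i * n + j := by
    rw [mul_comm, Nat.mul_add_div (by omega), Nat.div_eq_of_lt hk, add_zero]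
  have h2 : (i * n + j) / n = i := by
    rw [mul_comm, Nat.mul_add_div (by omega), Nat.div_eq_of_lt hj, add_zero]
  rw [codeSum, h1, h2, Nat.mul_add_mod', Nat.mul_add_mod', Nat.mod_eq_of_lt hj, Nat.mod_eq_of_lt hk]

theorem card_hits (n m : ℕ) (a b c : ℕ → ℤ) : (hits n m a b c).card = tripleCount n m a b c := by
  rw [hits, Finset.card_filter, sum_range_mul, sum_range_mul, tripleCount]
  refine Finset.sum_congr rfl fun i _ => Finset.sum_congr rfl fun j hj =>
    Finset.sum_congr rfl fun k hk => ?_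
  rw [codeSum_eq a b c i (Finset.mem_range.1 hj) (Finset.mem_range.1 hk)]

theorem code_lt {n i j k : ℕ} (hi : i < n) (hj : j < n) (hk : k < n) :
    (i * n + j) * n + k < n * n * n := by
  have h1 : i * n + j < n * n := by nlinarith
  nlinarith

theorem code_div_lt {n q : ℕ} (hq : q < n * n * n) : q / n / n < n ∧ q / n % n < n ∧ q % n < n := by
  have hn : 0 < n := by
    rcases Nat.eq_zero_or_pos n with rfl | h
    · simp at hq
    · exact h
  refine ⟨?_, Nat.mod_lt _ hn, Nat.mod_lt _ hn⟩
  rw [Nat.div_div_eq_div_mul]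
  exact Nat.div_lt_of_lt_mul (by rwa [mul_comm n] at hq)

/-- The least code that may follow the first `t` codes of a list. -/
def minNext (q : ℕ → ℤ) : ℕ → ℤ
  | 0 => 0
  | t + 1 => q t + 1

/-- The entry `t` of a list of codes passes the test of the verifier. -/
def StepOk (n m : ℕ) (a b c : ℕ → ℤ) (q : ℕ → ℤ) (t : ℕ) : Prop :=
  minNext q t ≤ q t ∧ q t < n * n * n ∧ (m : ℤ) ∣ codeSum n a b c (q t).toNat ∧
    codeSum n a b c (q t).toNat ≠ 0

/-- The words of a proof string that the verifier accepts. -/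
def ProofOk (d n : ℕ) (a b c : ℕ → ℤ) (p : ℤ → ℤ) : Prop :=
  ∃ m l : ℕ, p 0 = m ∧ p 1 = l ∧ 0 < m ∧ m ≤ modBound n ∧ l ≤ falseBound d n ∧
    (∀ t < l, StepOk n m a b c (fun t => p (t + 2)) t) ∧ tripleCount n m a b c = l

/-- Each entry is compared only with its predecessor; the order of all entries follows by
transitivity. Nonnegativity makes the passage to natural numbers injective. -/
theorem StepOk.strictMono {n m l : ℕ} {a b c : ℕ → ℤ} {q : ℕ → ℤ}
    (h : ∀ t < l, StepOk n m a b c q t) : ∀ t < l, 0 ≤ q t ∧ ∀ t' < t, q t' < q t := by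
  intro t
  induction t with
  | zero => exact fun ht => ⟨(h 0 ht).1, fun t' h' => absurd h' (by omega)⟩
  | succ t ih =>
    intro ht
    obtain ⟨h1, h2⟩ := ih (by omega)
    have h3 : q t + 1 ≤ q (t + 1) := (h (t + 1) ht).1
    refine ⟨by omega, fun t' ht' => ?_⟩
    rcases Nat.lt_succ_iff_lt_or_eq.1 ht' with h4 | rfl
    · have := h2 t' h4
      omega
    · omega

/-- The listed codes are distinct hits, and there are as many of them as hits, so all hits are
listed. A zero triple would be a hit, but every listed code has a nonzero sum. -/
theorem ProofOk.sum_ne_zero {d n : ℕ} {a b c : ℕ → ℤ} {p : ℤ → ℤ} (h : ProofOk d n a b c p)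
    {i j k : ℕ} (hi : i < n) (hj : j < n) (hk : k < n) : a i + b j + c k ≠ 0 := by
  obtain ⟨m, l, -, -, -, -, -, hs, hl⟩ := h
  set q : ℕ → ℤ := fun t => p (t + 2)
  have hm := StepOk.strictMono hs
  have hinj : Set.InjOn (fun t => (q t).toNat) (Finset.range l : Set ℕ) := by
    intro t ht t' ht' heq
    simp only [Finset.coe_range, Set.mem_Iio] at ht ht'
    have h1 := hm t ht
    have h2 := hm t' ht'
    have heq' : (q t).toNat = (q t').toNat := heq
    rcases lt_trichotomy t t' with hlt | h | hlt
    · have := h2.2 t hlt; omega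
    · exact h
    · have := h1.2 t' hlt; omega
  have hsub : (Finset.range l).image (fun t => (q t).toNat) ⊆ hits n m a b c := by
    intro x hx
    obtain ⟨t, ht, rfl⟩ := Finset.mem_image.1 hx
    have ht := Finset.mem_range.1 ht
    have h1 := hs t ht
    have h2 := (hm t ht).1
    refine Finset.mem_filter.2 ⟨Finset.mem_range.2 ?_, h1.2.2.1⟩
    have h3 := h1.2.1
    zify
    rw [Int.toNat_of_nonneg h2]
    exact h3
  have heq := Finset.eq_of_subset_of_card_le hsub (by
    rw [Finset.card_image_of_injOn hinj, Finset.card_range, card_hits, hl])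
  intro h0
  have hcode : (i * n + j) * n + k ∈ hits n m a b c := by
    refine Finset.mem_filter.2 ⟨Finset.mem_range.2 (code_lt hi hj hk), ?_⟩
    rw [codeSum_eq a b c i hj hk, h0]
    exact dvd_zero _
  rw [← heq] at hcode
  obtain ⟨t, ht, hc⟩ := Finset.mem_image.1 hcode
  have := (hs t (Finset.mem_range.1 ht)).2.2.2
  have hc' : (q t).toNat = (i * n + j) * n + k := hc
  rw [hc', codeSum_eq a b c i hj hk] at this
  exact this h0

/-! ## The verifier -/

/-- Reads the modulus and the number of listed triples. -/
def headCmd : Cmd :=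
  .seq (assign 8 1) <|
  .seq (assign 6 1) <|
  .seq (assign 7 0) <|
  .seq (branch (less 0 (load 3 0))
    (branch (less (load 3 0) (reg 4 + 1)) (assign 6 (load 3 0)) (assign 8 0)) (assign 8 0)) <|
  branch (less (load 3 1) 0) (assign 8 0)
    (branch (less (load 3 1) (reg 5 + 1)) (assign 7 (load 3 1)) (assign 8 0))

/-- Checks the list of triples. -/
def listCmd : Cmd :=
  .seq (assign 34 0) <|
  forLoop 35 7 <|
    branch (less (load 3 (reg 35 + 2)) (reg 34)) (assign 8 0) <|
    branch (less (load 3 (reg 35 + 2)) (reg 0 * reg 0 * reg 0))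
      (.seq (assign 36 (load 3 (reg 35 + 2))) <|
       .seq (assign 34 (reg 36 + 1)) <|
       .seq (assign 37 (load 0 (reg 36 / reg 0 / reg 0) + load 1 (reg 36 / reg 0 % reg 0) +
        load 2 (reg 36 % reg 0))) <|
       branch (reg 37 % reg 6) (assign 8 0) (branch (reg 37) .skip (assign 8 0)))
      (assign 8 0)

/-- Compares the number of listed triples with the number of all triples. -/
def compareCmd : Cmd :=
  branch (less (2 * (reg 31 - reg 9 * reg 10 * reg 7)) (reg 9 * reg 10))
    (branch (less (2 * (reg 9 * reg 10 * reg 7 - reg 31)) (reg 9 * reg 10)) .skip (assign 8 0))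
    (assign 8 0)

/-- The verifier. -/
def verifier (d : ℕ) : Cmd :=
  .seq (paramsCmd d) <| .seq headCmd <| .seq listCmd <| .seq countCmd <| .seq compareCmd <|
  emit (reg 8)

/-- A malformed entry leaves the default m = 1 or l = 0 in place and only clears the flag. The
remaining program then runs within the same time bound, whatever the proof string. The words of the
proof are compared with their bounds before they are copied, since they may be arbitrary. -/
theorem headCmd_spec {d n : ℕ} {s : State} (h : HasParams d n s) :
    HT (cellBound d n) headCmd 13 s fun s' => ∃ m l : ℕ, s'.reg 6 = m ∧ s'.reg 7 = l ∧ 0 < m ∧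
      m ≤ modBound n ∧ l ≤ falseBound d n ∧
      ((s'.reg 8 = 1 ∧ s.arr 3 0 = m ∧ s.arr 3 1 = l) ∨
        (s'.reg 8 = 0 ∧ ¬ ((0 < s.arr 3 0 ∧ s.arr 3 0 ≤ modBound n) ∧
          (0 ≤ s.arr 3 1 ∧ s.arr 3 1 ≤ falseBound d n)))) := by
  have b1 : (1 : ℤ) ≤ cellBound d n := le_cellBound_of_le (by norm_num)
  have b0 : (0 : ℤ) ≤ cellBound d n := le_cellBound_of_le (by norm_num)
  have hM : (modBound n : ℤ) ≤ cellBound d n := natCast_le_cellBound (modBound_le n) (by omega)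
  have hF : (falseBound d n : ℤ) ≤ cellBound d n :=
    natCast_le_cellBound (falseBound_le d n) (by omega)
  have hM1 : 1 ≤ modBound n := Nat.succ_pos _
  refine HT.assign_seq (T₁ := 11) (by simpa using b1) ?_ le_rfl
  refine HT.assign_seq (T₁ := 9) (by simpa using b1) ?_ le_rfl
  refine HT.assign_seq (T₁ := 7) (by simpa using b0) ?_ le_rfl
  simp only [val_ofNat]
  refine HT.seq (T₁ := 3) (T₂ := 3) (R := fun s' => ∃ m : ℕ, s'.reg 6 = m ∧ 0 < m ∧
    m ≤ modBound n ∧ ((s'.reg 8 = 1 ∧ s.arr 3 0 = m) ∨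
      (s'.reg 8 = 0 ∧ ¬ (0 < s.arr 3 0 ∧ s.arr 3 0 ≤ modBound n)))) ?_ ?_ (by omega)
  · refine HT.branch (T₁ := 2) (fun h1 => HT.branch (T₁ := 1) (fun h2 => ?_) (fun h2 => ?_) le_rfl)
      (fun h1 => HT.conseq (HT.assign (by simpa using b0) ?_) (show 1 ≤ 2 by norm_num)
        fun _ _ h => h) le_rfl
    · simp [h.r4] at h1 h2
      refine HT.assign ?_ ⟨(s.arr 3 0).toNat, ?_, ?_, ?_, ?_⟩
      · simp
        rw [abs_of_pos h1]
        omega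
      · simp; omega
      · omega
      · omega
      · left; simp; omega
    · simp [h.r4] at h1 h2
      refine HT.assign (by simpa using b0) ⟨1, by simp, one_pos, hM1, ?_⟩
      right; simp; omega
    · simp at h1
      refine ⟨1, by simp, one_pos, hM1, ?_⟩
      right; simp; omega
  · rintro s1 hs1 ⟨m, h6, hm, hmM, hor⟩
    have e3 : s1.arr 3 = s.arr 3 := by simpa using hs1.arr 3 rfl
    have e5 : s1.reg 5 = falseBound d n := by simpa [h.r5] using hs1.reg 5 rfl
    have e7 : s1.reg 7 = 0 := by simpa using hs1.reg 7 rfl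
    refine HT.branch (T₁ := 2) (fun h1 => HT.conseq (HT.assign (by simpa using b0) ?_)
      (show 1 ≤ 2 by norm_num) fun _ _ h => h)
      (fun h1 => HT.branch (T₁ := 1) (fun h2 => ?_) (fun h2 => ?_) le_rfl) le_rfl
    · simp [e3] at h1
      refine ⟨m, 0, by simpa using h6, by simpa using e7, hm, hmM, Nat.zero_le _, ?_⟩
      right; simp; omega
    · simp [e3, e5] at h1 h2
      refine HT.assign ?_ ⟨m, (s.arr 3 1).toNat, by simpa using h6, ?_, hm, hmM, by omega, ?_⟩
      · simp [e3]
        rw [abs_of_nonneg h1]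
        omega
      · simp [e3]; omega
      · simp; omega
    · simp [e3, e5] at h1 h2
      refine HT.assign (by simpa using b0)
        ⟨m, 0, by simpa using h6, by simpa using e7, hm, hmM, Nat.zero_le _, ?_⟩
      right; simp; omega

/-- A cleared flag is never set again, so the loop may simply continue after a failure. Register
`34` is required to be nonnegative even then: an entry that passes both comparisons is thus always a
code in range, and its value is small enough to be stored. -/
theorem listCmd_spec {d n m l : ℕ} {s : State} {a b c : ℕ → ℤ} (h : HasParams d n s)
    (hi : HasInput n a b c s) (h6 : s.reg 6 = m) (h7 : s.reg 7 = l) (hl : l ≤ falseBound d n)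
    (h8 : s.reg 8 = 0 ∨ s.reg 8 = 1) (ha : ∀ i < n, |a i| ≤ (2 ^ lg n) ^ d)
    (hb : ∀ i < n, |b i| ≤ (2 ^ lg n) ^ d) (hc : ∀ i < n, |c i| ≤ (2 ^ lg n) ^ d) :
    HT (cellBound d n) listCmd (20 * (l + 1)) s fun s' => (s'.reg 8 = 0 ∨ s'.reg 8 = 1) ∧
      (s'.reg 8 = 1 ↔ s.reg 8 = 1 ∧ ∀ t < l, StepOk n m a b c (fun t => s.arr 3 (t + 2)) t) := by
  have b0 : (0 : ℤ) ≤ cellBound d n := le_cellBound_of_le (by norm_num)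
  have hX := two_le_two_pow_lg n
  have hn := lt_two_pow_lg n
  have hX' : (2 : ℤ) ≤ 2 ^ lg n := by exact_mod_cast hX
  have hn3 : (n * n * n : ℤ) ≤ cellBound d n := by
    refine le_trans ?_ (pow_le_cellBound (k := 3) (by omega))
    have : (n : ℤ) ≤ 2 ^ lg n := by exact_mod_cast hn.le
    calc (n * n * n : ℤ) ≤ 2 ^ lg n * 2 ^ lg n * 2 ^ lg n := by gcongr
      _ = _ := by ring
  have hB3 : (2 ^ lg n : ℤ) ^ d + (2 ^ lg n) ^ d + (2 ^ lg n) ^ d ≤ cellBound d n := by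
    refine le_trans ?_ (pow_le_cellBound (k := d + 2) (by omega))
    have : (1 : ℤ) ≤ (2 ^ lg n) ^ d := one_le_pow₀ (by omega)
    rw [pow_add]
    have : (4 : ℤ) ≤ (2 ^ lg n) ^ 2 := by nlinarith
    nlinarith
  set q : ℕ → ℤ := fun t => s.arr 3 (t + 2) with hq
  refine HT.assign_seq (T₁ := l * 14 + 3) (by simpa using b0) ?_ (by omega)
  simp only [val_ofNat]
  refine HT.forLoop (T₁ := 11) l (fun i s' => (s'.reg 8 = 0 ∨ s'.reg 8 = 1) ∧ 0 ≤ s'.reg 34 ∧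
    (s'.reg 8 = 1 → s'.reg 34 = minNext q i) ∧
    (s'.reg 8 = 1 ↔ s.reg 8 = 1 ∧ ∀ t < i, StepOk n m a b c q t)) (by simpa using h7)
    (natCast_le_cellBound (hl.trans (falseBound_le d n)) (by omega)) rfl rfl ?_ ?_ ?_ (by omega)
  · simp [minNext, h8]
  · rintro i s' hil hs h35 ⟨i8, i34, imin, iff⟩
    have e3 : s'.arr 3 = s.arr 3 := by simpa using hs.arr 3 rfl
    have e0 : s'.reg 0 = n := by simpa [h.r0] using hs.reg 0 rfl
    have e6 : s'.reg 6 = m := by simpa [h6] using hs.reg 6 rfl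
    have hi' : HasInput n a b c s' := (hi.of_same (s' := s.setReg 34 0)
      (p := assign 34 0) ⟨fun y hy => by
        have : y ≠ 34 := by simpa [writesReg] using hy
        simp [this], fun _ _ => rfl, fun _ => rfl⟩).of_same hs
    have eq : s'.arr 3 ((i : ℤ) + 2) = q i := by rw [e3]
    have hsucc : (∀ t < i + 1, StepOk n m a b c q t) ↔
        (∀ t < i, StepOk n m a b c q t) ∧ StepOk n m a b c q i := Nat.forall_lt_succ_right
    -- Common to all branches that clear the flag: it suffices that the present entry is wrong or
    -- that the flag was already cleared.
    have fail : ¬ StepOk n m a b c q i ∨ s'.reg 8 = 0 → ∀ s'' : State, s''.reg 8 = 0 →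
        0 ≤ s''.reg 34 → (s''.reg 8 = 0 ∨ s''.reg 8 = 1) ∧ 0 ≤ s''.reg 34 ∧
        (s''.reg 8 = 1 → s''.reg 34 = minNext q (i + 1)) ∧
        (s''.reg 8 = 1 ↔ s.reg 8 = 1 ∧ ∀ t < i + 1, StepOk n m a b c q t) := by
      intro hno s'' h8'' h34
      refine ⟨.inl h8'', h34, by omega, by omega, fun ⟨hh1, hh2⟩ => ?_⟩
      rw [hsucc] at hh2
      rcases hno with hno | hno
      · exact absurd hh2.2 hno
      · have := iff.2 ⟨hh1, hh2.1⟩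
        omega
    have hno1 : q i < s'.reg 34 → ¬ StepOk n m a b c q i ∨ s'.reg 8 = 0 := by
      intro hlt
      rcases i8 with h0 | h1
      · exact .inr h0
      · refine .inl fun hst => ?_
        have h1' := imin h1
        have h2' := hst.1
        omega
    refine HT.branch (T₁ := 10) (fun h1 => ?_) (fun h1 => ?_) le_rfl
    · simp [h35, eq] at h1
      refine HT.conseq (HT.assign (by simpa using b0) (fail (hno1 h1) _ (by simp) (by simpa using i34)))
        (by norm_num) fun _ _ h => h
    simp [h35, eq] at h1
    refine HT.branch (T₁ := 9) (fun h2 => ?_) (fun h2 => ?_) le_rfl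
    swap
    · simp [h35, eq, e0] at h2
      refine HT.conseq (HT.assign (by simpa using b0) (fail (.inl ?_) _ (by simp) (by simpa using i34)))
        (by norm_num) fun _ _ h => h
      intro hst
      have := hst.2.1
      omega
    simp [h35, eq, e0] at h2
    have hq0 : 0 ≤ q i := by omega
    obtain ⟨x, hx⟩ : ∃ x : ℕ, q i = x := ⟨(q i).toNat, by omega⟩
    have hxn : x < n * n * n := by
      rw [hx] at h2
      exact_mod_cast h2
    obtain ⟨d1, d2, d3⟩ := code_div_lt hxn
    have hval : s'.arr 0 ((x : ℤ) / n / n) + s'.arr 1 ((x : ℤ) / n % n) + s'.arr 2 ((x : ℤ) % n) =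
        codeSum n a b c x := by
      have r1 := hi'.a0 _ d1
      have r2 := hi'.a1 _ d2
      have r3 := hi'.a2 _ d3
      push_cast at r1 r2 r3
      rw [r1, r2, r3, codeSum]
    have hstep : StepOk n m a b c q i ↔ minNext q i ≤ q i ∧ (m : ℤ) ∣ codeSum n a b c x ∧
        codeSum n a b c x ≠ 0 := by
      unfold StepOk
      rw [hx, Int.toNat_natCast]
      have : (x : ℤ) < n * n * n := by exact_mod_cast hxn
      exact ⟨fun h => ⟨h.1, h.2.2⟩, fun h => ⟨h.1, this, h.2⟩⟩
    refine HT.assign_seq (T₁ := 7) ?_ ?_ le_rfl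
    · simp [h35, eq]
      rw [abs_of_nonneg hq0]
      omega
    simp only [val_load, val_add, val_reg, val_ofNat, h35, eq, hx]
    refine HT.assign_seq (T₁ := 5) ?_ ?_ le_rfl
    · simp
      rw [abs_of_nonneg (by omega)]
      omega
    simp only [val_add, val_reg, val_ofNat, State.setReg_reg, if_true]
    refine HT.assign_seq (T₁ := 3) ?_ ?_ le_rfl
    · simp [e0, hval]
      refine le_trans (abs_add_le _ _) (le_trans (add_le_add_left (abs_add_le _ _) _) ?_)
      have := ha _ d1
      have := hb _ d2
      have := hc _ d3
      omega
    generalize hσ : State.setReg _ 37 _ = σ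
    have f37 : σ.reg 37 = codeSum n a b c x := by rw [← hσ]; simp [e0, hval]
    have f34 : σ.reg 34 = x + 1 := by rw [← hσ]; simp
    have f8 : σ.reg 8 = s'.reg 8 := by rw [← hσ]; simp
    have f6 : σ.reg 6 = m := by rw [← hσ]; simp [e6]
    refine HT.branch (T₁ := 2) (fun h3 => ?_) (fun h3 => ?_) le_rfl
    · simp [f37, f6] at h3
      refine HT.conseq (HT.assign (by simpa using b0) (fail (.inl ?_) _ (by simp)
        (by simp [f34]; omega))) (by norm_num) fun _ _ h => h
      rw [hstep]
      intro hst
      exact h3 hst.2.1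
    simp [f37, f6] at h3
    refine HT.branch (T₁ := 1) (fun h4 => ?_) (fun h4 => ?_) le_rfl
    · simp [f37] at h4
      refine HT.skip ?_
      refine ⟨by simpa [f8] using i8, by simp [f34]; omega, fun _ => by simp [f34, minNext, hx], ?_⟩
      change σ.reg 8 = 1 ↔ _
      rw [f8, iff, hsucc, hstep]
      constructor
      · rintro ⟨g1, g2⟩
        have g3 := imin (iff.2 ⟨g1, g2⟩)
        exact ⟨g1, g2, by omega, h3, h4⟩
      · exact fun h => ⟨h.1, h.2.1⟩
    · simp [f37] at h4
      refine HT.assign (by simpa using b0) (fail (.inl ?_) _ (by simp) (by simp [f34]; omega))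
      rw [hstep]
      exact fun h => h.2.2 h4
  · rintro s' - - ⟨i8, -, -, iff⟩
    exact ⟨i8, iff⟩

/-- The running time of the verifier. -/
def verifierTime (d n : ℕ) : ℕ := 10000 * (falseBound d n + modBound n) * lg n * lg n

theorem verifier_spec {d n : ℕ} {s : State} {a b c : ℕ → ℤ} (h0 : s.reg 0 = n)
    (hi : HasInput n a b c s) (hz : ∀ k, 12 ≤ k → ∀ i, s.arr k i = 0)
    (ha : ∀ i < n, |a i| ≤ (2 ^ lg n) ^ d) (hb : ∀ i < n, |b i| ≤ (2 ^ lg n) ^ d)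
    (hc : ∀ i < n, |c i| ≤ (2 ^ lg n) ^ d) :
    HT (cellBound d n) (verifier d) (verifierTime d n) s fun s' =>
      ∃ v, s'.out = s.out ++ [v] ∧ (v = 1 ↔ ProofOk d n a b c (s.arr 3)) := by
  have hl := one_le_lg n
  have hM1 : 1 ≤ modBound n := Nat.succ_pos _
  have b0 : (0 : ℤ) ≤ cellBound d n := le_cellBound_of_le (by norm_num)
  obtain ⟨U, hU⟩ : ∃ U, U = (falseBound d n + modBound n) * lg n * lg n := ⟨_, rfl⟩
  have hll : 1 ≤ lg n * lg n := Nat.mul_pos hl hl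
  have hU1 : falseBound d n + modBound n ≤ U := by
    rw [hU, mul_assoc]
    exact Nat.le_mul_of_pos_right _ hll
  have hU2 : 40 * modBound n * lg n ≤ 40 * U := by
    rw [hU]
    have h1 : modBound n * lg n ≤ (falseBound d n + modBound n) * lg n * lg n := by
      calc modBound n * lg n ≤ (falseBound d n + modBound n) * lg n := by gcongr; omega
        _ ≤ _ := Nat.le_mul_of_pos_right _ hl
    nlinarith
  have hU3 : 6000 * modBound n * lg n * lg n ≤ 6000 * U := by
    rw [hU]
    have : modBound n * lg n * lg n ≤ (falseBound d n + modBound n) * lg n * lg n := by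
      gcongr; omega
    nlinarith
  refine HT.conseq (T₁ := 10000 * U) (Q := fun s' => _) ?_
    (by rw [hU, verifierTime]; exact le_of_eq (by ring)) fun _ _ h => h
  refine HT.seq (T₂ := 9900 * U) ((paramsCmd_spec d n s h0).conseq hU2 fun _ _ h => h) ?_ (by omega)
  intro s1 hs1 hp1
  have e31 : s1.arr 3 = s.arr 3 := hs1.arr 3 rfl
  have hi1 := hi.of_same hs1
  refine HT.seq (T₂ := 9800 * U) (headCmd_spec hp1) ?_ (by omega)
  rintro s2 hs2 ⟨m, l, h6, h7, hm, hmM, hlF, hor⟩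
  have e32 : s2.arr 3 = s.arr 3 := by rw [hs2.arr 3 rfl, e31]
  rw [e31] at hor
  have hi2 := hi1.of_same hs2
  have hp2 := hp1.of_same hs2
  refine HT.seq (T₁ := 40 * U) (T₂ := 9700 * U) ((listCmd_spec hp2 hi2 h6 h7 hlF
    (hor.elim (fun h => .inr h.1) fun h => .inl h.1) ha hb hc).conseq (by omega) fun _ _ h => h) ?_ (by omega)
  rintro s3 hs3 ⟨h83, hiff⟩
  rw [e32] at hiff
  have h63 : s3.reg 6 = m := by rw [hs3.reg 6 rfl, h6]
  have h73 : s3.reg 7 = l := by rw [hs3.reg 7 rfl, h7]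
  refine HT.seq (T₂ := 3600 * U) ((countCmd_spec (hp2.of_same hs3) (hi2.of_same hs3) h63 hm hmM
    fun k hk i => ?_).conseq hU3 fun _ _ h => h) ?_ (by omega)
  · have e1 : s3.arr k = s2.arr k := hs3.arr k (by simp [listCmd, forLoop, writesArr])
    have e2 : s2.arr k = s1.arr k := hs2.arr k (by simp [headCmd, writesArr])
    have e3 : s1.arr k = s.arr k := hs1.arr k (by simp [paramsCmd, writesArr])
    rw [e1, e2, e3, hz k hk]
  rintro s4 hs4 ⟨K, h9, h10, hres⟩
  have h74 : s4.reg 7 = l := by rw [hs4.reg 7 rfl, h73]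
  have h84 : s4.reg 8 = s3.reg 8 := hs4.reg 8 rfl
  have hSN : 0 < scale n * (2 ^ K : ℕ) := by
    have := thousand_le_scale n
    have : 0 < ((2 ^ K : ℕ) : ℤ) := by positivity
    nlinarith
  obtain ⟨r1, r2⟩ := abs_lt.1 (show |s4.reg 31 * 2 - 2 * (scale n * (2 ^ K : ℕ) *
    tripleCount n m a b c)| < scale n * (2 ^ K : ℕ) by
      rw [show s4.reg 31 * 2 - 2 * (scale n * (2 ^ K : ℕ) * tripleCount n m a b c) =
        2 * (s4.reg 31 - scale n * (2 ^ K : ℕ) * tripleCount n m a b c) by ring, abs_mul]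
      simpa using hres)
  -- Both S N l and S N times the true count are multiples of S N. If register `31` is closer than S
  -- N / 2 to both of them, they are equal.
  have hcmp : tripleCount n m a b c = l ↔
      2 * (s4.reg 31 - scale n * (2 ^ K : ℕ) * l) < scale n * (2 ^ K : ℕ) ∧
      2 * (scale n * (2 ^ K : ℕ) * l - s4.reg 31) < scale n * (2 ^ K : ℕ) := by
    constructor
    · intro h
      rw [← h]
      constructor <;> linarith
    · rintro ⟨h1, h2⟩
      have g1 : (tripleCount n m a b c : ℤ) < l + 1 := by nlinarith
      have g2 : (l : ℤ) < tripleCount n m a b c + 1 := by nlinarith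
      omega
  refine HT.seq (T₁ := 3) (T₂ := 1) (R := fun s' => s'.reg 8 = 1 ↔
    s3.reg 8 = 1 ∧ tripleCount n m a b c = l) ?_ ?_ (by omega)
  · rw [hcmp]
    refine HT.branch (T₁ := 2) (fun h1 => HT.branch (T₁ := 1) (fun h2 => HT.skip ?_)
      (fun h2 => HT.assign (by simpa using b0) ?_) le_rfl)
      (fun h1 => HT.conseq (HT.assign (Q := fun s' => s'.reg 8 = 1 ↔ _) (by simpa using b0) ?_)
        (by norm_num) fun _ _ h => h) le_rfl
    · simp [h9, h10, h74] at h1 h2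
      push_cast
      rw [h84]
      exact ⟨fun h => ⟨h, h1, h2⟩, fun h => h.1⟩
    · simp [h9, h10, h74] at h1 h2 ⊢
      intro _ _
      exact h2
    · simp [h9, h10, h74] at h1 ⊢
      intro _ hh
      omega
  · intro s5 hs5 h8
    have o5 : s5.out = s.out := by
      rw [hs5.out rfl, hs4.out rfl, hs3.out rfl, hs2.out rfl, hs1.out rfl]
    refine HT.emit ⟨s5.reg 8, by simp [o5], ?_⟩
    rw [h8, hiff]
    constructor
    · rintro ⟨⟨g1, g2⟩, g3⟩
      rcases hor with ⟨-, g4, g5⟩ | ⟨g4, -⟩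
      · exact ⟨m, l, g4, g5, hm, hmM, hlF, g2, g3⟩
      · omega
    · rintro ⟨m', l', g1, g2, g3, g4, g5, g6, g7⟩
      rcases hor with ⟨k1, k2, k3⟩ | ⟨k1, k2⟩
      · obtain rfl : m = m' := by omega
        obtain rfl : l = l' := by omega
        exact ⟨⟨k1, g6⟩, g7⟩
      · exact absurd (by rw [g1, g2]; omega) k2

/-! ## Good moduli -/

/-- The codes of the triples whose sum is a nonzero multiple of `m`. -/
def falsePositives (n m : ℕ) (a b c : ℕ → ℤ) : Finset ℕ :=
  (hits n m a b c).filter fun q => codeSum n a b c q ≠ 0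

/-- The product of the prime factors divides N, and each of them is at least 2. -/
theorem two_pow_card_primeFactors_le {N : ℕ} (hN : N ≠ 0) : 2 ^ N.primeFactors.card ≤ N := by
  refine le_trans ?_ (Nat.le_of_dvd (Nat.pos_of_ne_zero hN) (Nat.prod_primeFactors_dvd N))
  exact Finset.pow_card_le_prod _ _ _ fun p hp => (Nat.prime_of_mem_primeFactors hp).two_le

/-- Chebyshev's bound: 2^M ≤ (M + 1) lcm(1, …, M) ≤ (M + 1) M^π(M), since each prime power in the
least common multiple is at most M. With M + 1 ≤ 2^(2 lg n) this gives M ≤ 2 lg n (π(M) + 1). -/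
theorem modBound_le_mul_card_primesLE {n : ℕ} (hn : 0 < n) :
    modBound n ≤ 8 * lg n * (Nat.primesLE (modBound n)).card := by
  have hs : 0 < sqrtUp n := by
    by_contra h
    have := le_sqrtUp_mul_self n
    have h0 : sqrtUp n = 0 := by omega
    rw [h0] at this
    omega
  have hM2 : 2 ≤ modBound n := by unfold modBound; nlinarith
  have hMX : modBound n + 1 ≤ (2 ^ lg n) ^ 2 := by
    have h1 := lt_two_pow_lg n
    have h2 := sqrtUp_le n
    calc modBound n + 1 ≤ n * n + 2 := by unfold modBound; nlinarith
      _ ≤ (n + 1) ^ 2 := by nlinarith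
      _ ≤ _ := by gcongr; exact h1
  set P := Nat.primesLE (modBound n) with hP
  have h1 := Chebyshev.two_pow_le_mul_lcmUpto (modBound n)
  have h2 : Nat.lcmUpto (modBound n) ≤ modBound n ^ P.card := by
    rw [Nat.lcmUpto_eq_prod_pow_log]
    exact Finset.prod_le_pow_card _ _ _ fun p _ => Nat.pow_log_le_self p (by omega)
  have hlg := one_le_lg n
  have h3 : 2 ^ modBound n ≤ 2 ^ (2 * lg n * (P.card + 1)) := by
    calc 2 ^ modBound n ≤ (2 ^ lg n) ^ 2 * ((2 ^ lg n) ^ 2) ^ P.card := by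
          refine h1.trans (Nat.mul_le_mul hMX (h2.trans ?_))
          gcongr
          omega
      _ = _ := by rw [← pow_mul, ← pow_mul, ← pow_add]; congr 1; ring
  have h4 := (Nat.pow_le_pow_iff_right one_lt_two).1 h3
  have h5 : 1 ≤ P.card := Finset.card_pos.2 ⟨2, by simp [hP, Nat.mem_primesLE, hM2, Nat.prime_two]⟩
  nlinarith

/-- Counting the pairs of a prime and one of its false positives in two ways shows that at most half
of the primes up to M are bad. All other moduli are ignored; this loses only a logarithmic factor,
by the density of the primes. -/
theorem modBound_le_mul_card_good {d n : ℕ} {a b c : ℕ → ℤ}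
    (ha : ∀ i < n, |a i| ≤ (2 ^ lg n) ^ d) (hb : ∀ i < n, |b i| ≤ (2 ^ lg n) ^ d)
    (hc : ∀ i < n, |c i| ≤ (2 ^ lg n) ^ d) :
    modBound n ≤ 16 * lg n * ((Finset.range (modBound n)).filter fun r =>
      (falsePositives n (r + 1) a b c).card < falseBound d n).card := by
  have hlg := one_le_lg n
  -- For n = 0 there are no triples, and the only modulus 1 is good.
  rcases Nat.eq_zero_or_pos n with rfl | hn
  · rw [Finset.filter_true_of_mem, Finset.card_range]
    · exact Nat.le_mul_of_pos_left _ (by omega)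
    · intro r _
      simp [falsePositives, hits, falseBound]
  set good := (Finset.range (modBound n)).filter fun r =>
      (falsePositives n (r + 1) a b c).card < falseBound d n with hgood
  set P := Nat.primesLE (modBound n) with hP
  have hπ := modBound_le_mul_card_primesLE hn
  rw [← hP] at hπ
  set bad := P.filter fun p => falseBound d n ≤ (falsePositives n p a b c).card with hbad
  have hPp : ∀ p ∈ P, p.Prime ∧ p ≤ modBound n := fun p hp => by
    have := Nat.mem_primesLE.1 hp
    tauto
  -- the good primes are among the good moduli
  have h1 : P.card ≤ bad.card + good.card := by
    rw [← Finset.card_filter_add_card_filter_not (s := P)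
      fun p => falseBound d n ≤ (falsePositives n p a b c).card]
    -- The draw r stands for the modulus r + 1, so a prime p corresponds to the draw p - 1.
    refine Nat.add_le_add_left (Finset.card_le_card_of_injOn (fun p => p - 1) ?_ ?_) _
    · intro p hp
      simp only [Finset.coe_filter, Set.mem_ofPred_eq, not_le] at hp
      obtain ⟨hp1, hp2⟩ := hPp p hp.1
      have := hp1.pos
      simp only [hgood, Finset.coe_filter, Set.mem_ofPred_eq, Finset.mem_range]
      rw [Nat.sub_add_cancel hp1.pos]
      exact ⟨by omega, hp.2⟩
    · intro p hp p' hp' h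
      simp only [Finset.coe_filter, Set.mem_ofPred_eq, not_le] at hp hp'
      have h1 := (hPp p hp.1).1.pos
      have h2 := (hPp p' hp'.1).1.pos
      simp only at h
      omega
  -- double counting of the false positives
  have h2 : ∑ p ∈ P, (falsePositives n p a b c).card ≤ n * n * n * ((d + 2) * lg n) := by
    have e1 : ∀ p, (falsePositives n p a b c).card = ∑ q ∈ Finset.range (n * n * n),
        if (p : ℤ) ∣ codeSum n a b c q ∧ codeSum n a b c q ≠ 0 then 1 else 0 := fun p => by
      rw [falsePositives, hits, Finset.filter_filter, Finset.card_filter]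
    simp only [e1]
    rw [Finset.sum_comm]
    refine (Finset.sum_le_card_nsmul _ _ ((d + 2) * lg n) fun q hq => ?_).trans (by simp)
    rw [← Finset.card_filter]
    obtain ⟨d1, d2, d3⟩ := code_div_lt (Finset.mem_range.1 hq)
    by_cases h0 : codeSum n a b c q = 0
    · simp [h0]
    have hsub : P.filter (fun p : ℕ => (p : ℤ) ∣ codeSum n a b c q ∧ codeSum n a b c q ≠ 0) ⊆
        (codeSum n a b c q).natAbs.primeFactors := by
      intro p hp
      obtain ⟨hp1, hp2, -⟩ := Finset.mem_filter.1 hp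
      exact Nat.mem_primeFactors.2 ⟨(hPp p hp1).1, Int.natCast_dvd.1 hp2, Int.natAbs_ne_zero.2 h0⟩
    refine (Finset.card_le_card hsub).trans ?_
    have hle : (codeSum n a b c q).natAbs ≤ 2 ^ ((d + 2) * lg n) := by
      have hX : (2 : ℤ) ≤ 2 ^ lg n := by exact_mod_cast two_le_two_pow_lg n
      have : |codeSum n a b c q| ≤ (2 ^ lg n) ^ (d + 2) := by
        have hX1 : (1 : ℤ) ≤ (2 ^ lg n) ^ d := one_le_pow₀ (by omega)
        have h4 : (4 : ℤ) ≤ (2 ^ lg n) ^ 2 := by nlinarith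
        have g1 := ha _ d1
        have g2 := hb _ d2
        have g3 := hc _ d3
        have g4 := abs_add_le (a (q / n / n) + b (q / n % n)) (c (q % n))
        have g5 := abs_add_le (a (q / n / n)) (b (q / n % n))
        rw [pow_add]
        unfold codeSum
        nlinarith
      rw [← pow_mul, mul_comm] at this
      rw [Int.abs_eq_natAbs] at this
      exact_mod_cast this
    exact (Nat.pow_le_pow_iff_right one_lt_two).1
      ((two_pow_card_primeFactors_le (Int.natAbs_ne_zero.2 h0)).trans hle)
  have h3 : bad.card * falseBound d n ≤ n * n * n * ((d + 2) * lg n) := by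
    refine le_trans ?_ h2
    rw [← smul_eq_mul]
    refine (Finset.card_nsmul_le_sum bad _ _ fun p hp => (Finset.mem_filter.1 hp).2).trans ?_
    exact Finset.sum_le_sum_of_subset (Finset.filter_subset _ _)
  -- With s for `sqrtUp n`, π(M) ≥ n s / (8 lg n) and F > 16 (d+2) n s (lg n)² give π(M) F ≥ 2 (d+2)
  -- n² s² lg n ≥ 2 n³ (d+2) lg n. If more than half of the primes were bad, this would contradict
  -- the double count; hence the factor 16 in `falseConst`.
  have h4 : 2 * bad.card ≤ P.card := by
    by_contra! h
    have hs := le_sqrtUp_mul_self n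
    have g1 : P.card * falseBound d n < 2 * bad.card * falseBound d n :=
      Nat.mul_lt_mul_of_pos_right h (Nat.succ_pos _)
    have g2 : P.card * (falseConst d * n * sqrtUp n * lg n * lg n) ≤ P.card * falseBound d n :=
      Nat.mul_le_mul_left _ (Nat.le_succ _)
    have g3 : 2 * ((d + 2) * n * sqrtUp n * lg n) * (n * sqrtUp n) ≤
        P.card * (falseConst d * n * sqrtUp n * lg n * lg n) := by
      calc _ ≤ 2 * ((d + 2) * n * sqrtUp n * lg n) * (8 * lg n * P.card) := by
            refine Nat.mul_le_mul_left _ (le_trans ?_ hπ)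
            exact Nat.le_succ _
        _ = _ := by unfold falseConst; ring
    have g4 : 2 * (n * n * n * ((d + 2) * lg n)) ≤
        2 * ((d + 2) * n * sqrtUp n * lg n) * (n * sqrtUp n) := by
      calc 2 * (n * n * n * ((d + 2) * lg n)) ≤
          2 * (n * n * (sqrtUp n * sqrtUp n) * ((d + 2) * lg n)) := by gcongr
        _ = _ := by ring
    rw [mul_assoc] at g1
    omega
  calc modBound n ≤ 8 * lg n * P.card := hπ
    _ ≤ 8 * lg n * (2 * good.card) := by gcongr; omega
    _ = _ := by ring

/-! ## Buckets -/

/-- `v` is the least index in `[K, n)` at which `f` has the value `g`, or `n` if there is none. -/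
structure IsNext (n : ℕ) (f : ℕ → ℤ) (g : ℤ) (K v : ℕ) : Prop where
  le : K ≤ v
  le_n : v ≤ n
  eq : v < n → f v = g
  ne : ∀ k, K ≤ k → k < v → f k ≠ g

/-- The residue that `a i + b j` must have for `(i, j, k)` to be a hit. -/
def target (m : ℕ) (c : ℕ → ℤ) (k : ℕ) : ℤ := (0 - c k) % m

theorem dvd_add_iff_target {m : ℕ} {c : ℕ → ℤ} {k : ℕ} {x : ℤ} :
    (m : ℤ) ∣ x + c k ↔ target m c k = x % m := by
  rw [target, ← Int.ModEq, Int.modEq_iff_dvd]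
  congr! 1
  ring

/-- The indices with equal targets form linked lists: array `40` has the heads, array `41` the
links. The indices below `K` are not yet inserted. -/
structure Buckets (n m K : ℕ) (c : ℕ → ℤ) (s : State) : Prop where
  head : ∀ g : ℕ, g < m → ∃ v : ℕ, s.arr 40 g = v ∧ IsNext n (target m c) g K v
  link : ∀ k : ℕ, K ≤ k → k < n → ∃ v : ℕ, s.arr 41 k = v ∧
    IsNext n (target m c) (target m c k) (k + 1) v

theorem Buckets.of_same {n m K : ℕ} {c : ℕ → ℤ} {s s' : State} {p : Cmd} (h : Buckets n m K c s)
    (hs : p.Same s s') (h0 : p.writesArr 40 = false := by rfl)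
    (h1 : p.writesArr 41 = false := by rfl) : Buckets n m K c s' :=
  ⟨by rw [hs.arr _ h0]; exact h.head, by rw [hs.arr _ h1]; exact h.link⟩

/-- Builds the buckets. -/
def bucketCmd : Cmd :=
  .seq (forLoop 47 6 (store 40 (reg 47) (reg 0))) <|
  forLoop 47 0 <|
    .seq (assign 43 (reg 0 - 1 - reg 47)) <|
    .seq (assign 48 ((0 - load 2 (reg 43)) % reg 6)) <|
    .seq (store 41 (reg 43) (load 40 (reg 48))) <|
    store 40 (reg 48) (reg 43)

/-- The indices are inserted at the heads from n - 1 down to 0, so each list is increasing. This is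
what lets the enumeration produce the codes in increasing order without sorting. -/
theorem bucketCmd_spec {d n m : ℕ} {s : State} {a b c : ℕ → ℤ} (h : HasParams d n s)
    (hi : HasInput n a b c s) (h6 : s.reg 6 = m) (hm : 0 < m) (hmM : m ≤ modBound n) :
    HT (cellBound d n) bucketCmd (20 * (n + m + 1)) s (Buckets n m 0 c) := by
  have hmB : (m : ℤ) ≤ cellBound d n :=
    natCast_le_cellBound (hmM.trans (modBound_le n)) (by omega)
  have hnB : (n : ℤ) ≤ cellBound d n :=
    natCast_le_cellBound (k := 1) (by rw [pow_one]; exact (lt_two_pow_lg n).le) (by omega)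
  refine HT.seq (T₁ := m * 4 + 3) (T₂ := n * 10 + 3) (R := Buckets n m n c) ?_ ?_ (by omega)
  · refine HT.forLoop (T₁ := 1) m (fun i s' => ∀ g : ℕ, g < i → s'.arr 40 g = n) h6 hmB rfl rfl
      (by simp) ?_ ?_ le_rfl
    · intro i s' him hs h47 hI
      have e0 : s'.reg 0 = n := by simpa [h.r0] using hs.reg 0 rfl
      refine HT.store (by simp [e0, hnB]) fun g hg => ?_
      simp only [State.setReg_arr, State.setArr_arr, val_reg, h47, e0]
      split_ifs with h1
      · rfl
      · refine hI g ?_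
        have : ¬ (g : ℤ) = i := by simpa using h1
        omega
    · intro s' hs _ hI
      exact ⟨fun g hg => ⟨n, hI g hg, le_rfl, le_rfl, by omega, by omega⟩, by omega⟩
  · intro s1 hs1 hb
    have hp1 := h.of_same hs1
    have hi1 := hi.of_same hs1
    have h61 : s1.reg 6 = m := by rw [hs1.reg 6 rfl, h6]
    refine HT.forLoop (T₁ := 7) n (fun i s' => ∃ K, K + i = n ∧ Buckets n m K c s') hp1.r0 hnB rfl rfl
      ⟨n, by omega, hb.of_same (s' := s1.setReg 47 0) (p := assign 47 0) ⟨fun y hy => by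
        have : y ≠ 47 := by simpa [writesReg] using hy
        simp [this], fun _ _ => rfl, fun _ => rfl⟩⟩ ?_ ?_ le_rfl
    · rintro i s' hin hs h47 ⟨K', hK', hB⟩
      obtain ⟨K, rfl⟩ : ∃ K, K' = K + 1 := ⟨K' - 1, by omega⟩
      have e0 : s'.reg 0 = n := by simpa [hp1.r0] using hs.reg 0 rfl
      have e6 : s'.reg 6 = m := by simpa [h61] using hs.reg 6 rfl
      have e2 : s'.arr 2 K = c K := by
        rw [show s'.arr 2 = s1.arr 2 from hs.arr 2 rfl]
        exact hi1.a2 K (by omega)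
      obtain ⟨g, hg⟩ : ∃ g : ℕ, target m c K = g :=
        ⟨(target m c K).toNat, by
          have : 0 ≤ target m c K := Int.emod_nonneg _ (by omega)
          omega⟩
      have hgm : g < m := by
        have : target m c K < m := Int.emod_lt_of_pos _ (by omega)
        omega
      obtain ⟨v, hv, hnext⟩ := hB.head g hgm
      have eK : (n : ℤ) - 1 - i = K := by omega
      refine HT.assign_seq (T₁ := 5) ?_ ?_ le_rfl
      · simp [e0, h47, eK]
        omega
      simp only [val_sub, val_reg, val_ofNat, e0, h47, eK]
      refine HT.assign_seq (T₁ := 3) ?_ ?_ le_rfl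
      · have : target m c K = (-c K) % m := by simp [target]
        simp [e6, e2, ← this, hg]
        omega
      have : (((0 - load 2 (reg 43)) % reg 6 : Expr)).val (s'.setReg 43 K) = g := by
        simp [e6, e2, ← hg, target]
      rw [this]
      refine HT.store_seq (T₁ := 1) ?_ ?_ le_rfl
      · have := hnext.le_n
        simp [hv]
        omega
      refine HT.store ?_ ⟨K, by omega, ?_, ?_⟩
      · simp
        omega
      · intro g' hg'
        by_cases hgg : g' = g
        · subst hgg
          exact ⟨K, by simp, le_rfl, by omega, fun _ => hg, by omega⟩
        · obtain ⟨v', hv', hn'⟩ := hB.head g' hg'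
          refine ⟨v', by simp [hgg, hv'], by have := hn'.le; omega, hn'.le_n, hn'.eq, fun k hk hkv => ?_⟩
          rcases hk.eq_or_lt with rfl | hlt
          · rw [hg]
            exact fun h => hgg (by exact_mod_cast h.symm)
          · exact hn'.ne k hlt hkv
      · intro k hk hkn
        rcases hk.eq_or_lt with rfl | hlt
        · exact ⟨v, by simp [hv], by rw [hg]; exact hnext⟩
        · obtain ⟨v', hv', hn'⟩ := hB.link k hlt hkn
          exact ⟨v', by simp [hv', show k ≠ K by omega], hn'⟩
    · rintro s' - - ⟨K, hK, hB⟩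
      obtain rfl : K = 0 := by omega
      exact hB

/-! ## Enumeration of hits -/

theorem codeSum_pair {n : ℕ} (a b c : ℕ → ℤ) (u : ℕ) {k : ℕ} (hk : k < n) :
    codeSum n a b c (u * n + k) = a (u / n) + b (u % n) + c k := by
  have h1 : (u * n + k) / n = u := by
    rw [mul_comm, Nat.mul_add_div (by omega), Nat.div_eq_of_lt hk, add_zero]
  rw [codeSum, h1, Nat.mul_add_mod', Nat.mod_eq_of_lt hk]

theorem mem_hits_pair {n m u k : ℕ} {a b c : ℕ → ℤ} (hu : u < n * n) (hk : k < n) :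
    u * n + k ∈ hits n m a b c ↔ target m c k = (a (u / n) + b (u % n)) % m := by
  rw [hits, Finset.mem_filter, Finset.mem_range, codeSum_pair a b c u hk, dvd_add_iff_target]
  exact ⟨fun h => h.2, fun h => ⟨by nlinarith, h⟩⟩

/-- The bucket contains all k that complete the pair u to a hit, so jumping to the next entry of the
list skips no hit; for v = n it skips to the next pair. -/
theorem IsNext.le_of_mem_hits {n m u K v : ℕ} {a b c : ℕ → ℤ} (hu : u < n * n)
    (h : IsNext n (target m c) ((a (u / n) + b (u % n)) % m) K v) {x : ℕ}
    (hx : x ∈ hits n m a b c) (hK : u * n + K ≤ x) : u * n + v ≤ x := by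
  by_contra hlt
  obtain ⟨k, rfl⟩ : ∃ k, x = u * n + k := ⟨x - u * n, by omega⟩
  have := h.le_n
  exact h.ne k (by omega) (by omega) ((mem_hits_pair hu (by omega)).1 hx)

theorem filter_lt_congr {S : Finset ℕ} {x y : ℕ} (hxy : x ≤ y) (h : ∀ z ∈ S, x ≤ z → y ≤ z) :
    S.filter (· < y) = S.filter (· < x) := by
  ext z
  simp only [Finset.mem_filter]
  refine and_congr_right fun hz => ⟨fun hy => ?_, fun hx => by omega⟩
  by_contra hx
  have := h z hz (by omega)
  omega

theorem filter_lt_succ {S : Finset ℕ} {x : ℕ} (hx : x ∈ S) :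
    (S.filter (· < x + 1)).card = (S.filter (· < x)).card + 1 := by
  have : S.filter (· < x + 1) = insert x (S.filter (· < x)) := by
    ext z
    simp only [Finset.mem_filter, Finset.mem_insert]
    constructor
    · rintro ⟨h1, h2⟩
      rcases Nat.lt_succ_iff_lt_or_eq.1 h2 with h | h
      · exact .inr ⟨h1, h⟩
      · exact .inl h
    · rintro (rfl | ⟨h1, h2⟩)
      · exact ⟨hx, by omega⟩
      · exact ⟨h1, by omega⟩
  rw [this, Finset.card_insert_of_notMem (by simp)]

/-- The number of elements of `S` that are less than `x`. -/
def countBelow (S : Finset ℕ) (x : ℕ) : ℕ := (S.filter (· < x)).card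

theorem countBelow_mono (S : Finset ℕ) {x y : ℕ} (h : x ≤ y) : countBelow S x ≤ countBelow S y :=
  Finset.card_le_card fun z hz => by
    simp only [Finset.mem_filter] at hz ⊢
    exact ⟨hz.1, by omega⟩

/-- Some triple with indices below `n` has sum zero. -/
def HasZeroSum (n : ℕ) (a b c : ℕ → ℤ) : Prop :=
  ∃ i < n, ∃ j < n, ∃ k < n, a i + b j + c k = 0

/-- The first `l` entries of `q` are codes of hits, increasing and less than `x`. -/
def Listed (n m : ℕ) (a b c : ℕ → ℤ) (x l : ℕ) (q : ℕ → ℤ) : Prop :=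
  ∀ t < l, minNext q t ≤ q t ∧ q t < x ∧ (q t).toNat ∈ hits n m a b c

/-- The state during the enumeration: the codes below `p n + k - n` are processed, where `k < n`
only if `k` continues the list of the pair before `p`. The flag `o` tells that the enumeration was
aborted. -/
structure Scan (d n m : ℕ) (a b c : ℕ → ℤ) (p k l o : ℕ) (s : State) : Prop where
  r42 : s.reg 42 = p
  r43 : s.reg 43 = k
  r44 : s.reg 44 = l
  r45 : s.reg 45 = o
  p_le : p ≤ n * n
  k_le : k ≤ n
  pos : k < n → 0 < p ∧ target m c k = (a ((p - 1) / n) + b ((p - 1) % n)) % m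
  l_le : l ≤ falseBound d n
  listed : Listed n m a b c (p * n + k - n) l fun t => s.arr 42 t
  o_zero : o = 0 → l = countBelow (hits n m a b c) (p * n + k - n)
  o_one : o = 0 ∨ o = 1 ∧ l = falseBound d n ∧ p = n * n ∧ k = n
  found_zero : s.reg 46 = 0 → l ≤ countBelow (falsePositives n m a b c) (p * n + k - n)
  found_one : s.reg 46 ≠ 0 → HasZeroSum n a b c

/-- Processes the next code, or passes to the next pair. -/
def scanStep : Cmd :=
  branch (less (reg 43) (reg 0))
    (branch (less (reg 44) (reg 5))
      (.seq (store 42 (reg 44) ((reg 42 - 1) * reg 0 + reg 43)) <|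
       .seq (assign 44 (reg 44 + 1)) <|
       .seq (branch (load 0 ((reg 42 - 1) / reg 0) + load 1 ((reg 42 - 1) % reg 0) +
         load 2 (reg 43)) .skip (assign 46 1)) <|
       assign 43 (load 41 (reg 43)))
      (.seq (assign 45 1) <| .seq (assign 42 (reg 41)) <| assign 43 (reg 0)))
    (.seq (assign 43 (load 40 ((load 0 (reg 42 / reg 0) + load 1 (reg 42 % reg 0)) % reg 6))) <|
     assign 42 (reg 42 + 1))

/-- A bound for the number of remaining steps of an enumeration. -/
def scanRest (d n p l o : ℕ) : ℕ := (n * n - p) + (falseBound d n - l) + (1 - o)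

theorem Listed.snoc {n m x y l : ℕ} {a b c : ℕ → ℤ} {q q' : ℕ → ℤ} (h : Listed n m a b c x l q)
    (hx : x ∈ hits n m a b c) (hxy : x < y) (hq : ∀ t < l, q' t = q t) (hl : q' l = x) :
    Listed n m a b c y (l + 1) q' := by
  intro t ht
  rcases Nat.lt_succ_iff_lt_or_eq.1 ht with h1 | rfl
  · obtain ⟨h2, h3, h4⟩ := h t h1
    refine ⟨?_, by rw [hq t h1]; omega, by rwa [hq t h1]⟩
    cases t with
    | zero => simpa [minNext, hq 0 h1] using h2
    | succ t =>
      rw [minNext] at h2 ⊢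
      rwa [hq _ h1, hq t (by omega)]
  · refine ⟨?_, by rw [hl]; exact_mod_cast hxy, by rw [hl]; simpa using hx⟩
    cases t with
    | zero => simp [minNext, hl]
    | succ t =>
      rw [minNext, hl, hq t (by omega)]
      have := (h t (by omega)).2.1
      omega

theorem Listed.mono {n m x y l : ℕ} {a b c : ℕ → ℤ} {q : ℕ → ℤ} (h : Listed n m a b c x l q)
    (hxy : x ≤ y) : Listed n m a b c y l q := fun t ht =>
  ⟨(h t ht).1, lt_of_lt_of_le (h t ht).2.1 (by exact_mod_cast hxy), (h t ht).2.2⟩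

/-- Each step lowers the measure: listing a hit raises l, aborting raises o, and passing to the next
pair raises p. The truncated subtraction in the position p n + k - n is harmless, because k = n when
p = 0. As long as no zero sum has been met, every listed hit is a false positive. -/
theorem scanStep_spec {d n m p k l o : ℕ} {s : State} {a b c : ℕ → ℤ} (h : HasParams d n s)
    (hi : HasInput n a b c s) (h6 : s.reg 6 = m) (h41 : s.reg 41 = (n * n : ℕ)) (hm : 0 < m)
    (hb : Buckets n m 0 c s) (hs : Scan d n m a b c p k l o s) (hlt : p < n * n ∨ k < n) :
    HT (cellBound d n) scanStep 11 s fun s' => ∃ p' k' l' o', Scan d n m a b c p' k' l' o' s' ∧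
      scanRest d n p' l' o' < scanRest d n p l o := by
  have hX := lt_two_pow_lg n
  have hnB : (n : ℤ) ≤ cellBound d n :=
    natCast_le_cellBound (k := 1) (by rw [pow_one]; exact hX.le) (by omega)
  have hnn : n * n ≤ (2 ^ lg n) ^ 2 := by rw [sq]; gcongr
  have hnnB : ((n * n : ℕ) : ℤ) ≤ cellBound d n := natCast_le_cellBound hnn (by omega)
  have hn3B : ((n * n * n : ℕ) : ℤ) ≤ cellBound d n :=
    natCast_le_cellBound (k := 3) (by rw [pow_succ]; gcongr) (by omega)
  have hF : (falseBound d n : ℤ) ≤ cellBound d n :=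
    natCast_le_cellBound (falseBound_le d n) (by omega)
  have b1 : (1 : ℤ) ≤ cellBound d n := le_cellBound_of_le (by norm_num)
  have ho : o = 0 := by
    rcases hs.o_one with h | ⟨-, -, h1, h2⟩
    · exact h
    · omega
  subst ho
  have hpn := hs.p_le
  have hkn := hs.k_le
  refine HT.branch (T₁ := 10) (fun h1 => HT.branch (T₁ := 9) (fun h2 => ?_) (fun h2 => ?_) le_rfl)
    (fun h1 => ?_) le_rfl
  · simp [hs.r43, h.r0] at h1
    simp [hs.r44, h.r5] at h2
    obtain ⟨hp0, htar⟩ := hs.pos h1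
    obtain ⟨u, rfl⟩ : ∃ u, p = u + 1 := ⟨p - 1, by omega⟩
    simp only [Nat.add_sub_cancel] at htar
    have hx : (u + 1) * n + k - n = u * n + k := by rw [Nat.succ_mul]; omega
    obtain ⟨v, hv, hnext⟩ := hb.link k (Nat.zero_le _) h1
    have hvn := hnext.le_n
    have hkv := hnext.le
    have hy : (u + 1) * n + v - n = u * n + v := by rw [Nat.succ_mul]; omega
    have hcode : u * n + k ≤ n * n * n := by nlinarith
    have hmem : u * n + k ∈ hits n m a b c := (mem_hits_pair (by omega) h1).2 htar
    have e42 : s.reg 42 - 1 = u := by rw [hs.r42]; push_cast; ring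
    have hlisted := hs.listed
    have hzero := hs.o_zero rfl
    have hfz := hs.found_zero
    rw [hx] at hlisted hzero hfz
    -- By the choice of v there is no hit strictly between the present code and u n + v.
    have hcb : countBelow (hits n m a b c) (u * n + v) =
        countBelow (hits n m a b c) (u * n + k) + 1 := by
      unfold countBelow
      rw [← filter_lt_succ hmem, filter_lt_congr (y := u * n + v) (x := u * n + k + 1) (by omega)]
      intro z hz hkz
      refine IsNext.le_of_mem_hits (by omega) (K := k + 1) ?_ hz hkz
      rw [← htar]
      exact hnext
    refine HT.store_seq (T₁ := 7) ?_ ?_ le_rfl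
    · simp only [val_add, val_mul, val_sub, val_reg, val_ofNat, e42, h.r0, hs.r43]
      rw [abs_of_nonneg (by positivity)]
      refine le_trans ?_ hn3B
      exact_mod_cast hcode
    simp only [val_add, val_mul, val_sub, val_reg, val_ofNat, e42, h.r0, hs.r43, hs.r44]
    refine HT.assign_seq (T₁ := 5) ?_ ?_ le_rfl
    · simp [hs.r44]
      rw [abs_of_nonneg (by positivity)]
      omega
    simp only [val_add, val_reg, val_ofNat, State.setArr_reg, hs.r44]
    generalize hσ : State.setReg _ 44 _ = σ
    have g42 : σ.reg 42 = (u + 1 : ℕ) := by rw [← hσ]; simp [hs.r42]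
    have g43 : σ.reg 43 = k := by rw [← hσ]; simp [hs.r43]
    have g44 : σ.reg 44 = (l + 1 : ℕ) := by rw [← hσ]; simp
    have g45 : σ.reg 45 = 0 := by rw [← hσ]; simp [hs.r45]
    have g46 : σ.reg 46 = s.reg 46 := by rw [← hσ]; simp
    have g0 : σ.reg 0 = n := by rw [← hσ]; simp [h.r0]
    have ga : ∀ j, j ≠ 42 → σ.arr j = s.arr j := by
      intro j hj
      rw [← hσ]
      exact State.setArr_arr_of_ne _ _ _ _ _ hj
    have gq : ∀ t < l, σ.arr 42 t = s.arr 42 t := by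
      intro t ht
      rw [← hσ]
      simp [show t ≠ l by omega]
    have gl : σ.arr 42 l = (u * n + k : ℕ) := by rw [← hσ]; simp
    have e42' : σ.reg 42 - 1 = u := by rw [g42]; push_cast; ring
    have hval : (load 0 ((reg 42 - 1) / reg 0) + load 1 ((reg 42 - 1) % reg 0) +
         load 2 (reg 43) : Expr).val σ = codeSum n a b c (u * n + k) := by
      rw [codeSum_pair a b c u h1]
      have hu : u < n * n := by omega
      have i0 := hi.a0 (u / n) (Nat.div_lt_of_lt_mul hu)
      have i1 := hi.a1 (u % n) (Nat.mod_lt _ (by omega))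
      have i2 := hi.a2 k h1
      push_cast at i0 i1
      simp only [val_add, val_load, val_div, val_mod, val_sub, val_reg, val_ofNat, e42', g0, g43,
        ga 0 (by norm_num), ga 1 (by norm_num), ga 2 (by norm_num), i0, i1, i2]
    refine HT.seq (T₁ := 2) (T₂ := 1) (R := fun s' => (∀ x, x ≠ 46 → s'.reg x = σ.reg x) ∧
      s'.arr = σ.arr ∧ (s'.reg 46 = 0 → s.reg 46 = 0 ∧ codeSum n a b c (u * n + k) ≠ 0) ∧
      (s'.reg 46 ≠ 0 → HasZeroSum n a b c)) ?_ ?_ (by omega)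
    · refine HT.branch (T₁ := 1) (fun h3 => HT.skip ⟨fun _ _ => rfl, rfl, fun h4 => ?_, fun h4 => ?_⟩)
        (fun h3 => HT.assign (by simpa using b1) ⟨fun x hx => by simp [hx], rfl, by simp, fun _ => ?_⟩)
        le_rfl
      · rw [hval] at h3
        exact ⟨g46 ▸ h4, h3⟩
      · exact hs.found_one (g46 ▸ h4)
      · rw [hval, codeSum_pair a b c u h1] at h3
        have hu : u < n * n := by omega
        exact ⟨_, Nat.div_lt_of_lt_mul hu, _, Nat.mod_lt _ (by omega), k, h1, h3⟩
    · rintro s1 - ⟨hr, harr, hz, ho⟩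
      have eload : (load 41 (reg 43) : Expr).val s1 = v := by
        simp [hr 43 (by norm_num), g43, harr, ga 41 (by norm_num), hv]
      refine HT.assign ?_ ⟨u + 1, v, l + 1, 0, ?_, ?_⟩
      · rw [eload, abs_of_nonneg (by positivity)]
        omega
      · rw [eload]
        constructor
        · simp [hr 42 (by norm_num), g42]
        · simp
        · simp [hr 44 (by norm_num), g44]
        · simp [hr 45 (by norm_num), g45]
        · exact hpn
        · exact hvn
        · intro hvlt
          refine ⟨Nat.succ_pos _, ?_⟩
          rw [Nat.add_sub_cancel, hnext.eq hvlt, htar]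
        · omega
        · rw [hy]
          simp only [State.setReg_arr, harr]
          exact hlisted.snoc hmem (by omega) gq gl
        · intro _
          rw [hy, hcb, ← hzero]
        · exact .inl rfl
        · intro h46
          obtain ⟨z1, z2⟩ := hz (by simpa using h46)
          rw [hy]
          have hmem' : u * n + k ∈ falsePositives n m a b c := Finset.mem_filter.2 ⟨hmem, z2⟩
          have := hfz z1
          have h5 : countBelow (falsePositives n m a b c) (u * n + k + 1) =
            countBelow (falsePositives n m a b c) (u * n + k) + 1 := filter_lt_succ hmem'
          have := countBelow_mono (falsePositives n m a b c) (show u * n + k + 1 ≤ u * n + v by omega)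
          omega
        · intro h46
          exact ho (by simpa using h46)
      · unfold scanRest
        omega
  · simp [hs.r43, h.r0] at h1
    simp [hs.r44, h.r5] at h2
    have hle := hs.l_le
    have hmono : p * n + k - n ≤ n * n * n + n - n := by
      have : p * n ≤ n * n * n := Nat.mul_le_mul_right _ hpn
      omega
    -- An abort jumps to the final position p = n², k = n, so that the loop condition fails.
    refine HT.assign_seq (T₁ := 3) (by simpa using b1) ?_ (by omega)
    simp only [val_ofNat]
    refine HT.assign_seq (T₁ := 1) (by simp [h41]; exact_mod_cast hnnB) ?_ (by omega)
    simp only [val_reg, State.setReg_reg, h41]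
    refine HT.assign (by simp [h.r0]; exact hnB) ⟨n * n, n, l, 1, ?_, ?_⟩
    · constructor
      · simp
      · simp [h.r0]
      · simp [hs.r44]
      · simp
      · exact le_rfl
      · exact le_rfl
      · omega
      · exact hle
      · exact hs.listed.mono hmono
      · simp
      · exact .inr ⟨rfl, by omega, rfl, rfl⟩
      · intro h46
        exact (hs.found_zero (by simpa using h46)).trans (countBelow_mono _ hmono)
      · intro h46
        exact hs.found_one (by simpa using h46)
    · unfold scanRest
      omega
  · simp [hs.r43, h.r0] at h1
    obtain rfl : k = n := by omega
    have hp : p < k * k := by omega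
    have hx : p * k + k - k = p * k := by omega
    have hkpos : 0 < k := by
      rcases Nat.eq_zero_or_pos k with rfl | h
      · omega
      · exact h
    have i0 := hi.a0 (p / k) (Nat.div_lt_of_lt_mul hp)
    have i1 := hi.a1 (p % k) (Nat.mod_lt _ hkpos)
    push_cast at i0 i1
    obtain ⟨g, hg⟩ : ∃ g : ℕ, (a (p / k) + b (p % k)) % m = g :=
      ⟨((a (p / k) + b (p % k)) % m).toNat, by
        have : 0 ≤ (a (p / k) + b (p % k)) % (m : ℤ) := Int.emod_nonneg _ (by omega)
        omega⟩
    have hgm : g < m := by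
      have : (a (p / k) + b (p % k)) % (m : ℤ) < m := Int.emod_lt_of_pos _ (by omega)
      omega
    obtain ⟨v, hv, hnext⟩ := hb.head g hgm
    have hvn := hnext.le_n
    have hval : (load 40 ((load 0 (reg 42 / reg 0) + load 1 (reg 42 % reg 0)) % reg 6) : Expr).val s
        = v := by
      simp only [val_add, val_load, val_div, val_mod, val_reg, hs.r42, h.r0, i0, i1, h6, hg, hv]
    have hy : (p + 1) * k + v - k = p * k + v := by rw [Nat.succ_mul]; omega
    have hlisted := hs.listed
    have hzero := hs.o_zero rfl
    have hfz := hs.found_zero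
    rw [hx] at hlisted hzero hfz
    refine HT.assign_seq (T₁ := 1) ?_ ?_ (by omega)
    · rw [hval, abs_of_nonneg (by positivity)]
      omega
    rw [hval]
    refine HT.assign ?_ ⟨p + 1, v, l, 0, ?_, ?_⟩
    · simp [hs.r42]
      rw [abs_of_nonneg (by positivity)]
      omega
    · constructor
      · simp [hs.r42]
      · simp
      · simp [hs.r44]
      · simp [hs.r45]
      · omega
      · exact hvn
      · intro hvlt
        refine ⟨Nat.succ_pos _, ?_⟩
        rw [Nat.add_sub_cancel, hnext.eq hvlt, hg]
      · exact hs.l_le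
      · rw [hy]
        exact hlisted.mono (by omega)
      · intro _
        rw [hy, hzero]
        unfold countBelow
        rw [filter_lt_congr (y := p * k + v) (x := p * k) (by omega)]
        intro z hz hkz
        refine IsNext.le_of_mem_hits hp (K := 0) ?_ hz hkz
        rw [hg]
        exact hnext
      · exact .inl rfl
      · intro h46
        rw [hy]
        exact (hfz (by simpa using h46)).trans (countBelow_mono _ (by omega))
      · intro h46
        exact hs.found_one (by simpa using h46)
    · unfold scanRest
      omega

/-! ## The prover -/

/-- Tries the modulus `m + 1` where `m` is the content of register `6`. -/
def attemptCmd : Cmd :=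
  .seq (assign 6 (reg 6 + 1)) <|
  .seq (assign 41 (reg 0 * reg 0)) <|
  .seq bucketCmd <|
  .seq (assign 42 0) <|
  .seq (assign 43 (reg 0)) <|
  .seq (assign 44 0) <|
  .seq (assign 45 0) <|
  .seq (assign 46 0) <|
  .seq (loop (less (reg 42) (reg 41) + less (reg 43) (reg 0)) scanStep) <|
  branch (reg 46) (assign 40 1) (branch (reg 45) .skip (assign 40 1))

/-- Outputs the modulus and the list of triples. -/
def emitCmd : Cmd :=
  .seq (emit (reg 6)) <| .seq (emit (reg 44)) <| forLoop 47 44 (emit (load 42 (reg 47)))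

/-- One round of the prover. -/
def roundCmd : Cmd := .seq (rand 6 (reg 4 - 1)) attemptCmd

/-- The prover. -/
def prover (d : ℕ) : Cmd :=
  .seq (paramsCmd d) <| .seq (assign 40 0) <| .seq (loop (equal (reg 40) 0) roundCmd) emitCmd

theorem val_less_add_less_eq_zero {e f e' f' : Expr} {s : State} :
    (less e f + less e' f').val s = 0 ↔ f.val s ≤ e.val s ∧ f'.val s ≤ e'.val s := by
  rw [val_add, ← val_less_eq_zero (e := e), ← val_less_eq_zero (e := e')]
  have h1 : 0 ≤ (less e f).val s := by simp only [less, val, BinOp.apply]; split <;> simp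
  have h2 : 0 ≤ (less e' f').val s := by simp only [less, val, BinOp.apply]; split <;> simp
  omega

/-- The prover has found a suitable modulus and the list of its hits, unless there is a triple with
sum zero. -/
def Success (d n : ℕ) (a b c : ℕ → ℤ) (s : State) : Prop :=
  ∃ m l : ℕ, s.reg 6 = m ∧ s.reg 44 = l ∧ 0 < m ∧ m ≤ modBound n ∧ l ≤ falseBound d n ∧
    (¬ HasZeroSum n a b c → tripleCount n m a b c = l ∧
      Listed n m a b c (n * n * n) l fun t => s.arr 42 t)

/-- The running time of one attempt. -/
def attemptTime (d n : ℕ) : ℕ := 100 * (n * n + modBound n + falseBound d n)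

/-- If a zero sum was found, success claims nothing about the list. If the enumeration was not
aborted, the list is complete. If it was aborted without a zero sum, the F listed hits are all false
positives and the modulus is bad. So a good modulus always ends the search, even if there is a zero
triple. -/
theorem attemptCmd_spec {d n r : ℕ} {s : State} {a b c : ℕ → ℤ} (h : HasParams d n s)
    (hi : HasInput n a b c s) (h6 : s.reg 6 = r) (hr : r < modBound n) (h40 : s.reg 40 = 0) :
    HT (cellBound d n) attemptCmd (attemptTime d n) s fun s' =>
      (s'.reg 40 = 0 ∧ falseBound d n ≤ (falsePositives n (r + 1) a b c).card) ∨
      (s'.reg 40 = 1 ∧ Success d n a b c s') := by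
  have hX := lt_two_pow_lg n
  have hnB : (n : ℤ) ≤ cellBound d n :=
    natCast_le_cellBound (k := 1) (by rw [pow_one]; exact hX.le) (by omega)
  have hnn : n * n ≤ (2 ^ lg n) ^ 2 := by rw [sq]; gcongr
  have hnnB : ((n * n : ℕ) : ℤ) ≤ cellBound d n := natCast_le_cellBound hnn (by omega)
  have hrB : ((r + 1 : ℕ) : ℤ) ≤ cellBound d n :=
    natCast_le_cellBound ((Nat.succ_le_of_lt hr).trans (modBound_le n)) (by omega)
  have b0 : (0 : ℤ) ≤ cellBound d n := le_cellBound_of_le (by norm_num)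
  have b1 : (1 : ℤ) ≤ cellBound d n := le_cellBound_of_le (by norm_num)
  have hnle : n ≤ n * n := Nat.le_mul_self n
  have hM : 1 ≤ modBound n := Nat.succ_pos _
  obtain ⟨U, hU⟩ : ∃ U, U = n * n + modBound n + falseBound d n := ⟨_, rfl⟩
  have hF : 1 ≤ falseBound d n := Nat.succ_pos _
  unfold attemptTime
  rw [← hU]
  refine HT.assign_seq (T₁ := 98 * U) ?_ ?_ (by omega)
  · simp [h6]
    rw [abs_of_nonneg (by positivity)]
    exact_mod_cast hrB
  simp only [val_add, val_reg, val_ofNat, h6]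
  refine HT.assign_seq (T₁ := 96 * U) ?_ ?_ (by omega)
  · simp [h.r0]
    exact_mod_cast hnnB
  simp only [val_mul, val_reg, State.setReg_reg, h.r0, show (0 : ℕ) ≠ 6 by norm_num, if_false]
  generalize hσ : State.setReg _ 41 _ = σ
  have q6 : σ.reg 6 = (r + 1 : ℕ) := by rw [← hσ]; simp
  have q41 : σ.reg 41 = (n * n : ℕ) := by rw [← hσ]; simp
  have q40 : σ.reg 40 = 0 := by rw [← hσ]; simp [h40]
  have qp : HasParams d n σ := by rw [← hσ]; exact (h.setReg).setReg
  have qi : HasInput n a b c σ := by rw [← hσ]; exact ⟨hi.a0, hi.a1, hi.a2⟩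
  refine HT.seq (T₂ := 50 * U) ((bucketCmd_spec qp qi q6 (Nat.succ_pos r) hr).conseq
    (show _ ≤ 45 * U by omega) fun _ _ h => h) ?_ (by omega)
  intro s1 hs1 hb1
  have hp1 := qp.of_same hs1
  refine HT.assign_seq (T₁ := 48 * U) (by simpa using b0) ?_ (by omega)
  refine HT.assign_seq (T₁ := 46 * U) (by simp [hp1.r0, hnB]) ?_ (by omega)
  refine HT.assign_seq (T₁ := 44 * U) (by simpa using b0) ?_ (by omega)
  refine HT.assign_seq (T₁ := 42 * U) (by simpa using b0) ?_ (by omega)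
  refine HT.assign_seq (T₁ := 40 * U) (by simpa using b0) ?_ (by omega)
  simp only [val_ofNat, val_reg, State.setReg_reg, hp1.r0, show (0 : ℕ) ≠ 42 by norm_num, if_false]
  generalize hσ2 : State.setReg _ 46 _ = ρ
  have r6 : ρ.reg 6 = (r + 1 : ℕ) := by rw [← hσ2]; simpa [q6] using hs1.reg 6 rfl
  have r41 : ρ.reg 41 = (n * n : ℕ) := by rw [← hσ2]; simpa [q41] using hs1.reg 41 rfl
  have r40 : ρ.reg 40 = 0 := by rw [← hσ2]; simpa [q40] using hs1.reg 40 rfl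
  have rp : HasParams d n ρ := by rw [← hσ2]; exact hp1.setReg.setReg.setReg.setReg.setReg
  have hi1 := qi.of_same hs1
  have ri : HasInput n a b c ρ := by rw [← hσ2]; exact ⟨hi1.a0, hi1.a1, hi1.a2⟩
  have rb : Buckets n (r + 1) 0 c ρ := by rw [← hσ2]; exact ⟨hb1.head, hb1.link⟩
  -- The start p = 0, k = n is position 0: no list is being followed and the first pair comes next.
  have rs : Scan d n (r + 1) a b c 0 n 0 0 ρ := by
    constructor
    · rw [← hσ2]; simp
    · rw [← hσ2]; simp
    · rw [← hσ2]; simp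
    · rw [← hσ2]; simp
    · exact Nat.zero_le _
    · exact le_rfl
    · omega
    · exact Nat.zero_le _
    · intro t ht; omega
    · intro _; simp [countBelow]
    · exact .inl rfl
    · intro _; exact Nat.zero_le _
    · rw [← hσ2]; simp
  -- Each unit of the measure pays for the 11 steps of `scanStep` and one loop test.
  refine HT.seq (T₁ := 12 * scanRest d n 0 0 0 + 1) (T₂ := 3) (R := fun s' => ∃ l o,
    Scan d n (r + 1) a b c (n * n) n l o s') ?_ ?_ (by unfold scanRest; omega)
  · refine HT.loop (fun τ s' => ∃ p k l o, Scan d n (r + 1) a b c p k l o s' ∧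
      τ = 12 * scanRest d n p l o + 1) ⟨0, n, 0, 0, rs, rfl⟩ ?_ ?_
    · rintro τ s' hs ⟨p, k, l, o, hsc, rfl⟩ hne
      have e0 : s'.reg 0 = n := by rw [hs.reg 0 rfl, rp.r0]
      have e41 : s'.reg 41 = (n * n : ℕ) := by rw [hs.reg 41 rfl, r41]
      have hlt : p < n * n ∨ k < n := by
        by_contra hge
        apply hne
        rw [val_less_add_less_eq_zero]
        simp only [val_reg, e0, e41, hsc.r42, hsc.r43]
        omega
      obtain ⟨t, ht, s'', he, p', k', l', o', hsc', hlt'⟩ := scanStep_spec (rp.of_same hs)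
        (ri.of_same hs) (by rw [hs.reg 6 rfl, r6]) e41 (Nat.succ_pos r) (rb.of_same hs) hsc hlt
      exact ⟨11, 12 * scanRest d n p' l' o' + 1, by omega, t, ht, s'', he, p', k', l', o', hsc', rfl⟩
    · rintro τ s' hs ⟨p, k, l, o, hsc, rfl⟩ hz
      have e0 : s'.reg 0 = n := by rw [hs.reg 0 rfl, rp.r0]
      have e41 : s'.reg 41 = (n * n : ℕ) := by rw [hs.reg 41 rfl, r41]
      rw [val_less_add_less_eq_zero] at hz
      simp only [val_reg, e0, e41, hsc.r42, hsc.r43] at hz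
      have h1 := hsc.p_le
      have h2 := hsc.k_le
      obtain rfl : p = n * n := by omega
      obtain rfl : k = n := by omega
      exact ⟨by omega, l, o, hsc⟩
  · rintro s2 hs2 ⟨l, o, hsc⟩
    have e6 : s2.reg 6 = (r + 1 : ℕ) := by rw [hs2.reg 6 rfl, r6]
    have e40 : s2.reg 40 = 0 := by rw [hs2.reg 40 rfl, r40]
    have hpos : n * n * n + n - n = n * n * n := by omega
    have hall : ∀ S ⊆ Finset.range (n * n * n), countBelow S (n * n * n) = S.card := by
      intro S hS
      unfold countBelow
      rw [Finset.filter_true_of_mem]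
      exact fun x hx => Finset.mem_range.1 (hS hx)
    have hh := hall (hits n (r + 1) a b c) (Finset.filter_subset _ _)
    have hf := hall (falsePositives n (r + 1) a b c)
      ((Finset.filter_subset _ _).trans (Finset.filter_subset _ _))
    have good : (¬ HasZeroSum n a b c → o = 0) → ∀ s' : State, s'.reg 6 = s2.reg 6 →
        s'.reg 44 = s2.reg 44 → s'.arr = s2.arr → Success d n a b c s' := by
      intro hno s' f6 f44 farr
      refine ⟨r + 1, l, by rw [f6, e6], by rw [f44, hsc.r44], Nat.succ_pos r, hr, hsc.l_le,
        fun hz => ⟨?_, ?_⟩⟩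
      · rw [hsc.o_zero (hno hz), hpos, hh, card_hits]
      · rw [farr]
        have := hsc.listed
        rwa [hpos] at this
    refine HT.branch (T₁ := 2) (fun h1 => ?_) (fun h1 => HT.branch (T₁ := 1) (fun h2 => ?_)
      (fun h2 => ?_) le_rfl) le_rfl
    · refine HT.conseq (HT.assign (Q := fun s' => s'.reg 40 = 1 ∧ Success d n a b c s')
        (by simpa using b1) ⟨by simp, ?_⟩) (by norm_num) fun _ _ h => .inr h
      exact good (fun hz => absurd (hsc.found_one h1) hz) _ (by simp) (by simp) rfl
    · refine HT.skip (.inl ⟨e40, ?_⟩)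
      rcases hsc.o_one with ho | ⟨-, hl, -, -⟩
      · exact absurd (by simp [hsc.r45, ho]) h2
      · rw [← hf, ← hl, ← hpos]
        exact hsc.found_zero h1
    · refine HT.assign (by simpa using b1) (.inr ⟨by simp, ?_⟩)
      refine good (fun _ => ?_) _ (by simp) (by simp) rfl
      simpa [hsc.r45] using h2

theorem emitCmd_spec {d n l : ℕ} {s : State} (h44 : s.reg 44 = l) (hl : l ≤ falseBound d n) :
    HT (cellBound d n) emitCmd (4 * l + 7) s fun s' =>
      s'.out = s.out ++ s.reg 6 :: (l : ℤ) :: (List.range l).map fun t : ℕ => s.arr 42 t := by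
  refine HT.seq (HT.emit (Q := fun s' => s' = s.push (s.reg 6)) rfl) (T₂ := 4 * l + 5) ?_ (by omega)
  rintro s1 - rfl
  refine HT.seq (HT.emit (Q := fun s' => s' = (s.push (s.reg 6)).push l) (by simp [h44]))
    (T₂ := 4 * l + 3) ?_ (by omega)
  rintro s1 - rfl
  refine HT.forLoop (T₁ := 1) l (fun i s' => s'.out = s.out ++ s.reg 6 :: (l : ℤ) ::
    (List.range i).map fun t : ℕ => s.arr 42 t) (by simpa using h44)
    (natCast_le_cellBound (hl.trans (falseBound_le d n)) (by omega)) rfl rfl ?_ ?_ ?_ (by omega)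
  · simp
  · intro i s' hil hs h47 hI
    refine HT.emit ?_
    have : s'.arr 42 = s.arr 42 := hs.arr 42 rfl
    simp [hI, h47, this, List.range_succ]
  · intro s' _ _ hI
    exact hI

/-! ## Randomized computations -/

namespace Config

variable {w : ℕ}

theorem Halted.step_eq {c : Config} (h : c.Halted) (r : ℕ) : c.step w r = c := by
  obtain ⟨todo, st⟩ := c
  obtain rfl : todo = [] := h
  rfl

theorem Halted.drawMax_eq {c : Config} (h : c.Halted) : c.drawMax w = 0 := by
  obtain ⟨todo, st⟩ := c
  obtain rfl : todo = [] := h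
  rfl

theorem Halted.run_eq {c : Config} (h : c.Halted) (t : ℕ) : c.run w t = c := by
  induction t with
  | zero => rfl
  | succ t ih => rw [run, Function.iterate_succ_apply, h.step_eq]; exact ih

theorem runDist_succ_of_drawMax_eq_zero {c : Config} (h : c.drawMax w = 0) (t : ℕ) :
    c.runDist w (t + 1) = (c.step w 0).runDist w t := by
  have : PMF.uniformOfFinset (Finset.range (c.drawMax w + 1)) (by simp) = PMF.pure 0 := by
    ext r
    rw [PMF.uniformOfFinset_apply, PMF.pure_apply, h]
    by_cases hr : r = 0 <;> simp [hr]
  rw [runDist, this, PMF.pure_bind]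

/-- The probability that the computation has not halted after `t` steps. -/
noncomputable def pending (w t : ℕ) (c : Config) : ENNReal :=
  (c.runDist w t).toOuterMeasure {c' | ¬ c'.Halted}

theorem pending_le_one (t : ℕ) (c : Config) : c.pending w t ≤ 1 := by
  refine le_trans ((PMF.toOuterMeasure _).mono (Set.subset_univ _)) (le_of_eq ?_)
  exact (PMF.toOuterMeasure_apply_eq_one_iff _ _).2 (Set.subset_univ _)

theorem pending_succ_of_drawMax_eq_zero {c : Config} (h : c.drawMax w = 0) (t : ℕ) :
    c.pending w (t + 1) = (c.step w 0).pending w t := by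
  rw [pending, runDist_succ_of_drawMax_eq_zero h, pending]

theorem Halted.pending_eq {c : Config} (h : c.Halted) (t : ℕ) : c.pending w t = 0 := by
  induction t with
  | zero => simp [pending, runDist, PMF.toOuterMeasure_pure_apply, h]
  | succ t ih => rw [pending_succ_of_drawMax_eq_zero h.drawMax_eq, h.step_eq, ih]

/-- The average over the draw, with the denominator cleared to avoid division of extended reals. -/
theorem mul_pending_succ (c : Config) (t : ℕ) :
    ((c.drawMax w + 1 : ℕ) : ENNReal) * c.pending w (t + 1) =
      ∑ r ∈ Finset.range (c.drawMax w + 1), (c.step w r).pending w t := by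
  rw [pending, runDist, PMF.toOuterMeasure_bind_apply,
    tsum_eq_sum (s := Finset.range (c.drawMax w + 1)), Finset.mul_sum]
  · refine Finset.sum_congr rfl fun r hr => ?_
    rw [PMF.uniformOfFinset_apply_of_mem _ hr, Finset.card_range, ← mul_assoc,
      ENNReal.mul_inv_cancel (by simp) (by simp), one_mul, pending]
  · intro r hr
    rw [PMF.uniformOfFinset_apply_of_notMem _ hr, zero_mul]

/-- The expected number of steps among the first `k`. -/
noncomputable def truncTime (w k : ℕ) (c : Config) : ENNReal :=
  ∑ t ∈ Finset.range k, c.pending w t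

theorem truncTime_le_succ (k : ℕ) (c : Config) : c.truncTime w k ≤ c.truncTime w (k + 1) := by
  rw [truncTime, truncTime, Finset.sum_range_succ]
  exact le_self_add

theorem Halted.truncTime_eq {c : Config} (h : c.Halted) (k : ℕ) : c.truncTime w k = 0 :=
  Finset.sum_eq_zero fun t _ => h.pending_eq t

theorem truncTime_succ_le (k : ℕ) (c : Config) :
    c.truncTime w (k + 1) ≤ 1 + ∑ t ∈ Finset.range k, c.pending w (t + 1) := by
  rw [truncTime, Finset.sum_range_succ', add_comm]
  gcongr
  exact pending_le_one 0 c

theorem mul_truncTime_succ_le (k : ℕ) (c : Config) :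
    ((c.drawMax w + 1 : ℕ) : ENNReal) * c.truncTime w (k + 1) ≤ ((c.drawMax w + 1 : ℕ) : ENNReal) +
      ∑ r ∈ Finset.range (c.drawMax w + 1), (c.step w r).truncTime w k := by
  refine (mul_le_mul_right (truncTime_succ_le k c) _).trans (le_of_eq ?_)
  rw [mul_add, mul_one, Finset.mul_sum, Finset.sum_congr rfl fun t _ => mul_pending_succ c t,
    Finset.sum_comm]
  rfl

/-- The horizon k is the same on both sides. This is generous, by monotonicity, and spares adjusting
it to the number of steps. -/
theorem truncTime_le_of_detSteps {t : ℕ} {c c' : Config} (h : DetSteps w t c c') (k : ℕ) :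
    c.truncTime w k ≤ t + c'.truncTime w k := by
  induction h with
  | zero => simp
  | @succ t c c' h _ ih =>
    refine (truncTime_le_succ k c).trans ((truncTime_succ_le k c).trans ?_)
    rw [Finset.sum_congr rfl fun t _ => pending_succ_of_drawMax_eq_zero h t, Nat.cast_succ,
      add_comm (t : ENNReal), add_assoc]
    gcongr
    exact ih

theorem expectedTime_le_of_truncTime_le {c : Config} {T : ENNReal} (h : ∀ k, c.truncTime w k ≤ T) :
    c.expectedTime w ≤ T := by
  rw [expectedTime, ENNReal.tsum_eq_iSup_nat]
  exact iSup_le h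

/-- All halted configurations that are reached after `t` steps have a state in `Q`. -/
def Safe (w : ℕ) (Q : State → Prop) (t : ℕ) (c : Config) : Prop :=
  ∀ C ∈ (c.runDist w t).support, C.Halted → Q C.st

variable {Q : State → Prop}

theorem mem_support_runDist_succ {t : ℕ} {c C : Config} :
    C ∈ (c.runDist w (t + 1)).support ↔
      ∃ r < c.drawMax w + 1, C ∈ ((c.step w r).runDist w t).support := by
  rw [runDist, PMF.mem_support_bind_iff]
  simp only [PMF.mem_support_uniformOfFinset_iff, Finset.mem_range]

theorem Halted.mem_support_succ {C : Config} (h : C.Halted) {t : ℕ} :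
    ∀ {c : Config}, C ∈ (c.runDist w t).support → C ∈ (c.runDist w (t + 1)).support := by
  induction t with
  | zero =>
    intro c hC
    obtain rfl : C = c := by simpa [runDist] using hC
    rw [runDist_succ_of_drawMax_eq_zero h.drawMax_eq, h.step_eq]
    exact hC
  | succ t ih =>
    intro c hC
    obtain ⟨r, hr, h'⟩ := mem_support_runDist_succ.1 hC
    exact mem_support_runDist_succ.2 ⟨r, hr, ih h'⟩

/-- Halted configurations persist, so safety at a later time implies safety at an earlier one.
Deterministic steps can then be prepended without changing the time. -/
theorem Safe.of_succ {t : ℕ} {c : Config} (h : c.Safe w Q (t + 1)) : c.Safe w Q t :=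
  fun C hC hh => h C (hh.mem_support_succ hC) hh

theorem Halted.safe {c : Config} (h : c.Halted) (hQ : Q c.st) (t : ℕ) : c.Safe w Q t := by
  induction t with
  | zero =>
    intro C hC _
    obtain rfl : C = c := by simpa [runDist] using hC
    exact hQ
  | succ t ih =>
    rw [Safe, runDist_succ_of_drawMax_eq_zero h.drawMax_eq, h.step_eq]
    exact ih

theorem safe_succ {t : ℕ} {c : Config} (h : ∀ r < c.drawMax w + 1, (c.step w r).Safe w Q t) :
    c.Safe w Q (t + 1) := fun C hC hh => by
  obtain ⟨r, hr, h'⟩ := mem_support_runDist_succ.1 hC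
  exact h r hr C h' hh

theorem safe_of_detSteps {n t : ℕ} {c c' : Config} (h : DetSteps w n c c') (hs : c'.Safe w Q t) :
    c.Safe w Q t := by
  induction h with
  | zero => exact hs
  | @succ n c c' h _ ih =>
    refine Safe.of_succ (safe_succ fun r hr => ?_)
    obtain rfl : r = 0 := by omega
    exact ih hs

/-- A computation that repeats rounds with independent random choices among `M` numbers, at least one
in `L` of which leads to the end. The rounds start in configurations in `S`, and take `A` steps. -/
structure Rounds (w M L A : ℕ) (S : Config → Prop) (Q : State → Prop) : Prop where
  not_halted : ∀ c, S c → ¬ c.Halted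
  exists_round : ∀ c, S c → ∃ t c', DetSteps w t c c' ∧ c'.drawMax w + 1 = M ∧
    ∃ good ⊆ Finset.range M, M ≤ L * good.card ∧ ∀ r < M, ∃ t' c'',
      DetSteps w t' (c'.step w r) c'' ∧ t + 1 + t' ≤ A ∧
        (S c'' ∧ r ∉ good ∨ c''.Halted ∧ Q c''.st)

variable {M L A : ℕ} {S : Config → Prop}

theorem Rounds.safe (h : Rounds w M L A S Q) (t : ℕ) : ∀ c, S c → c.Safe w Q t := by
  induction t with
  | zero =>
    intro c hc C hC hh
    obtain rfl : C = c := by simpa [runDist] using hC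
    exact absurd hh (h.not_halted C hc)
  | succ t ih =>
    intro c hc
    obtain ⟨n, c', h1, h2, good, -, -, h3⟩ := h.exists_round c hc
    refine safe_of_detSteps h1 (safe_succ fun r hr => ?_)
    obtain ⟨t', c'', h4, -, h5⟩ := h3 r (by omega)
    refine safe_of_detSteps h4 ?_
    rcases h5 with ⟨h5, -⟩ | ⟨h5, h6⟩
    · exact ih c'' h5
    · exact h5.safe h6 t

/-- The expectation T satisfies T ≤ A + (1 - 1/L) T, which suggests T ≤ L A. Since T might be
infinite, the times are truncated at k and the bound is proved by induction on k. -/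
theorem Rounds.truncTime_le (h : Rounds w M L A S Q) (k : ℕ) :
    ∀ c, S c → c.truncTime w k ≤ (L * A : ℕ) := by
  induction k with
  | zero => simp [truncTime]
  | succ k ih =>
    intro c hc
    obtain ⟨n, c', h1, h2, good, hsub, hcard, h3⟩ := h.exists_round c hc
    have hA : n + 1 ≤ A := by
      obtain ⟨t', c'', -, h5, -⟩ := h3 0 (by omega)
      omega
    have hM : (M : ENNReal) ≠ 0 := by simp; omega
    have key : ∀ r ∈ Finset.range M,
        (c'.step w r).truncTime w k ≤ ((A - (n + 1) + if r ∈ good then 0 else L * A : ℕ) : ENNReal) := by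
      intro r hr
      obtain ⟨t', c'', h4, h5, h6⟩ := h3 r (Finset.mem_range.1 hr)
      refine (truncTime_le_of_detSteps h4 k).trans ?_
      rcases h6 with ⟨h6, h7⟩ | ⟨h6, -⟩
      · rw [if_neg h7, Nat.cast_add]
        gcongr
        · omega
        · exact ih c'' h6
      · rw [h6.truncTime_eq, add_zero]
        exact_mod_cast (show t' ≤ A - (n + 1) by omega).trans (Nat.le_add_right _ _)
    -- After multiplication by M: a round costs at most M A in total, the bad draws contribute (M -
    -- |good|) L A, and M ≤ L |good| makes the sum at most M L A.
    have hnat : M * n + (M + ∑ r ∈ Finset.range M, (A - (n + 1) + if r ∈ good then 0 else L * A)) ≤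
        M * (L * A) := by
      have h4 : ∑ r ∈ Finset.range M, (if r ∈ good then 0 else L * A) =
          (M - good.card) * (L * A) := by
        rw [Finset.sum_ite, Finset.sum_const_zero, zero_add, Finset.sum_const, smul_eq_mul,
          Finset.filter_not, Finset.filter_mem_eq_inter, Finset.inter_eq_right.2 hsub,
          Finset.card_sdiff_of_subset hsub, Finset.card_range]
      obtain ⟨A', rfl⟩ : ∃ A', A = n + 1 + A' := ⟨A - (n + 1), by omega⟩
      have hle : good.card ≤ M := by simpa using Finset.card_le_card hsub
      obtain ⟨x, hx⟩ : ∃ x, M = good.card + x := ⟨M - good.card, by omega⟩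
      rw [Finset.sum_add_distrib, h4, Finset.sum_const, Finset.card_range, smul_eq_mul,
        Nat.add_sub_cancel_left]
      have h5 : M - good.card = x := by omega
      rw [h5]
      calc M * n + (M + (M * A' + x * (L * (n + 1 + A'))))
          = M * (n + 1 + A') + x * (L * (n + 1 + A')) := by ring
        _ ≤ (L * good.card) * (n + 1 + A') + x * (L * (n + 1 + A')) := by gcongr
        _ = (good.card + x) * (L * (n + 1 + A')) := by ring
        _ = _ := by rw [← hx]
    refine (ENNReal.mul_le_mul_iff_right hM (by simp)).1 ?_
    calc (M : ENNReal) * c.truncTime w (k + 1)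
        ≤ M * (n + c'.truncTime w (k + 1)) := by gcongr; exact truncTime_le_of_detSteps h1 _
      _ = M * n + M * c'.truncTime w (k + 1) := mul_add _ _ _
      _ ≤ M * n + (M + ∑ r ∈ Finset.range M, (c'.step w r).truncTime w k) := by
        gcongr
        have := mul_truncTime_succ_le (w := w) k c'
        rwa [h2] at this
      _ ≤ M * n + (M + ∑ r ∈ Finset.range M,
          ((A - (n + 1) + if r ∈ good then 0 else L * A : ℕ) : ENNReal)) := by
        gcongr with r hr
        exact key r hr
      _ ≤ M * (L * A : ℕ) := by exact_mod_cast hnat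

end Config

/-! ## Exactness of the programs -/

theorem falseConst_le_cellBound (d n : ℕ) : (falseConst d : ℤ) ≤ cellBound d n := by
  refine le_trans ?_ (two_pow_le_cellBound (k := d + 5) (by omega))
  have : d + 1 ≤ 2 ^ d := Nat.lt_two_pow_self
  have : falseConst d ≤ 2 ^ (d + 5) := by unfold falseConst; rw [pow_add]; omega
  exact_mod_cast this

theorem prover_exact (d n : ℕ) : (prover d).Exact (cellBound d n) := by
  have hlit : ∀ z : ℤ, z ≤ 2 ^ 120 → z ≤ cellBound d n := fun z => le_cellBound_of_le
  simp [prover, paramsCmd, roundCmd, attemptCmd, emitCmd, bucketCmd, scanStep, forLoop, Cmd.Exact,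
    falseConst_le_cellBound, hlit]

theorem countCmd_exact (d n : ℕ) : countCmd.Exact (cellBound d n) := by
  have hlit : ∀ z : ℤ, z ≤ 2 ^ 120 → z ≤ cellBound d n := fun z => le_cellBound_of_le
  simp [countCmd, scaleCmd, sqrtCmd, rootCmd, twiddleCmd, histCmd, stageCmd, fftCmd, sumCmd, forLoop,
    Cmd.Exact, hlit]

theorem verifier_exact (d n : ℕ) : (verifier d).Exact (cellBound d n) := by
  have hlit : ∀ z : ℤ, z ≤ 2 ^ 120 → z ≤ cellBound d n := fun z => le_cellBound_of_le
  simp [verifier, paramsCmd, headCmd, listCmd, compareCmd, forLoop, Cmd.Exact,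
    falseConst_le_cellBound, countCmd_exact, hlit]

theorem verifier_deterministic (d : ℕ) : (verifier d).Deterministic := by
  simp [verifier, paramsCmd, headCmd, listCmd, compareCmd, countCmd, scaleCmd, sqrtCmd, rootCmd,
    twiddleCmd, histCmd, stageCmd, fftCmd, sumCmd, forLoop, Cmd.Deterministic]

/-! ## The start configuration -/

/-- The number of words of `lg n` bits in a machine word. -/
def wordFactor (d : ℕ) : ℕ := 8 * (d + 140) + 2

theorem two_le_cellBound (d n : ℕ) : 2 ≤ cellBound d n := le_cellBound_of_le (by norm_num)

/-- The word length is chosen such that 2^w = B^8 X², and X² ≥ 4. -/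
theorem cellBound_pow_lt (d n : ℕ) : 2 * cellBound d n ^ 8 < 2 ^ (wordFactor d * lg n) := by
  have h2 : (2 : ℤ) ≤ 2 ^ lg n := by exact_mod_cast two_le_two_pow_lg n
  have hB : 0 < cellBound d n ^ 8 := pow_pos (by have := two_le_cellBound d n; omega) _
  have : (2 : ℤ) ^ (wordFactor d * lg n) = cellBound d n ^ 8 * (2 ^ lg n) ^ 2 := by
    rw [cellBound, ← pow_mul, ← pow_add, ← pow_mul, wordFactor]
    ring
  rw [this]
  have : (4 : ℤ) ≤ (2 ^ lg n) ^ 2 := by nlinarith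
  nlinarith

theorem two_mul_lt_of_le_cellBound {d n : ℕ} {z : ℤ} (h : |z| ≤ cellBound d n) :
    2 * |z| < 2 ^ (wordFactor d * lg n) := by
  have h1 := two_le_cellBound d n
  have h2 : cellBound d n ^ 1 ≤ cellBound d n ^ 8 := pow_le_pow_right₀ (by omega) (by norm_num)
  have := cellBound_pow_lt d n
  rw [pow_one] at h2
  omega

theorem arrayOf_natCast {w : ℕ} {l : List ℤ} {i : ℕ} (h : 2 * |l.getD i 0| < 2 ^ w) :
    arrayOf w l i = l.getD i 0 := by
  simp only [arrayOf, Int.natCast_nonneg, if_true, Int.toNat_natCast]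
  exact wrap_eq_self h

/-- A finite sequence, continued by zeros. -/
def extend {n : ℕ} (f : Fin n → ℤ) (i : ℕ) : ℤ := if h : i < n then f ⟨i, h⟩ else 0

theorem getD_ofFn {n : ℕ} (f : Fin n → ℤ) (i : ℕ) : (List.ofFn f).getD i 0 = extend f i := by
  by_cases h : i < n <;> simp [extend, h, List.getD_eq_getElem?_getD]

section
variable {d n : ℕ} {f : Fin n → ℤ} (hf : ∀ i, |f i| < 2 ^ (d * (Nat.log 2 n + 1)))
include hf

theorem abs_extend_le (i : ℕ) : |extend f i| ≤ (2 ^ lg n) ^ d := by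
  unfold extend
  split
  · rw [← pow_mul, mul_comm]
    exact (hf _).le
  · simp

theorem arrayOf_ofFn (i : ℕ) : arrayOf (wordFactor d * lg n) (List.ofFn f) i = extend f i := by
  rw [← getD_ofFn]
  refine arrayOf_natCast (two_mul_lt_of_le_cellBound ?_)
  rw [getD_ofFn]
  exact (abs_extend_le hf i).trans (pow_le_cellBound (by omega))

theorem abs_arrayOf_ofFn_le (i : ℤ) :
    |arrayOf (wordFactor d * lg n) (List.ofFn f) i| ≤ cellBound d n := by
  rcases le_or_gt 0 i with h | h
  · obtain ⟨j, rfl⟩ := Int.eq_ofNat_of_zero_le h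
    rw [arrayOf_ofFn hf]
    exact (abs_extend_le hf j).trans (pow_le_cellBound (by omega))
  · have := two_le_cellBound d n
    simp [arrayOf, not_le.2 h]
    omega

end

section
variable {d n : ℕ} (I : ThreeSumInstance d n) (p : Cmd) (π : List ℤ)

theorem hasZeroSum_iff : HasZeroSum n (extend I.a) (extend I.b) (extend I.c) ↔ I.HasZeroTriple := by
  constructor
  · rintro ⟨i, hi, j, hj, k, hk, h⟩
    exact ⟨⟨i, hi⟩, ⟨j, hj⟩, ⟨k, hk⟩, by simpa [extend, hi, hj, hk] using h⟩
  · rintro ⟨i, j, k, h⟩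
    exact ⟨i, i.2, j, j.2, k, k.2, by simpa [extend] using h⟩

theorem start_reg_zero : (I.start (wordFactor d * lg n) p π).st.reg 0 = n := by
  have hn : |(n : ℤ)| ≤ cellBound d n := by
    rw [abs_of_nonneg (by positivity)]
    exact natCast_le_cellBound (k := 1) (by rw [pow_one]; exact (lt_two_pow_lg n).le) (by omega)
  exact wrap_eq_self (two_mul_lt_of_le_cellBound hn)

theorem start_hasInput : HasInput n (extend I.a) (extend I.b) (extend I.c)
    (I.start (wordFactor d * lg n) p π).st :=
  ⟨fun i _ => arrayOf_ofFn I.a_lt i, fun i _ => arrayOf_ofFn I.b_lt i,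
    fun i _ => arrayOf_ofFn I.c_lt i⟩

theorem start_bdd : (I.start (wordFactor d * lg n) p π).st.Bdd (cellBound d n) := by
  have h2 := two_le_cellBound d n
  refine ⟨fun x => ?_, fun k hk i => ?_⟩
  · by_cases hx : x = 0
    · rw [hx, start_reg_zero, abs_of_nonneg (by positivity)]
      exact natCast_le_cellBound (k := 1) (by rw [pow_one]; exact (lt_two_pow_lg n).le) (by omega)
    · simp [ThreeSumInstance.start, hx]
      omega
  · simp only [ThreeSumInstance.start, hk, if_false]
    split_ifs
    · exact abs_arrayOf_ofFn_le I.a_lt i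
    · exact abs_arrayOf_ofFn_le I.b_lt i
    · exact abs_arrayOf_ofFn_le I.c_lt i
    · simp
      omega

/-! ## The verifier on the machine -/

theorem Config.run_eq_of_halted {w t t' : ℕ} {c : Config} (h : (c.run w t).Halted) (ht : t ≤ t') :
    c.run w t' = c.run w t := by
  obtain ⟨k, rfl⟩ := Nat.exists_eq_add_of_le' ht
  rw [Config.run, Function.iterate_add_apply]
  exact h.run_eq k

theorem verifier_run : ∃ t ≤ verifierTime d n, ∃ v,
    ((I.start (wordFactor d * lg n) (verifier d) π).run (wordFactor d * lg n) t).Halted ∧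
    ((I.start (wordFactor d * lg n) (verifier d) π).run (wordFactor d * lg n) t).st.out = [v] ∧
    (v = 1 ↔ ProofOk d n (extend I.a) (extend I.b) (extend I.c)
      (arrayOf (wordFactor d * lg n) π)) := by
  obtain ⟨t, ht, s', he, v, hv, hiff⟩ := verifier_spec (start_reg_zero I (verifier d) π)
    (start_hasInput I (verifier d) π) (fun k hk i => by
      simp [ThreeSumInstance.start, show k ≠ 0 by omega, show k ≠ 1 by omega, show k ≠ 2 by omega,
        show k ≠ 3 by omega])
    (fun i _ => abs_extend_le I.a_lt i) (fun i _ => abs_extend_le I.b_lt i)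
    (fun i _ => abs_extend_le I.c_lt i)
  have hr : (I.start (wordFactor d * lg n) (verifier d) π).run (wordFactor d * lg n) t = ⟨[], s'⟩ :=
    (he.detSteps (two_le_cellBound d n) (cellBound_pow_lt d n) (start_bdd I _ π)
    (verifier_exact d n) []).run_eq
  refine ⟨t, ht, v, ?_, ?_, hiff⟩
  · rw [hr]
    rfl
  · rw [hr]
    simpa [ThreeSumInstance.start] using hv

/-- A halted run no longer changes, so its output does not depend on the halting time at which it is
read. -/
theorem accepts_iff : I.Accepts (wordFactor d * lg n) (verifier d) π ↔
    ProofOk d n (extend I.a) (extend I.b) (extend I.c) (arrayOf (wordFactor d * lg n) π) := by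
  obtain ⟨t, -, v, h1, h2, h3⟩ := verifier_run I π
  rw [← h3]
  constructor
  · rintro ⟨t', h4, h5⟩
    rcases le_total t t' with h | h
    · rw [Config.run_eq_of_halted h1 h, h2] at h5
      simpa using h5
    · rw [Config.run_eq_of_halted h4 h, h5] at h2
      simpa using h2.symm
  · rintro rfl
    exact ⟨t, h1, h2⟩

theorem verifier_halts :
    ((I.start (wordFactor d * lg n) (verifier d) π).run (wordFactor d * lg n)
      (verifierTime d n)).Halted := by
  obtain ⟨t, ht, v, h1, -⟩ := verifier_run I π
  rwa [Config.run_eq_of_halted h1 ht]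

theorem verifier_sound (h : I.HasZeroTriple) :
    ¬ I.Accepts (wordFactor d * lg n) (verifier d) π := by
  rw [accepts_iff]
  intro hp
  obtain ⟨i, hi, j, hj, k, hk, h0⟩ := (hasZeroSum_iff I).2 h
  exact hp.sum_ne_zero hi hj hk h0

end

/-! ## The prover on the machine -/

/-- The proof string of a successful prover. -/
theorem proofOk_arrayOf {d n m l : ℕ} {a b c q : ℕ → ℤ} (hm : 0 < m) (hmM : m ≤ modBound n)
    (hl : l ≤ falseBound d n) (hs : ∀ t < l, StepOk n m a b c q t) (ht : tripleCount n m a b c = l) :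
    ProofOk d n a b c (arrayOf (wordFactor d * lg n) ((m : ℤ) :: (l : ℤ) :: (List.range l).map q)) := by
  have hX := lt_two_pow_lg n
  have hn3B : ((n * n * n : ℕ) : ℤ) ≤ cellBound d n :=
    natCast_le_cellBound (k := 3) (by rw [pow_succ, sq]; gcongr) (by omega)
  have hmB : (m : ℤ) ≤ cellBound d n :=
    natCast_le_cellBound (hmM.trans (modBound_le n)) (by omega)
  have hlB : (l : ℤ) ≤ cellBound d n :=
    natCast_le_cellBound (hl.trans (falseBound_le d n)) (by omega)
  have hmono := StepOk.strictMono hs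
  have key : ∀ t < l, arrayOf (wordFactor d * lg n) ((m : ℤ) :: (l : ℤ) :: (List.range l).map q)
      ((t : ℤ) + 2) = q t := by
    intro t ht
    have hg : ((m : ℤ) :: (l : ℤ) :: (List.range l).map q).getD (t + 2) 0 = q t := by
      simp [List.getD_eq_getElem?_getD, ht]
    have := arrayOf_natCast (w := wordFactor d * lg n) (i := t + 2)
      (l := (m : ℤ) :: (l : ℤ) :: (List.range l).map q) ?_
    · rw [hg] at this
      exact_mod_cast this
    · rw [hg]
      refine two_mul_lt_of_le_cellBound ?_
      rw [abs_of_nonneg (hmono t ht).1]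
      have := (hs t ht).2.1
      push_cast at hn3B
      omega
  refine ⟨m, l, ?_, ?_, hm, hmM, hl, fun t ht => ?_, ht⟩
  · have := arrayOf_natCast (w := wordFactor d * lg n) (i := 0)
      (l := (m : ℤ) :: (l : ℤ) :: (List.range l).map q)
      (two_mul_lt_of_le_cellBound (by simpa using hmB))
    simpa using this
  · have := arrayOf_natCast (w := wordFactor d * lg n) (i := 1)
      (l := (m : ℤ) :: (l : ℤ) :: (List.range l).map q)
      (two_mul_lt_of_le_cellBound (by simpa using hlB))
    simpa using this
  · obtain ⟨h1, h2⟩ := hs t ht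
    unfold StepOk
    beta_reduce
    rw [key t ht]
    refine ⟨?_, h2⟩
    cases t with
    | zero => exact h1
    | succ t =>
      simp only [minNext]
      rw [key t (by omega)]
      exact h1

/-- The configurations of the prover before a round. -/
def RoundStart (d n : ℕ) (a b c : ℕ → ℤ) (C : Config) : Prop :=
  C.todo = [loop (equal (reg 40) 0) roundCmd, emitCmd] ∧ C.st.reg 40 = 0 ∧ HasParams d n C.st ∧
    HasInput n a b c C.st ∧ C.st.out = [] ∧ C.st.Bdd (cellBound d n)

/-- The output is a proof string that the verifier accepts, unless there is a triple with sum zero. -/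
def OutputOk (d n : ℕ) (a b c : ℕ → ℤ) (s : State) : Prop :=
  ¬ HasZeroSum n a b c → ProofOk d n a b c (arrayOf (wordFactor d * lg n) s.out)

theorem detSteps_loop_true {B : ℤ} {w : ℕ} (hB : 2 ≤ B) (hw : 2 * B ^ 8 < 2 ^ w) {s : State}
    (hs : s.Bdd B) {e : Expr} (he : e.Exact B) (h : e.val s ≠ 0) (p : Cmd) (K : List Cmd) :
    DetSteps w 1 ⟨loop e p :: K, s⟩ ⟨p :: loop e p :: K, s⟩ := by
  have := DetSteps.one (w := w) (c := ⟨loop e p :: K, s⟩) rfl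
  simpa only [Config.step, (Expr.eval_eq_val hB hw hs e he).1, h, ne_eq, not_false_eq_true,
    if_true] using this

/-- The only draw of a round is its choice of a modulus, and the good draws are those with fewer
than F false positives; a factor 16 lg n suffices by `modBound_le_mul_card_good`. The time of a
round includes the output in case of success. -/
theorem prover_rounds {d n : ℕ} {a b c : ℕ → ℤ} (ha : ∀ i < n, |a i| ≤ (2 ^ lg n) ^ d)
    (hb : ∀ i < n, |b i| ≤ (2 ^ lg n) ^ d) (hc : ∀ i < n, |c i| ≤ (2 ^ lg n) ^ d) :
    Config.Rounds (wordFactor d * lg n) (modBound n) (16 * lg n)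
      (attemptTime d n + 4 * falseBound d n + 12) (RoundStart d n a b c) (OutputOk d n a b c) := by
  have hB := two_le_cellBound d n
  have hw := cellBound_pow_lt d n
  have hlit : ∀ z : ℤ, z ≤ 2 ^ 120 → z ≤ cellBound d n := fun z => le_cellBound_of_le
  have hM : 0 < modBound n := Nat.succ_pos _
  have hMB : (modBound n : ℤ) ≤ cellBound d n := natCast_le_cellBound (modBound_le n) (by omega)
  have hexact := prover_exact d n
  obtain ⟨-, -, ⟨hcond, hround⟩, hemit⟩ := hexact
  have hatt := hround.2
  constructor
  · rintro C ⟨h, -⟩ hh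
    rw [Config.Halted, h] at hh
    cases hh
  · rintro ⟨-, s⟩ ⟨rfl, h40, hp, hi, hout, hbdd⟩
    simp only at h40 hp hi hout hbdd
    have st1 := detSteps_loop_true hB hw hbdd hcond (by simp [h40]) roundCmd [emitCmd]
    have st2 : DetSteps (wordFactor d * lg n) 1
        ⟨[roundCmd, loop (equal (reg 40) 0) roundCmd, emitCmd], s⟩
        ⟨[rand 6 (reg 4 - 1), attemptCmd, loop (equal (reg 40) 0) roundCmd, emitCmd], s⟩ :=
      DetSteps.one rfl
    refine ⟨_, _, st1.trans st2, ?_, (Finset.range (modBound n)).filter fun r =>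
      (falsePositives n (r + 1) a b c).card < falseBound d n, Finset.filter_subset _ _,
      modBound_le_mul_card_good ha hb hc, fun r hr => ?_⟩
    -- The register holds M ≥ 1, so the draw is from {0, …, M - 1} and has exactly M outcomes.
    · have hev : (reg 4 - 1 : Expr).eval (wordFactor d * lg n) s = modBound n - 1 := by
        rw [(Expr.eval_eq_val hB hw hbdd _ (by simp [hlit])).1]
        simp [hp.r4]
      simp only [Config.drawMax, hev]
      omega
    · simp only [Config.step]
      have hσ : (⟨Function.update s.reg 6 (r : ℤ), s.arr, s.out⟩ : State) = s.setReg 6 r := rfl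
      rw [hσ]
      have hσb : (s.setReg 6 r).Bdd (cellBound d n) := by
        refine ⟨fun x => ?_, hbdd.2⟩
        rw [State.setReg_reg]
        split
        · rw [abs_of_nonneg (Int.natCast_nonneg r)]
          omega
        · exact hbdd.1 x
      have hσi : HasInput n a b c (s.setReg 6 r) := ⟨hi.a0, hi.a1, hi.a2⟩
      obtain ⟨t, ht, s', he, hor⟩ := attemptCmd_spec (hp.setReg (x := 6) (v := r)) hσi
        (r := r) (by simp) hr (by simp [h40])
      have st3 := he.detSteps hB hw hσb hatt [loop (equal (reg 40) 0) roundCmd, emitCmd]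
      have hb' := he.bdd hσb
      have hsame := he.same
      have hout' : s'.out = [] := by rw [hsame.out rfl]; exact hout
      rcases hor with ⟨g40, hbad⟩ | ⟨g40, hgood⟩
      · refine ⟨t, _, st3, by omega, .inl ⟨⟨rfl, g40, (hp.setReg).of_same hsame,
          hσi.of_same hsame, hout', hb'⟩, ?_⟩⟩
        simp [hbad]
      · obtain ⟨m, l, h6, h44, hm, hmM, hl, hres⟩ := hgood
        obtain ⟨t', ht', s'', he', hq⟩ := emitCmd_spec (d := d) (n := n) h44 hl
        have st4 := (Exec.loop_false (B := cellBound d n) (e := equal (reg 40) 0) (p := roundCmd)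
          (s := s') (by simp [g40])).detSteps hB hw hb' ⟨hcond, hround⟩ [emitCmd]
        have st5 := he'.detSteps hB hw hb' hemit []
        refine ⟨_, _, (st3.trans st4).trans st5, by omega, .inr ⟨rfl, fun hz => ?_⟩⟩
        obtain ⟨h1, h2⟩ := hres hz
        change ProofOk d n a b c (arrayOf _ s''.out)
        rw [hq, hout', h6]
        refine proofOk_arrayOf hm hmM hl (fun t ht => ?_) h1
        obtain ⟨g1, g2, g3⟩ := h2 t ht
        obtain ⟨g4, g5⟩ := Finset.mem_filter.1 g3
        refine ⟨g1, by exact_mod_cast g2, g5, fun h0 => hz ?_⟩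
        obtain ⟨d1, d2, d3⟩ := code_div_lt (Finset.mem_range.1 g4)
        exact ⟨_, d1, _, d2, _, d3, h0⟩

/-- The bound for the expected running time of the prover. -/
def proverTime (d n : ℕ) : ℕ :=
  40 * modBound n * lg n + 4 + 16 * lg n * (attemptTime d n + 4 * falseBound d n + 12)

section
variable {d n : ℕ} (I : ThreeSumInstance d n)

theorem prover_start : ∃ t ≤ 40 * modBound n * lg n + 4, ∃ C,
    DetSteps (wordFactor d * lg n) t (I.start (wordFactor d * lg n) (prover d) []) C ∧
    RoundStart d n (extend I.a) (extend I.b) (extend I.c) C := by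
  have hB := two_le_cellBound d n
  have hw := cellBound_pow_lt d n
  have hi := start_hasInput I (prover d) []
  have hbdd := start_bdd I (prover d) []
  obtain ⟨t, ht, s, he, hp⟩ := paramsCmd_spec d n _ (start_reg_zero I (prover d) [])
  have hexact := prover_exact d n
  have st1 : DetSteps (wordFactor d * lg n) 1 (I.start (wordFactor d * lg n) (prover d) [])
    ⟨[paramsCmd d, _], _⟩ := DetSteps.one rfl
  have st2 := he.detSteps hB hw hbdd hexact.1
    [.seq (assign 40 0) (.seq (loop (equal (reg 40) 0) roundCmd) emitCmd)]
  have st3 : DetSteps (wordFactor d * lg n) 1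
    ⟨[.seq (assign 40 0) (.seq (loop (equal (reg 40) 0) roundCmd) emitCmd)], s⟩
    ⟨[assign 40 0, .seq (loop (equal (reg 40) 0) roundCmd) emitCmd], s⟩ := DetSteps.one rfl
  have he4 : Exec (cellBound d n) (assign 40 0) s 1 (s.setReg 40 0) :=
    .assign s 40 0 (by simp; omega)
  have st4 := he4.detSteps hB hw (he.bdd hbdd) hexact.2.1
    [.seq (loop (equal (reg 40) 0) roundCmd) emitCmd]
  have st5 : DetSteps (wordFactor d * lg n) 1
    ⟨[.seq (loop (equal (reg 40) 0) roundCmd) emitCmd], s.setReg 40 0⟩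
    ⟨[loop (equal (reg 40) 0) roundCmd, emitCmd], s.setReg 40 0⟩ := DetSteps.one rfl
  have hi' := hi.of_same he.same
  refine ⟨_, ?_, _, st1.trans (st2.trans (st3.trans (st4.trans st5))), rfl, by simp, hp.setReg,
    ⟨hi'.a0, hi'.a1, hi'.a2⟩, ?_, he4.bdd (he.bdd hbdd)⟩
  · omega
  · change s.out = []
    rw [he.same.out rfl]
    rfl

theorem prover_expectedTime :
    (I.start (wordFactor d * lg n) (prover d) []).expectedTime (wordFactor d * lg n) ≤
      (proverTime d n : ENNReal) := by
  obtain ⟨t, ht, C, hst, hC⟩ := prover_start I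
  refine Config.expectedTime_le_of_truncTime_le fun k => ?_
  have := (prover_rounds (fun i _ => abs_extend_le I.a_lt i) (fun i _ => abs_extend_le I.b_lt i)
    (fun i _ => abs_extend_le I.c_lt i)).truncTime_le k C hC
  refine (Config.truncTime_le_of_detSteps hst k).trans ((add_le_add_right this _).trans ?_)
  rw [← Nat.cast_add]
  exact_mod_cast Nat.add_le_add_right ht _

theorem prover_complete (h : ¬ I.HasZeroTriple) (t : ℕ) (C : Config)
    (hC : C ∈ ((I.start (wordFactor d * lg n) (prover d) []).runDist (wordFactor d * lg n) t).support)
    (hh : C.Halted) : I.Accepts (wordFactor d * lg n) (verifier d) C.st.out := by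
  obtain ⟨t', -, C', hst, hC'⟩ := prover_start I
  have := (prover_rounds (fun i _ => abs_extend_le I.a_lt i) (fun i _ => abs_extend_le I.b_lt i)
    (fun i _ => abs_extend_le I.c_lt i)).safe t C' hC'
  rw [accepts_iff]
  exact Config.safe_of_detSteps hst this C hC hh (fun hz => h ((hasZeroSum_iff I).1 hz))

end

/-! ## Asymptotics -/

/-- For n ≥ 3 one has log n ≥ 1, so lg n ≤ log n / log 2 + 1 ≤ 3 log n. Likewise `sqrtUp n` is less
than √n + 1 unless it is at most 1, hence at most 2 √n. -/
theorem parameter_bounds {n : ℕ} (hn : 3 ≤ n) : 1 ≤ Real.log n ∧ 1 ≤ √(n : ℝ) ∧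
    (lg n : ℝ) ≤ 3 * Real.log n ∧ (sqrtUp n : ℝ) ≤ 2 * √(n : ℝ) := by
  have hn' : (3 : ℝ) ≤ n := by exact_mod_cast hn
  have hlog : 1 ≤ Real.log n := by
    rw [Real.le_log_iff_exp_le (by linarith)]
    linarith [Real.exp_one_lt_d9]
  have hsqrt : 1 ≤ √(n : ℝ) := Real.one_le_sqrt.2 (by linarith)
  refine ⟨hlog, hsqrt, ?_, ?_⟩
  · have h1 : (Nat.log 2 n : ℝ) * Real.log 2 ≤ Real.log n := by
      rw [← Real.log_pow]
      refine Real.log_le_log (by positivity) ?_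
      exact_mod_cast Nat.pow_log_le_self 2 (by omega)
    have h2 := Real.log_two_gt_d9
    have h3 : (0 : ℝ) ≤ Nat.log 2 n := Nat.cast_nonneg _
    unfold lg
    push_cast
    nlinarith
  · by_contra hlt
    have h1 : 1 < sqrtUp n := by
      have : (1 : ℝ) < sqrtUp n := by linarith
      exact_mod_cast this
    obtain ⟨t, ht⟩ : ∃ t, sqrtUp n = t + 1 := ⟨sqrtUp n - 1, by omega⟩
    have h2 : (t * t : ℝ) < n := by
      exact_mod_cast mul_self_lt_of_lt_sqrtUp (show t < sqrtUp n by omega)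
    rw [ht] at hlt
    push_cast at hlt
    have h3 := Real.lt_sqrt_of_sq_lt (show (t : ℝ) ^ 2 < n by rwa [sq])
    linarith

theorem isSoftO_of_le {f : ℕ → ℕ} {g : ℕ → ℝ} (hg : ∀ n, 0 ≤ g n) (K : ℝ) (k : ℕ)
    (h : ∀ n : ℕ, 3 ≤ n → (f n : ℝ) ≤ K * (g n * Real.log n ^ k)) :
    IsSoftO (fun n => (f n : ℝ)) g := by
  refine ⟨k, IsBigO.of_bound K ?_⟩
  filter_upwards [eventually_ge_atTop 3] with n hn
  have := (parameter_bounds hn).1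
  rw [Real.norm_of_nonneg (Nat.cast_nonneg _), Real.norm_of_nonneg (mul_nonneg (hg n) (by positivity))]
  exact h n hn

theorem verifierTime_isSoftO (d : ℕ) :
    IsSoftO (fun n => (verifierTime d n : ℝ)) fun n => (n : ℝ) ^ (3 / 2 : ℝ) := by
  -- Two of the four logarithms come from F and two from the factor (lg n)²; the latter turn the
  -- constant 10000 into 90000.
  refine isSoftO_of_le (fun n => by positivity) (90000 * (18 * falseConst d + 4)) 4 fun n hn => ?_
  obtain ⟨h1, h2, h3, h4⟩ := parameter_bounds hn
  have hx : (1 : ℝ) ≤ n := by exact_mod_cast (show 1 ≤ n by omega)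
  have hpow : (n : ℝ) ^ (3 / 2 : ℝ) = n * √(n : ℝ) := by
    rw [Real.sqrt_eq_rpow, show (3 / 2 : ℝ) = 1 + 1 / 2 by norm_num, Real.rpow_add (by linarith),
      Real.rpow_one]
  rw [hpow]
  set x : ℝ := (n : ℝ)
  set r := √x
  set y := Real.log x
  have hy2 : 1 ≤ y ^ 2 := one_le_pow₀ h1
  have hxr : 1 ≤ x * r := one_le_mul_of_one_le_of_one_le hx h2
  have hxry : x * r ≤ x * r * y ^ 2 := le_mul_of_one_le_right (by linarith) hy2
  have hfalse : (falseBound d n : ℝ) ≤ 18 * falseConst d * (x * r * y ^ 2) + x * r * y ^ 2 := by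
    unfold falseBound
    push_cast
    have : (falseConst d : ℝ) * x * sqrtUp n * lg n * lg n ≤
        falseConst d * x * (2 * r) * (3 * y) * (3 * y) := by gcongr
    have e : (falseConst d : ℝ) * x * (2 * r) * (3 * y) * (3 * y) =
      18 * falseConst d * (x * r * y ^ 2) := by ring
    linarith
  have hmod : (modBound n : ℝ) ≤ 3 * (x * r * y ^ 2) := by
    unfold modBound
    push_cast
    have : x * sqrtUp n ≤ x * (2 * r) := by gcongr
    linarith
  unfold verifierTime
  push_cast
  calc 10000 * ((falseBound d n : ℝ) + modBound n) * lg n * lg n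
      ≤ 10000 * ((18 * falseConst d * (x * r * y ^ 2) + x * r * y ^ 2) + 3 * (x * r * y ^ 2)) *
        (3 * y) * (3 * y) := by gcongr
    _ = _ := by ring

theorem proverTime_isSoftO (d : ℕ) :
    IsSoftO (fun n => (proverTime d n : ℝ)) fun n => (n : ℝ) ^ 2 := by
  -- Two of the three logarithms come from F and one from the expected number of rounds.
  refine isSoftO_of_le (fun n => by positivity)
    (40 * 2 * 3 + 4 + 48 * (100 * (4 + 9 * falseConst d) + 4 * (9 * falseConst d + 1) + 12)) 3
    fun n hn => ?_
  obtain ⟨h1, -, h3, -⟩ := parameter_bounds hn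
  have hx : (1 : ℝ) ≤ n := by exact_mod_cast (show 1 ≤ n by omega)
  have hs : (sqrtUp n : ℝ) ≤ n := by exact_mod_cast sqrtUp_le n
  set x : ℝ := (n : ℝ)
  set y := Real.log x
  have hx2 : 1 ≤ x ^ 2 := one_le_pow₀ hx
  have hy2 : 1 ≤ y ^ 2 := one_le_pow₀ h1
  have hxy : x ^ 2 ≤ x ^ 2 * y ^ 2 := le_mul_of_one_le_right (by linarith) hy2
  have hxy3 : x ^ 2 * y ^ 2 ≤ x ^ 2 * y ^ 3 := by
    gcongr
    norm_num
  have hfalse : (falseBound d n : ℝ) ≤ (9 * falseConst d + 1) * (x ^ 2 * y ^ 2) := by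
    unfold falseBound
    push_cast
    have : (falseConst d : ℝ) * x * sqrtUp n * lg n * lg n ≤
        falseConst d * x * x * (3 * y) * (3 * y) := by gcongr
    have e : (falseConst d : ℝ) * x * x * (3 * y) * (3 * y) =
      9 * falseConst d * (x ^ 2 * y ^ 2) := by ring
    linarith
  have hmod : (modBound n : ℝ) ≤ 2 * (x ^ 2 * y ^ 2) := by
    unfold modBound
    push_cast
    have : x * sqrtUp n ≤ x * x := by gcongr
    linarith
  have hatt : (attemptTime d n : ℝ) ≤ 100 * (4 + 9 * falseConst d) * (x ^ 2 * y ^ 2) := by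
    unfold attemptTime
    push_cast
    linarith
  unfold proverTime
  push_cast
  calc 40 * (modBound n : ℝ) * lg n + 4 +
        16 * lg n * (attemptTime d n + 4 * falseBound d n + 12)
      ≤ 40 * (2 * (x ^ 2 * y ^ 2)) * (3 * y) + 4 * (x ^ 2 * y ^ 3) +
        16 * (3 * y) * (100 * (4 + 9 * falseConst d) * (x ^ 2 * y ^ 2) +
          4 * ((9 * falseConst d + 1) * (x ^ 2 * y ^ 2)) + 12 * (x ^ 2 * y ^ 2)) := by
        gcongr
        · linarith
        · linarith
    _ = _ := by ring

end WordRAM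

theorem mainTheorem4 (d : ℕ) :
    ∃ (κ : ℕ) (V P : WordRAM.Cmd) (TV TP : ℕ → ℕ),
      V.Deterministic ∧
      IsSoftO (fun n => (TV n : ℝ)) (fun n => (n : ℝ) ^ (3 / 2 : ℝ)) ∧
      IsSoftO (fun n => (TP n : ℝ)) (fun n => (n : ℝ) ^ 2) ∧
      ∀ (n w : ℕ), w = κ * (Nat.log 2 n + 1) → ∀ I : ThreeSumInstance d n,
        -- the verifier's running time, on every proof string
        (∀ π : List ℤ, ((I.start w V π).run w (TV n)).Halted) ∧
        -- soundness
        (I.HasZeroTriple → ∀ π : List ℤ, ¬ I.Accepts w V π) ∧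
        -- the prover's expected running time
        (I.start w P []).expectedTime w ≤ (TP n : ENNReal) ∧
        -- completeness: whatever the prover's coins, its output is an accepted proof string
        (¬ I.HasZeroTriple → ∀ (t : ℕ), ∀ C ∈ ((I.start w P []).runDist w t).support,
          C.Halted → I.Accepts w V C.st.out) := by
  refine ⟨WordRAM.wordFactor d, WordRAM.verifier d, WordRAM.prover d, WordRAM.verifierTime d,
    WordRAM.proverTime d, WordRAM.verifier_deterministic d, WordRAM.verifierTime_isSoftO d,
    WordRAM.proverTime_isSoftO d, ?_⟩
  rintro n _ rfl I
  exact ⟨WordRAM.verifier_halts I, fun h π => WordRAM.verifier_sound I π h,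
    WordRAM.prover_expectedTime I, WordRAM.prover_complete I⟩
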